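/- Let $\mathbf{SU}(2)$ carry the left-invariant vector fields $X,Y,Z$ associated with the matrices $\begin{pmatrix}0&1\\-1&0\end{pmatrix}$, $\begin{pmatrix}0&i\\ i&0\end{pmatrix}$, $\begin{pmatrix}i&0\\0&-i\end{pmatrix}$, let $\mathcal L=X^2+Y^2$, and let $p_t$ ($t>0$) be the heat kernel of $e^{t\mathcal L}$ issued from the identity, with respect to the normalized Haar measure $\mu$; that is, $p_t$ is continuous and for all smooth $\varphi$ one has $\frac{d}{dt}\int\varphi\,p_t\,d\mu=\int(\mathcal L\varphi)\,p_t\,d\mu$ for $t>0$, and $\int\varphi\,p_t\,d\mu\to\varphi(1)$ as $t\to0^+$. Write $p_t(r,z)$ for its value at the point $$\exp(r\cos\vartheta\,X+r\sin\vartheta\,Y)\exp(zZ)=\begin{pmatrix}\cos r\,e^{iz}&\sin r\,e^{i(\vartheta-z)}\\-\sin r\,e^{-i(\vartheta-z)}&\cos r\,e^{-iz}\end{pmatrix},$$ which does not depend on $\vartheta\in\mathbb R$ (each assertion below holds for every $\vartheta$). 1. For $t>0$ and $z\in[0,\pi]$, $$p_t(0,z)=\frac{\pi^2e^t}{4t^2}\,e^{-\frac{2\pi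 z-z^2}{4t}}\sum_{k\in\mathbb Z}e^{-\frac{k(k+1)\pi^2}{t}}\,\frac{(2k+1)+2k\,e^{-\frac{\pi}{2t}(z+2k\pi)}}{\bigl(1+e^{-\frac{\pi}{2t}(z+2k\pi)}\bigr)^2},$$ the series being absolutely convergent. Consequently, for every $z\in(0,\pi]$ there is $C>0$ (depending on $z$) such that, as $t\to0^+$, $$p_t(0,z)=\frac{\pi^2e^t}{4t^2}\,e^{-\frac{2\pi z-z^2}{4t}}\bigl(1+O(e^{-C/t})\bigr).$$ 2. For $r\in(0,\frac\pi2)$, as $t\to0^+$, $$p_t(r,0)\sim\frac{r}{\sin r}\sqrt{\frac{1}{1-r\cot r}}\;\frac{\sqrt\pi\,e^{-\frac{r^2}{4t}}}{4t^{3/2}}.$$ 3. Let $r\in(0,\frac\pi2)$ and $z\in[-\pi,\pi]$. The equation $$\theta-z=\cos r\,\sin\theta\,\frac{\arccos(\cos\theta\cos r)}{\sqrt{1-\cos^2r\cos^2\theta}}$$ has a unique solution $\theta=\theta(r,z)$ in $[-\pi,\pi]$, and, with $u=\cos r\cos\theta(r,z)$, as $t\to0^+$, $$p_t(r,z)\sim\frac1{\sin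 r}\,\frac{\arccos u}{\sqrt{1-\frac{u\arccos u}{\sqrt{1-u^2}}}}\;\frac{\sqrt\pi\,e^{-\frac{d^2}{4t}}}{4t^{3/2}},\qquad d^2=\frac{(\theta(r,z)-z)^2\tan^2r}{\sin^2\theta(r,z)},$$ where for $\sin\theta(r,z)=0$ (that is, $z\in\{-\pi,0,\pi\}$) the quotient $d^2$, which reads $0/0$, stands for its limit value $(\arccos u)^2$. -/

import Mathlib

open Real Set Filter Topology MeasureTheory Asymptotics
open scoped ContDiff

/-- The group `SU(2)` of `2 × 2` complex unitary matrices of determinant `1`, with the topology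
induced by that of the matrices. -/
abbrev SU2 : Type := ↥(Matrix.specialUnitaryGroup (Fin 2) ℂ)

noncomputable section

instance SU2.instMeasurableSpace : MeasurableSpace SU2 := borel SU2

instance SU2.instBorelSpace : BorelSpace SU2 := ⟨rfl⟩

instance SU2.instIsTopologicalGroup : IsTopologicalGroup SU2 where
  continuous_mul := continuous_mul
  continuous_inv := by
    refine Continuous.subtype_mk ?_ _
    exact Continuous.star continuous_subtype_val

instance SU2.instCompactSpace : CompactSpace SU2 := by
  refine isCompact_iff_compactSpace.1 ?_
  have hK : IsCompact
      (Set.pi Set.univ fun _ : Fin 2 => Set.pi Set.univ fun _ : Fin 2 =>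
        Metric.closedBall (0 : ℂ) 1) :=
    isCompact_univ_pi fun _ => isCompact_univ_pi fun _ => isCompact_closedBall _ _
  have hcl : IsClosed
      ((Matrix.specialUnitaryGroup (Fin 2) ℂ : Set (Matrix (Fin 2) (Fin 2) ℂ))) := by
    have h : ((Matrix.specialUnitaryGroup (Fin 2) ℂ : Set (Matrix (Fin 2) (Fin 2) ℂ))) =
        {A | A * star A = 1} ∩ {A | A.det = 1} := by
      ext A
      simp [Matrix.mem_specialUnitaryGroup_iff, Matrix.mem_unitaryGroup_iff]
    rw [h]
    exact (isClosed_eq (continuous_id.mul continuous_id.star) continuous_const).inter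
      (isClosed_eq (Continuous.matrix_det continuous_id) continuous_const)
  refine hK.of_isClosed_subset hcl ?_
  intro A hA i _ j _
  rw [mem_closedBall_zero_iff]
  exact entry_norm_bound_of_unitary (Matrix.mem_specialUnitaryGroup_iff.1 hA).1 i j

/-- The bi-invariant Haar measure of `SU(2)`, normalized to have total mass `1`. -/
def SU2.haar : Measure SU2 := Measure.haarMeasure ⊤

theorem SU2.mem_of_row (a b : ℂ) (h : a * star a + b * star b = 1) :
    !![a, b; -star b, star a] ∈ Matrix.specialUnitaryGroup (Fin 2) ℂ := by
  rw [Matrix.mem_specialUnitaryGroup_iff, Matrix.mem_unitaryGroup_iff]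
  constructor
  · ext i j
    fin_cases i <;> fin_cases j <;>
      simp [Matrix.mul_apply, Fin.sum_univ_two, Matrix.star_apply] <;>
      simp only [Complex.star_def] at h
    · exact h
    · ring
    · ring
    · linear_combination h
  · rw [Matrix.det_fin_two_of]
    linear_combination h

theorem SU2.cyl_mem (r ϑ z : ℝ) :
    !![(cos r : ℂ) * Complex.exp (z * Complex.I),
        (sin r : ℂ) * Complex.exp ((ϑ - z) * Complex.I);
      -((sin r : ℂ) * Complex.exp (-((ϑ - z) * Complex.I))),
        (cos r : ℂ) * Complex.exp (-(z * Complex.I))] ∈ Matrix.specialUnitaryGroup (Fin 2) ℂ := by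
  have c1 : star ((cos r : ℂ) * Complex.exp (z * Complex.I)) =
      (cos r : ℂ) * Complex.exp (-(z * Complex.I)) := by
    rw [Complex.star_def, map_mul, ← Complex.exp_conj, Complex.conj_ofReal]; simp
  have c2 : star ((sin r : ℂ) * Complex.exp ((ϑ - z) * Complex.I)) =
      (sin r : ℂ) * Complex.exp (-((ϑ - z) * Complex.I)) := by
    rw [Complex.star_def, map_mul, ← Complex.exp_conj, Complex.conj_ofReal]; simp
  rw [← c1, ← c2]
  apply SU2.mem_of_row
  rw [c1, c2]
  have e1 : Complex.exp (z * Complex.I) * Complex.exp (-(z * Complex.I)) = 1 := by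
    rw [← Complex.exp_add]; simp
  have e2 : Complex.exp ((ϑ - z) * Complex.I) * Complex.exp (-((ϑ - z) * Complex.I)) = 1 := by
    rw [← Complex.exp_add]; simp
  have hcs : (cos r : ℂ) ^ 2 + (sin r : ℂ) ^ 2 = 1 := by
    rw [add_comm]; exact_mod_cast Real.sin_sq_add_cos_sq r
  linear_combination hcs + (cos r : ℂ) ^ 2 * e1 + (sin r : ℂ) ^ 2 * e2

/-- The point of `SU(2)` with cylindric coordinates `(r, ϑ, z)`, that is
`exp (r cos ϑ X + r sin ϑ Y) * exp (z Z)` for the Pauli matrices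
`X = (0, 1; -1, 0)`, `Y = (0, i; i, 0)` and `Z = (i, 0; 0, -i)`. -/
def SU2.cyl (r ϑ z : ℝ) : SU2 :=
  ⟨!![(cos r : ℂ) * Complex.exp (z * Complex.I),
        (sin r : ℂ) * Complex.exp ((ϑ - z) * Complex.I);
      -((sin r : ℂ) * Complex.exp (-((ϑ - z) * Complex.I))),
        (cos r : ℂ) * Complex.exp (-(z * Complex.I))], SU2.cyl_mem r ϑ z⟩

/-- A function on `SU(2)` is smooth when it is the restriction of a smooth function of the (real
vector space of) matrices; this is smoothness on the closed submanifold `SU(2)`. -/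
def SU2.IsSmooth (f : SU2 → ℝ) : Prop :=
  ∃ F : (Fin 2 → Fin 2 → ℂ) → ℝ, ContDiff ℝ ∞ F ∧ ∀ g : SU2, f g = F (fun i j => g.1 i j)

/-- The left-invariant vector field `X`: `(X f)(g) = d/ds f (g * exp (s X))` at `s = 0`, where
`exp (s X) = (cos s, sin s; -sin s, cos s)`. -/
def SU2.vfX (f : SU2 → ℝ) (g : SU2) : ℝ := deriv (fun s : ℝ => f (g * SU2.cyl s 0 0)) 0

/-- The left-invariant vector field `Y`: `(Y f)(g) = d/ds f (g * exp (s Y))` at `s = 0`, where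
`exp (s Y) = (cos s, i sin s; i sin s, cos s)`. -/
def SU2.vfY (f : SU2 → ℝ) (g : SU2) : ℝ := deriv (fun s : ℝ => f (g * SU2.cyl s (π / 2) 0)) 0

/-- The subelliptic operator `L = X² + Y²`. -/
def SU2.subLaplacian (f : SU2 → ℝ) (g : SU2) : ℝ :=
  SU2.vfX (SU2.vfX f) g + SU2.vfY (SU2.vfY f) g

/-- `p` is the heat kernel, issued from the identity, of the semigroup `exp (t L)` with respect to
the normalized Haar measure `μ`: each `p t`, `t > 0`, is continuous, and the functional
`φ ↦ ∫ φ p_t dμ = (exp (t L) φ) 1` on smooth functions satisfies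
`d/dt ∫ φ p_t dμ = ∫ (L φ) p_t dμ` for `t > 0` and `∫ φ p_t dμ → φ 1` as `t → 0+`.
In other words `p` is the fundamental solution of `∂p/∂t = L p` with `p_t μ → δ_1`. -/
structure SU2.IsHeatKernel (p : ℝ → SU2 → ℝ) : Prop where
  continuous : ∀ t : ℝ, 0 < t → Continuous (p t)
  heat_eq : ∀ φ : SU2 → ℝ, SU2.IsSmooth φ → ∀ t : ℝ, 0 < t →
    HasDerivAt (fun s : ℝ => ∫ g, φ g * p s g ∂SU2.haar)
      (∫ g, SU2.subLaplacian φ g * p t g ∂SU2.haar) t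
  initial : ∀ φ : SU2 → ℝ, SU2.IsSmooth φ →
    Tendsto (fun t : ℝ => ∫ g, φ g * p t g ∂SU2.haar) (𝓝[>] 0) (𝓝 (φ 1))

/-- `θ ∈ [-π, π]` solves the equation
`θ - z = cos r sin θ arccos (cos θ cos r) / √(1 - cos² r cos² θ)`. -/
def SU2.IsCriticalAngle (r z θ : ℝ) : Prop :=
  θ ∈ Icc (-π) π ∧
    θ - z = cos r * sin θ *
      (arccos (cos θ * cos r) / √(1 - cos r ^ 2 * cos θ ^ 2))

/-- The exponent `(θ - z)² tan² r / sin² θ`, where `θ` is the critical angle of `(r, z)`. If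
`sin θ = 0` (this is the case `z ∈ {-π, 0, π}`, `θ = z`) the quotient is `0 / 0`, and it is
replaced by its limit value `arccos (cos r cos θ)²`. -/
def SU2.expo (r z θ : ℝ) : ℝ :=
  if sin θ = 0 then arccos (cos r * cos θ) ^ 2
  else (θ - z) ^ 2 * tan r ^ 2 / sin θ ^ 2

end

/-! The sub-Laplacian is diagonalised by hand. The disc polynomials `disc p q` of the upper left
entry and its conjugate are eigenfunctions with eigenvalue `-(4pq + 2p + 2q)` (`subLaplacian_sph`),
so testing the heat equation against their left translates gives scalar linear differential
equations, which determine the corresponding moments of `p t`. The sums of the disc polynomials over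
`p + q = m` are the characters, that is, Chebyshev polynomials of the half trace. Expanding a peak
at the identity in characters recovers the continuous function `p t` pointwise as a series
(`IsHeatKernel.hasSum`); neither Peter-Weyl nor a regularity theorem is needed.

With `m = p + q` the eigenvalue of `-L` is `m (m + 2) - (p - q)²`. The factor `exp (t (p - q)²)` is
a Gaussian integral over a vertical line, and the remaining sum over `p + q = m` collapses to a
Chebyshev polynomial. Hence `p t` at `(r, z)` is the Gaussian average of the elliptic heat kernel
`qser` of `SU(2)`, continued to the complex half trace `cos r cos w` with `w` on the line
(`IsHeatKernel.eq_integral`). The line may have any real part `θ`, which plays the role of a contour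
shift. Poisson summation, through the functional equation of the theta function, turns `qser` at
`cos δ` into the image sum of `hker t (δ + 2kπ)` divided by `sin δ` (`hasSum_hker`).

On the axis `r = 0` one has `δ = w`, and for `θ = π/2` the denominator is `cosh y`. The quadratic
terms in `y` cancel, so each image contributes the Fourier transform of the hyperbolic secant and
its derivative. This is the exact series (`IsHeatKernel.hasSum_axis`), and comparing its terms gives
the exponentially small error (`abs_axisTerm_sub_le`).

For `0 < r < π/2` the line is put through the saddle point of `(w - z)² - arccos (cos r cos w)²`,
whose equation is that of the critical angle. Near the saddle the zeroth image dominates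
(`exists_norm_image_sum_sub_le`) and the phase is quadratic with positive curvature `curv`
(`phase_isLittleO`, `curv_pos`). Away from it the phase grows at least linearly (`exists_phase_ge`)
while the whole image sum obeys a uniform bound that survives the zeros of `sin δ`
(`exists_norm_image_sum_le`). Dominated convergence then gives `tendsto_integral_lapl`, hence the
asymptotics. The derivative of the saddle equation is again `curv`, so the critical angle is unique.
-/

namespace SU2

/-! ### Disc polynomials and their Chebyshev sums -/

/-- The disc (Zernike) polynomials in the two variables `A`, `B`, which are the spherical functions
`conj`-paired on the diagonal `B = conj A`. -/
noncomputable def disc (p q : ℕ) (A B : ℂ) : ℂ :=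
  ∑ i ∈ Finset.range (p + 1),
    ((-1) ^ i * (p.choose i : ℂ) * ((p + q - i).choose p : ℂ)) * (A ^ (p - i) * B ^ (q - i))

theorem disc_zero_left (q : ℕ) (A B : ℂ) : disc 0 q A B = B ^ q := by simp [disc]

theorem disc_zero_right (p : ℕ) (A B : ℂ) : disc p 0 A B = A ^ p := by
  rw [disc, Finset.sum_eq_single 0]
  · simp
  · intro i hi h0
    have : (p + 0 - i).choose p = 0 := by
      apply Nat.choose_eq_zero_of_lt
      have := Finset.mem_range.1 hi
      omega
    simp only [this]
    simp
  · simp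

/-- This recurrence is what makes the sum over a fixed degree satisfy the Chebyshev recurrence. It
comes from Pascal's rule on the coefficients. -/
theorem disc_succ_succ (p q : ℕ) (A B : ℂ) :
    disc (p + 1) (q + 1) A B = A * disc p (q + 1) A B + B * disc (p + 1) q A B - disc p q A B := by
  -- Pascal's rule on the second binomial, then on the first one in the part where `choose _ p`
  -- appears.
  have key : ∀ i, i ≤ p → ((p + 1).choose (i + 1) : ℂ) * ((p + q - i + 1).choose (p + 1) : ℂ)
      = (p.choose (i + 1)) * ((p + q - i).choose p)
        + ((p + 1).choose (i + 1)) * ((p + q - i).choose (p + 1))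
        + p.choose i * ((p + q - i).choose p) := by
    intro i hi
    norm_cast
    rw [Nat.choose_succ_succ (p + q - i) p, Nat.choose_succ_succ p i]
    ring
  have e1 : disc p (q + 1) A B = B ^ (q + 1) * A ^ p * ((p + q + 1).choose p : ℂ) +
      ∑ i ∈ Finset.range (p + 1), ((-1) ^ (i + 1) * (p.choose (i + 1) : ℂ) *
        ((p + q - i).choose p : ℂ)) * (A ^ (p - (i + 1)) * B ^ (q - i)) := by
    have : disc p (q + 1) A B = ∑ i ∈ Finset.range (p + 1 + 1),
        ((-1) ^ i * (p.choose i : ℂ) * ((p + (q + 1) - i).choose p : ℂ)) *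
          (A ^ (p - i) * B ^ (q + 1 - i)) := by
      rw [Finset.sum_range_succ, Nat.choose_succ_self]; simp [disc]
    rw [this, Finset.sum_range_succ']
    rw [add_comm]
    congr 1
    · simp; ring_nf
    · refine Finset.sum_congr rfl fun i hi => ?_
      rw [show p + (q + 1) - (i + 1) = p + q - i by omega, show q + 1 - (i + 1) = q - i by omega]
  have e2 : disc (p + 1) q A B = A ^ (p + 1) * B ^ q * ((p + 1 + q).choose (p + 1) : ℂ) +
      ∑ i ∈ Finset.range (p + 1), ((-1) ^ (i + 1) * ((p + 1).choose (i + 1) : ℂ) *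
        ((p + 1 + q - (i + 1)).choose (p + 1) : ℂ)) *
          (A ^ (p + 1 - (i + 1)) * B ^ (q - (i + 1))) := by
    rw [disc, Finset.sum_range_succ', add_comm]
    simp; ring_nf
  rw [e1, e2, disc, Finset.sum_range_succ', disc]
  have hA : A * ∑ i ∈ Finset.range (p + 1), ((-1) ^ (i + 1) * (p.choose (i + 1) : ℂ) *
        ((p + q - i).choose p : ℂ)) * (A ^ (p - (i + 1)) * B ^ (q - i)) =
      ∑ i ∈ Finset.range (p + 1), ((-1) ^ (i + 1) * (p.choose (i + 1) : ℂ) *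
        ((p + q - i).choose p : ℂ)) * (A ^ (p - i) * B ^ (q - i)) := by
    rw [Finset.mul_sum]
    refine Finset.sum_congr rfl fun i hi => ?_
    rcases Nat.lt_or_ge i p with h | h
    · rw [show p - i = p - (i + 1) + 1 by omega]; ring
    · rw [Nat.choose_eq_zero_of_lt (show p < i + 1 by omega)]; simp
  have hB : B * ∑ i ∈ Finset.range (p + 1), ((-1) ^ (i + 1) * ((p + 1).choose (i + 1) : ℂ) *
        ((p + 1 + q - (i + 1)).choose (p + 1) : ℂ)) * (A ^ (p + 1 - (i + 1)) * B ^ (q - (i + 1))) =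
      ∑ i ∈ Finset.range (p + 1), ((-1) ^ (i + 1) * ((p + 1).choose (i + 1) : ℂ) *
        ((p + q - i).choose (p + 1) : ℂ)) * (A ^ (p - i) * B ^ (q - i)) := by
    rw [Finset.mul_sum]
    refine Finset.sum_congr rfl fun i hi => ?_
    rw [show p + 1 + q - (i + 1) = p + q - i by omega, show p + 1 - (i + 1) = p - i by omega]
    rcases Nat.lt_or_ge i q with h | h
    · rw [show q - i = q - (i + 1) + 1 by omega]; ring
    · rw [Nat.choose_eq_zero_of_lt (show p + q - i < p + 1 by omega)]; simp
  rw [mul_add, mul_add, hA, hB]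
  have h0 : ((p + 1 + (q + 1)).choose (p + 1) : ℂ) =
      ((p + q + 1).choose p : ℂ) + ((p + 1 + q).choose (p + 1) : ℂ) := by
    norm_cast
    rw [show p + 1 + (q + 1) = (p + q + 1) + 1 by ring, Nat.choose_succ_succ,
      show p + 1 + q = p + q + 1 by ring]
  have hS : ∑ i ∈ Finset.range (p + 1), ((-1) ^ (i + 1) * ((p + 1).choose (i + 1) : ℂ) *
        ((p + 1 + (q + 1) - (i + 1)).choose (p + 1) : ℂ)) *
          (A ^ (p + 1 - (i + 1)) * B ^ (q + 1 - (i + 1))) =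
      ∑ i ∈ Finset.range (p + 1), ((-1) ^ (i + 1) * (p.choose (i + 1) : ℂ) *
        ((p + q - i).choose p : ℂ)) * (A ^ (p - i) * B ^ (q - i)) +
      ∑ i ∈ Finset.range (p + 1), ((-1) ^ (i + 1) * ((p + 1).choose (i + 1) : ℂ) *
        ((p + q - i).choose (p + 1) : ℂ)) * (A ^ (p - i) * B ^ (q - i)) -
      ∑ i ∈ Finset.range (p + 1), ((-1) ^ i * (p.choose i : ℂ) *
        ((p + q - i).choose p : ℂ)) * (A ^ (p - i) * B ^ (q - i)) := by
    rw [← Finset.sum_add_distrib, ← Finset.sum_sub_distrib]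
    refine Finset.sum_congr rfl fun i hi => ?_
    have hi' : i ≤ p := Nat.lt_succ_iff.1 (Finset.mem_range.1 hi)
    rw [show p + 1 + (q + 1) - (i + 1) = p + q - i + 1 by omega,
      show p + 1 - (i + 1) = p - i by omega, show q + 1 - (i + 1) = q - i by omega]
    linear_combination ((-1) ^ (i + 1) * (A ^ (p - i) * B ^ (q - i))) * key i hi'
  rw [hS]
  simp only [Nat.sub_zero, pow_zero, Nat.choose_zero_right, Nat.cast_one, h0]
  ring

/-- The sum of the disc polynomials of degree `m`: a Chebyshev polynomial of `A + B`. -/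
noncomputable def chi (m : ℕ) (A B : ℂ) : ℂ :=
  ∑ x ∈ Finset.HasAntidiagonal.antidiagonal m, disc x.1 x.2 A B

theorem chi_zero (A B : ℂ) : chi 0 A B = 1 := by simp [chi, disc]

theorem chi_one (A B : ℂ) : chi 1 A B = A + B := by
  simp [chi, Finset.Nat.antidiagonal_succ, disc_zero_left, disc_zero_right, add_comm]

theorem chi_add_two (m : ℕ) (A B : ℂ) :
    chi (m + 2) A B = (A + B) * chi (m + 1) A B - chi m A B := by
  have h1 : chi (m + 2) A B = B ^ (m + 2) + A ^ (m + 2) +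
      ∑ x ∈ Finset.HasAntidiagonal.antidiagonal m, disc (x.1 + 1) (x.2 + 1) A B := by
    rw [chi, Finset.Nat.antidiagonal_succ_succ']
    simp [disc_zero_left, disc_zero_right]
    ring
  have h2 : chi (m + 1) A B = B ^ (m + 1) +
      ∑ x ∈ Finset.HasAntidiagonal.antidiagonal m, disc (x.1 + 1) x.2 A B := by
    rw [chi, Finset.Nat.antidiagonal_succ]
    simp [disc_zero_left]
  have h3 : chi (m + 1) A B = A ^ (m + 1) +
      ∑ x ∈ Finset.HasAntidiagonal.antidiagonal m, disc x.1 (x.2 + 1) A B := by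
    rw [chi, Finset.Nat.antidiagonal_succ']
    simp [disc_zero_right]
  rw [h1, add_mul]
  nth_rewrite 1 [h3]
  rw [h2]
  simp only [disc_succ_succ, Finset.sum_add_distrib, Finset.sum_sub_distrib, ← Finset.mul_sum]
  rw [chi]
  ring

/-- The recurrence involves only `A + B`, so the two arguments may be replaced by any pair with the
same sum. Choosing such pairs cleverly is used repeatedly: a pair with product `1` makes each `disc`
a monomial, and a pair `c e^{iw}, c e^{-iw}` replaces two equal arguments `c cos w`. -/
theorem chi_congr (m : ℕ) {A B A' B' : ℂ} (h : A + B = A' + B') : chi m A B = chi m A' B' := by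
  induction m using Nat.twoStepInduction with
  | zero => simp [chi_zero]
  | one => simp [chi_one, h]
  | more m h1 h2 => rw [chi_add_two, chi_add_two, h1, h2, h]

theorem disc_of_mul_eq_one (p q : ℕ) {A B : ℂ} (h : A * B = 1) :
    disc p q A B = A ^ p * B ^ q := by
  induction p generalizing q with
  | zero => simp [disc_zero_left]
  | succ p ih =>
    induction q with
    | zero => simp [disc_zero_right]
    | succ q ihq =>
      rw [disc_succ_succ, ih, ih, ihq]
      linear_combination (A ^ p * B ^ q) * h

theorem disc_mul_mul (p q : ℕ) (A B : ℂ) {e e' : ℂ} (h : e * e' = 1) :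
    disc p q (A * e) (B * e') = e ^ p * e' ^ q * disc p q A B := by
  rw [disc, disc, Finset.mul_sum]
  refine Finset.sum_congr rfl fun i hi => ?_
  have hi' : i ≤ p := Nat.lt_succ_iff.1 (Finset.mem_range.1 hi)
  -- For `q < i` the exponent `q - i` is truncated, but the second binomial coefficient vanishes.
  rcases Nat.lt_or_ge q i with hq | hq
  · rw [Nat.choose_eq_zero_of_lt (show p + q - i < p by omega)]; simp
  · obtain ⟨p', rfl⟩ := Nat.exists_eq_add_of_le hi'
    obtain ⟨q', rfl⟩ := Nat.exists_eq_add_of_le hq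
    have : e ^ i * e' ^ i = 1 := by rw [← mul_pow, h, one_pow]
    simp only [Nat.add_sub_cancel_left, mul_pow, pow_add]
    linear_combination (-1 : ℂ) * ((-1) ^ i * ((i + p').choose i : ℂ) *
      ((i + p' + (i + q') - i).choose (i + p') : ℂ)) * (A ^ p' * e ^ p' * (B ^ q' * e' ^ q')) * this

theorem conj_disc (p q : ℕ) (A B : ℂ) :
    (starRingEnd ℂ) (disc p q A B) = disc p q ((starRingEnd ℂ) A) ((starRingEnd ℂ) B) := by
  simp [disc, map_sum]

theorem chi_exp (m : ℕ) (δ : ℂ) {A B : ℂ} (h : A + B = 2 * Complex.cos δ) :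
    chi m A B = ∑ x ∈ Finset.HasAntidiagonal.antidiagonal m,
      Complex.exp (((x.1 : ℂ) - x.2) * (δ * Complex.I)) := by
  have h2 : Complex.exp (δ * Complex.I) * Complex.exp (-(δ * Complex.I)) = 1 := by
    rw [← Complex.exp_add]; simp
  rw [chi_congr m (A' := Complex.exp (δ * Complex.I)) (B' := Complex.exp (-(δ * Complex.I))), chi]
  · refine Finset.sum_congr rfl fun x _ => ?_
    rw [disc_of_mul_eq_one _ _ h2, ← Complex.exp_nat_mul, ← Complex.exp_nat_mul, ← Complex.exp_add]
    ring_nf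
  · rw [h, Complex.cos]; ring_nf

theorem sin_mul_chi (m : ℕ) (δ : ℂ) {A B : ℂ} (h : A + B = 2 * Complex.cos δ) :
    Complex.sin δ * chi m A B = Complex.sin ((m + 1) * δ) := by
  induction m using Nat.twoStepInduction with
  | zero => simp [chi_zero]
  | one =>
    rw [chi_one, h]; push_cast
    rw [show ((1 : ℂ) + 1) * δ = 2 * δ by ring, Complex.sin_two_mul]; ring
  | more m h1 h2 =>
    rw [chi_add_two, mul_sub, h1, h]
    push_cast at h2 ⊢
    rw [show Complex.sin δ * (2 * Complex.cos δ * chi (m + 1) A B) =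
      2 * Complex.cos δ * (Complex.sin δ * chi (m + 1) A B) by ring, h2,
      show (m + 2 + 1 : ℂ) * δ = (m + 1 + 1) * δ + δ by ring,
      show (m + 1 : ℂ) * δ = (m + 1 + 1) * δ - δ by ring, Complex.sin_sub, Complex.sin_add]
    ring

/-! ### Disc polynomials as eigenfunctions of the sub-Laplacian -/

/-- The upper left entry of an element of `SU(2)`. -/
noncomputable def ent (g : SU2) : ℂ := g.1 0 0

/-- The disc polynomials as real functions on `SU(2)`. -/
noncomputable def sph (p q : ℕ) (g : SU2) : ℝ :=
  (disc p q (ent g) ((starRingEnd ℂ) (ent g))).re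

/-- For fixed `ϑ` the points with `z = 0` form a one-parameter subgroup, so an iterated horizontal
derivative is a second derivative along a single curve. -/
theorem cyl_mul_cyl (s σ ϑ : ℝ) : cyl s ϑ 0 * cyl σ ϑ 0 = cyl (s + σ) ϑ 0 := by
  have e2 : Complex.exp (ϑ * Complex.I) * Complex.exp (-(ϑ * Complex.I)) = 1 := by
    rw [← Complex.exp_add]; simp
  apply Subtype.ext
  ext i j
  fin_cases i <;> fin_cases j <;>
    simp [cyl, Complex.cos_add, Complex.sin_add]
  · linear_combination (-Complex.sin s * Complex.sin σ) * e2
  · ring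
  · ring
  · linear_combination (-Complex.sin s * Complex.sin σ) * e2

theorem row_eq (g : SU2) : g.1 0 0 * (starRingEnd ℂ) (g.1 0 0) +
    g.1 0 1 * (starRingEnd ℂ) (g.1 0 1) = 1 := by
  have h := (Matrix.mem_unitaryGroup_iff.1 (Matrix.mem_specialUnitaryGroup_iff.1 g.2).1)
  have := congrFun (congrFun h 0) 0
  simpa [Matrix.mul_apply, Fin.sum_univ_two, Matrix.star_apply] using this

theorem vfX_vfX (f : SU2 → ℝ) (g : SU2) :
    vfX (vfX f) g = deriv (deriv (fun s => f (g * cyl s 0 0))) 0 := by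
  rw [vfX]
  congr 1
  funext s
  simp only [vfX, mul_assoc, cyl_mul_cyl]
  rw [deriv_comp_const_add (f := fun s => f (g * cyl s 0 0)), add_zero]

theorem vfY_vfY (f : SU2 → ℝ) (g : SU2) :
    vfY (vfY f) g = deriv (deriv (fun s => f (g * cyl s (π / 2) 0))) 0 := by
  rw [vfY]
  congr 1
  funext s
  simp only [vfY, mul_assoc, cyl_mul_cyl]
  rw [deriv_comp_const_add (f := fun s => f (g * cyl s (π / 2) 0)), add_zero]

theorem subLaplacian_mul_left (f : SU2 → ℝ) (h g : SU2) :
    subLaplacian (fun g => f (h * g)) g = subLaplacian f (h * g) := by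
  simp only [subLaplacian, vfX, vfY, mul_assoc]

theorem ent_mul_cyl (g : SU2) (s ϑ : ℝ) : ent (g * cyl s ϑ 0) =
    g.1 0 0 * Complex.cos s + (-g.1 0 1 * Complex.exp (-(ϑ * Complex.I))) * Complex.sin s := by
  simp [ent, cyl, Matrix.mul_apply, Fin.sum_univ_two]
  ring

theorem conj_ent_mul_cyl (g : SU2) (s ϑ : ℝ) : (starRingEnd ℂ) (ent (g * cyl s ϑ 0)) =
    (starRingEnd ℂ) (g.1 0 0) * Complex.cos s +
      (-(starRingEnd ℂ) (g.1 0 1) * Complex.exp (ϑ * Complex.I)) * Complex.sin s := by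
  rw [ent_mul_cyl]
  simp [← Complex.exp_conj, ← Complex.cos_conj, ← Complex.sin_conj]

section Curve

variable (a b : ℂ)

/-- The curve `a cos s + b sin s`. -/
noncomputable def curve (s : ℝ) : ℂ := a * Complex.cos s + b * Complex.sin s

theorem hasDerivAt_curve (s : ℝ) : HasDerivAt (curve a b) (curve b (-a) s) s := by
  have h1 : HasDerivAt (fun s : ℝ => Complex.cos s) (-Complex.sin s) s :=
    (Complex.hasDerivAt_cos _).comp_ofReal
  have h2 : HasDerivAt (fun s : ℝ => Complex.sin s) (Complex.cos s) s :=
    (Complex.hasDerivAt_sin _).comp_ofReal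
  refine ((h1.const_mul a).fun_add (h2.const_mul b)).congr_deriv ?_
  rw [curve]; ring

theorem curve_zero : curve a b 0 = a := by simp [curve]

variable (a' b' : ℂ)

/-- The first derivative of `disc p q` along a pair of curves. -/
noncomputable def discD (p q : ℕ) (s : ℝ) : ℂ :=
  ∑ i ∈ Finset.range (p + 1),
    ((-1) ^ i * (p.choose i : ℂ) * ((p + q - i).choose p : ℂ)) *
      ((((p - i : ℕ) : ℂ) * curve a b s ^ (p - i - 1) * curve b (-a) s) * curve a' b' s ^ (q - i) +
        curve a b s ^ (p - i) *
          (((q - i : ℕ) : ℂ) * curve a' b' s ^ (q - i - 1) * curve b' (-a') s))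

theorem hasDerivAt_disc (p q : ℕ) (s : ℝ) :
    HasDerivAt (fun s => disc p q (curve a b s) (curve a' b' s)) (discD a b a' b' p q s) s := by
  unfold disc discD
  refine HasDerivAt.fun_sum fun i _ => ?_
  refine HasDerivAt.const_mul _ ?_
  exact ((hasDerivAt_curve a b s).fun_pow _).mul ((hasDerivAt_curve a' b' s).fun_pow _)

/-- The second derivative at `0` of the monomial `A ^ p * B ^ q` along a pair of curves. -/
noncomputable def monoDD (p q : ℕ) : ℂ :=
  (p : ℂ) * ((p - 1 : ℕ) : ℂ) * a ^ (p - 1 - 1) * b ^ 2 * a' ^ q - p * a ^ (p - 1) * a * a' ^ q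
    + 2 * (p * a ^ (p - 1) * b * (q * a' ^ (q - 1) * b'))
    + a ^ p * (q * ((q - 1 : ℕ) : ℂ) * a' ^ (q - 1 - 1) * b' ^ 2) - a ^ p * (q * a' ^ (q - 1) * a')

theorem hasDerivAt_discD (p q : ℕ) :
    HasDerivAt (discD a b a' b' p q) (∑ i ∈ Finset.range (p + 1),
      ((-1) ^ i * (p.choose i : ℂ) * ((p + q - i).choose p : ℂ)) *
        monoDD a b a' b' (p - i) (q - i)) 0 := by
  unfold discD
  refine HasDerivAt.fun_sum fun i _ => ?_
  refine HasDerivAt.const_mul _ ?_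
  have hA := hasDerivAt_curve a b 0
  have hB := hasDerivAt_curve a' b' 0
  have hA' := hasDerivAt_curve b (-a) 0
  have hB' := hasDerivAt_curve b' (-a') 0
  refine HasDerivAt.congr_deriv (((((hA.fun_pow (p - i - 1)).const_mul ((p - i : ℕ) : ℂ)).mul hA').mul
    (hB.fun_pow (q - i))).add
    ((hA.fun_pow (p - i)).mul
      (((hB.fun_pow (q - i - 1)).const_mul ((q - i : ℕ) : ℂ)).mul hB'))) ?_
  simp only [curve_zero, monoDD, Pi.mul_apply]
  ring

end Curve

/-- The two directions differ by the factors `-I` on `b` and `I` on `b'`. In the sum the terms in `b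
^ 2` and `b' ^ 2` cancel, the mixed terms double, and `h` replaces `b * b'` by `1 - a * a'`. So on
monomials the operator is triangular, with a single lower term. -/
theorem monoDD_add (p q : ℕ) (a a' b b' : ℂ) (h : a * a' + b * b' = 1) :
    monoDD a b a' b' p q + monoDD a (-Complex.I * b) a' (Complex.I * b') p q =
      -((4 * p * q + 2 * p + 2 * q) * (a ^ p * a' ^ q)) +
        4 * p * q * (a ^ (p - 1) * a' ^ (q - 1)) := by
  have hI : Complex.I ^ 2 = -1 := Complex.I_sq
  have hp : (p : ℂ) * a ^ (p - 1) * a = p * a ^ p := by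
    rcases p with _ | p
    · simp
    · simp only [Nat.add_sub_cancel]; ring
  have hq : (q : ℂ) * a' ^ (q - 1) * a' = q * a' ^ q := by
    rcases q with _ | q
    · simp
    · simp only [Nat.add_sub_cancel]; ring
  unfold monoDD
  generalize a ^ (p - 1 - 1) = u at *
  generalize a' ^ (q - 1 - 1) = v at *
  generalize a ^ (p - 1) = x at *
  generalize a' ^ (q - 1) = y at *
  generalize a ^ p = X at *
  generalize a' ^ q = Y at *
  generalize ((p - 1 : ℕ) : ℂ) = P at *
  generalize ((q - 1 : ℕ) : ℂ) = Q at *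
  linear_combination (p * P * u * b ^ 2 * Y + X * q * Q * v * b' ^ 2 - 2 * p * q * x * y * b * b') * hI
    + (4 * p * q * x * y) * h - 2 * Y * hp - 2 * X * hq - 4 * q * y * a' * hp - 4 * p * X * hq

theorem sum_monoDD (p q : ℕ) (a a' b b' : ℂ) (h : a * a' + b * b' = 1) :
    (∑ i ∈ Finset.range (p + 1), ((-1) ^ i * (p.choose i : ℂ) * ((p + q - i).choose p : ℂ)) *
        monoDD a b a' b' (p - i) (q - i)) +
      (∑ i ∈ Finset.range (p + 1), ((-1) ^ i * (p.choose i : ℂ) * ((p + q - i).choose p : ℂ)) *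
        monoDD a (-Complex.I * b) a' (Complex.I * b') (p - i) (q - i)) =
    -(4 * p * q + 2 * p + 2 * q) * disc p q a a' := by
  rw [← Finset.sum_add_distrib, disc, Finset.mul_sum, ← sub_eq_zero, ← Finset.sum_sub_distrib]
  -- The factor `4 i (p + q + 1 - i)` is the difference between the eigenvalues of the leading
  -- monomial and of the `i`-th one. The coefficients of `disc` are exactly those for which it
  -- cancels the lower term coming from index `i - 1`, so the sum telescopes between `c 0 = 0` and
  -- `c (p + 1) = 0`.
  set c : ℕ → ℂ := fun i => 4 * i * (p + q + 1 - i) *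
    ((-1) ^ i * (p.choose i : ℂ) * ((p + q - i).choose p : ℂ)) with hc
  have hrec : ∀ i, i ≤ p → c (i + 1) = -(4 * ((p - i : ℕ) : ℂ) * ((q - i : ℕ) : ℂ) *
      ((-1) ^ i * (p.choose i : ℂ) * ((p + q - i).choose p : ℂ))) := by
    intro i hi
    have h1 : (p.choose (i + 1) : ℂ) * (i + 1) = p.choose i * ((p - i : ℕ) : ℂ) := by
      exact_mod_cast Nat.choose_succ_right_eq p i
    -- When `p + q - i = 0` the subtraction `p + q - (i + 1)` is truncated and the binomial
    -- recurrence below would not apply.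
    rcases Nat.eq_zero_or_pos (p + q - i) with h0 | h0
    · have hpi : p - i = 0 := by omega
      rw [hpi] at h1 ⊢
      have : (p.choose (i + 1) : ℂ) = 0 := by
        rw [Nat.choose_eq_zero_of_lt (by omega)]; simp
      simp [hc, this]
    · have h2 : ((p + q - (i + 1)).choose p : ℂ) * (p + q - i) =
          (p + q - i).choose p * ((q - i : ℕ) : ℂ) := by
        obtain ⟨n, hn⟩ : ∃ n, p + q - i = n + 1 := ⟨p + q - i - 1, by omega⟩
        have := Nat.choose_mul_succ_eq n p
        rw [hn, show p + q - (i + 1) = n by omega, show q - i = n + 1 - p by omega]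
        have hn' : (p : ℂ) + q - i = n + 1 := by
          have : p + q = n + 1 + i := by omega
          have : (p : ℂ) + q = n + 1 + i := by exact_mod_cast this
          rw [this]; ring
        rw [hn']
        exact_mod_cast this
      simp only [hc]
      push_cast
      linear_combination (-4 * (-1) ^ i * ((p + q - (i + 1)).choose p : ℂ) * (p + q - i)) * h1
        - (4 * (-1) ^ i * (p.choose i : ℂ) * ((p - i : ℕ) : ℂ)) * h2
  have hterm : ∀ i ∈ Finset.range (p + 1),
      (((-1) ^ i * (p.choose i : ℂ) * ((p + q - i).choose p : ℂ)) * monoDD a b a' b' (p - i) (q - i)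
        + ((-1) ^ i * (p.choose i : ℂ) * ((p + q - i).choose p : ℂ)) *
          monoDD a (-Complex.I * b) a' (Complex.I * b') (p - i) (q - i)) -
      -(4 * p * q + 2 * p + 2 * q) *
        (((-1) ^ i * (p.choose i : ℂ) * ((p + q - i).choose p : ℂ)) *
          (a ^ (p - i) * a' ^ (q - i))) =
      c i * (a ^ (p - i) * a' ^ (q - i)) - c (i + 1) * (a ^ (p - (i + 1)) * a' ^ (q - (i + 1))) := by
    intro i hi
    have hi' : i ≤ p := Nat.lt_succ_iff.1 (Finset.mem_range.1 hi)
    rw [← mul_add, monoDD_add _ _ _ _ _ _ h, hrec i hi']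
    rcases Nat.lt_or_ge q i with hq | hq
    · have : ((p + q - i).choose p : ℂ) = 0 := by
        rw [Nat.choose_eq_zero_of_lt (by omega)]; simp
      simp [hc, this]
    · simp only [Nat.sub_sub, hc]
      push_cast [hi', hq]
      ring
  rw [Finset.sum_congr rfl hterm, Finset.sum_range_sub']
  have : c (p + 1) = 0 := by rw [hrec p le_rfl]; simp
  rw [this]
  simp [hc]

theorem hasDerivAt_re {f : ℝ → ℂ} {f' : ℂ} {x : ℝ} (h : HasDerivAt f f' x) :
    HasDerivAt (fun s => (f s).re) f'.re x :=
  (Complex.reCLM.hasFDerivAt (x := f x)).comp_hasDerivAt x h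

theorem sph_mul_cyl (p q : ℕ) (g : SU2) (s ϑ : ℝ) : sph p q (g * cyl s ϑ 0) =
    (disc p q (curve (g.1 0 0) (-g.1 0 1 * Complex.exp (-(ϑ * Complex.I))) s)
      (curve ((starRingEnd ℂ) (g.1 0 0))
        (-(starRingEnd ℂ) (g.1 0 1) * Complex.exp (ϑ * Complex.I)) s)).re := by
  rw [sph, conj_ent_mul_cyl, ent_mul_cyl]; rfl

theorem hasDerivAt_sph (p q : ℕ) (g : SU2) (s ϑ : ℝ) :
    HasDerivAt (fun s => sph p q (g * cyl s ϑ 0))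
      (discD (g.1 0 0) (-g.1 0 1 * Complex.exp (-(ϑ * Complex.I))) ((starRingEnd ℂ) (g.1 0 0))
        (-(starRingEnd ℂ) (g.1 0 1) * Complex.exp (ϑ * Complex.I)) p q s).re s := by
  simp only [sph_mul_cyl]
  exact hasDerivAt_re (hasDerivAt_disc _ _ _ _ p q s)

theorem deriv_deriv_sph (p q : ℕ) (g : SU2) (ϑ : ℝ) :
    deriv (deriv (fun s => sph p q (g * cyl s ϑ 0))) 0 =
    (∑ i ∈ Finset.range (p + 1), ((-1) ^ i * (p.choose i : ℂ) * ((p + q - i).choose p : ℂ)) *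
        monoDD (g.1 0 0) (-g.1 0 1 * Complex.exp (-(ϑ * Complex.I))) ((starRingEnd ℂ) (g.1 0 0))
        (-(starRingEnd ℂ) (g.1 0 1) * Complex.exp (ϑ * Complex.I)) (p - i) (q - i)).re := by
  have h : deriv (fun s => sph p q (g * cyl s ϑ 0)) = fun s =>
      (discD (g.1 0 0) (-g.1 0 1 * Complex.exp (-(ϑ * Complex.I))) ((starRingEnd ℂ) (g.1 0 0))
        (-(starRingEnd ℂ) (g.1 0 1) * Complex.exp (ϑ * Complex.I)) p q s).re :=
    funext fun s => (hasDerivAt_sph p q g s ϑ).deriv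
  rw [h]
  exact (hasDerivAt_re (hasDerivAt_discD _ _ _ _ p q)).deriv

theorem subLaplacian_sph (p q : ℕ) (g : SU2) :
    subLaplacian (sph p q) g = -(4 * p * q + 2 * p + 2 * q) * sph p q g := by
  rw [subLaplacian, vfX_vfX, vfY_vfY, deriv_deriv_sph, deriv_deriv_sph, ← Complex.add_re]
  have e1 : Complex.exp (-(((π / 2 : ℝ) : ℂ) * Complex.I)) = -Complex.I := by
    rw [← neg_mul, Complex.exp_mul_I]; simp
  have e2 : Complex.exp (((π / 2 : ℝ) : ℂ) * Complex.I) = Complex.I := by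
    rw [Complex.exp_mul_I, ← Complex.ofReal_cos, ← Complex.ofReal_sin]; simp
  have := sum_monoDD p q (g.1 0 0) ((starRingEnd ℂ) (g.1 0 0)) (-g.1 0 1)
    (-(starRingEnd ℂ) (g.1 0 1)) (by rw [neg_mul_neg]; exact row_eq g)
  rw [e1, e2]
  simp only [Complex.ofReal_zero, zero_mul, neg_zero, Complex.exp_zero, mul_one]
  rw [mul_comm (-g.1 0 1) (-Complex.I), mul_comm (-(starRingEnd ℂ) (g.1 0 1)) Complex.I, this, sph]
  have : (-(4 * p * q + 2 * p + 2 * q) : ℂ) = ((-(4 * p * q + 2 * p + 2 * q) : ℝ) : ℂ) := by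
    push_cast; ring
  rw [this, Complex.re_ofReal_mul]; rfl

theorem isSmooth_sph_mul_left (p q : ℕ) (h : SU2) : IsSmooth (fun g => sph p q (h * g)) := by
  refine ⟨fun M => (disc p q (h.1 0 0 * M 0 0 + h.1 0 1 * M 1 0)
    ((starRingEnd ℂ) (h.1 0 0 * M 0 0 + h.1 0 1 * M 1 0))).re, ?_, ?_⟩
  · have hp : ∀ i j, ContDiff ℝ ∞ (fun M : Fin 2 → Fin 2 → ℂ => M i j) := fun i j =>
      contDiff_apply_apply ℝ ℂ i j
    have h1 : ContDiff ℝ ∞ (fun M : Fin 2 → Fin 2 → ℂ => h.1 0 0 * M 0 0 + h.1 0 1 * M 1 0) :=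
      (contDiff_const.mul (hp 0 0)).add (contDiff_const.mul (hp 1 0))
    have h2 : ContDiff ℝ ∞ (fun M : Fin 2 → Fin 2 → ℂ =>
        (starRingEnd ℂ) (h.1 0 0 * M 0 0 + h.1 0 1 * M 1 0)) :=
      Complex.conjCLE.contDiff.comp h1
    refine Complex.reCLM.contDiff.comp ?_
    unfold disc
    exact ContDiff.sum fun i _ => contDiff_const.mul ((h1.pow _).mul (h2.pow _))
  · intro g
    simp [sph, ent, Matrix.mul_apply, Fin.sum_univ_two]

/-! ### Haar integration and orthogonality of the characters -/

theorem continuous_ent : Continuous ent := by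
  unfold ent
  exact (continuous_apply_apply (0 : Fin 2) (0 : Fin 2)).comp continuous_subtype_val

theorem continuous_sph (p q : ℕ) : Continuous (sph p q) := by
  unfold sph disc
  have := continuous_ent
  have h2 : Continuous fun g => (starRingEnd ℂ) (ent g) := Complex.continuous_conj.comp this
  refine Complex.continuous_re.comp ?_
  fun_prop

instance : IsProbabilityMeasure haar :=
  ⟨by unfold haar; exact Measure.haarMeasure_self (K₀ := (⊤ : TopologicalSpace.PositiveCompacts SU2))⟩

instance : Measure.IsHaarMeasure haar := by unfold haar; infer_instance

/-- The image measure is again a Haar probability measure, hence equal to `haar` by uniqueness. -/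
theorem map_mul_right_haar (h : SU2) : Measure.map (fun g => g * h) haar = haar := by
  have : IsProbabilityMeasure (Measure.map (fun g => g * h) haar) :=
    Measure.isProbabilityMeasure_map (by fun_prop)
  exact Measure.isHaarMeasure_eq_of_isProbabilityMeasure _ _

theorem integral_mul_right (f : SU2 → ℝ) (hf : Continuous f) (h : SU2) :
    ∫ g, f (g * h) ∂haar = ∫ g, f g ∂haar := by
  conv_rhs => rw [← map_mul_right_haar h]
  rw [integral_map (by fun_prop) hf.aestronglyMeasurable]

theorem integrable_of_continuous {f : SU2 → ℝ} (hf : Continuous f) : Integrable f haar :=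
  integrableOn_univ.1 (hf.continuousOn.integrableOn_compact isCompact_univ)

/-- Differentiate under the integral sign the identity that the integral of a right translate along
the subgroup is constant. -/
theorem integral_derivation_eq_zero {f f' : SU2 → ℝ} (hf : Continuous f) (hf' : Continuous f')
    (ϑ : ℝ) (h : ∀ g, HasDerivAt (fun s => f (g * cyl s ϑ 0)) (f' g) 0) :
    ∫ g, f' g ∂haar = 0 := by
  have hs : ∀ g s, HasDerivAt (fun s => f (g * cyl s ϑ 0)) (f' (g * cyl s ϑ 0)) s := by
    intro g s
    have := h (g * cyl s ϑ 0)
    simp only [mul_assoc, cyl_mul_cyl] at this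
    rw [show s = s + 0 by simp]
    have h2 := HasDerivAt.comp_sub_const (f := fun σ => f (g * cyl (s + σ) ϑ 0)) s s (by simpa using this)
    simpa using h2
  obtain ⟨M, hM⟩ : ∃ M, ∀ g, ‖f' g‖ ≤ M := by
    obtain ⟨M, hM⟩ := (isCompact_univ (X := SU2)).exists_bound_of_continuousOn hf'.continuousOn
    exact ⟨M, fun g => hM g (mem_univ _)⟩
  have key := (hasDerivAt_integral_of_dominated_loc_of_deriv_le (μ := haar) (x₀ := (0 : ℝ))
    (F := fun s g => f (g * cyl s ϑ 0)) (F' := fun s g => f' (g * cyl s ϑ 0))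
    (bound := fun _ => M) (s := univ) univ_mem
    (Eventually.of_forall fun s => (by fun_prop : Continuous fun g => f (g * cyl s ϑ 0)).aestronglyMeasurable)
    (integrable_of_continuous (by fun_prop))
    (by fun_prop : Continuous fun g => f' (g * cyl 0 ϑ 0)).aestronglyMeasurable
    (Eventually.of_forall fun g s _ => hM _) (integrable_const M)
    (Eventually.of_forall fun g s _ => hs g s)).2
  simp only [integral_mul_right f hf, integral_mul_right f' hf'] at key
  exact key.unique (hasDerivAt_const _ _)

/-- The derivative of `sph p q` in the horizontal direction `ϑ`. -/
noncomputable def sphD (p q : ℕ) (ϑ : ℝ) (g : SU2) : ℝ :=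
  (discD (g.1 0 0) (-g.1 0 1 * Complex.exp (-(ϑ * Complex.I))) ((starRingEnd ℂ) (g.1 0 0))
        (-(starRingEnd ℂ) (g.1 0 1) * Complex.exp (ϑ * Complex.I)) p q 0).re

/-- The second derivative of `sph p q` in the horizontal direction `ϑ`. -/
noncomputable def sphDD (p q : ℕ) (ϑ : ℝ) (g : SU2) : ℝ :=
  (∑ i ∈ Finset.range (p + 1), ((-1) ^ i * (p.choose i : ℂ) * ((p + q - i).choose p : ℂ)) *
        monoDD (g.1 0 0) (-g.1 0 1 * Complex.exp (-(ϑ * Complex.I))) ((starRingEnd ℂ) (g.1 0 0))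
        (-(starRingEnd ℂ) (g.1 0 1) * Complex.exp (ϑ * Complex.I)) (p - i) (q - i)).re

theorem continuous_entry (i j : Fin 2) : Continuous fun g : SU2 => g.1 i j :=
  (continuous_apply_apply i j).comp continuous_subtype_val

theorem continuous_conj_entry (i j : Fin 2) :
    Continuous fun g : SU2 => (starRingEnd ℂ) (g.1 i j) :=
  Complex.continuous_conj.comp (continuous_entry i j)

theorem continuous_sphD (p q : ℕ) (ϑ : ℝ) : Continuous (sphD p q ϑ) := by
  have key : ∀ a b a' b' : SU2 → ℂ, Continuous a → Continuous b → Continuous a' → Continuous b' →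
      Continuous fun g => (discD (a g) (b g) (a' g) (b' g) p q 0).re := by
    intro a b a' b' ha hb ha' hb'
    unfold discD
    simp only [curve_zero]
    refine Complex.continuous_re.comp ?_
    fun_prop
  exact key _ _ _ _ (continuous_entry 0 0) ((continuous_entry 0 1).neg.mul continuous_const)
    (continuous_conj_entry 0 0) ((continuous_conj_entry 0 1).neg.mul continuous_const)

theorem continuous_sphDD (p q : ℕ) (ϑ : ℝ) : Continuous (sphDD p q ϑ) := by
  have key : ∀ a b a' b' : SU2 → ℂ, Continuous a → Continuous b → Continuous a' → Continuous b' →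
      Continuous fun g => (∑ i ∈ Finset.range (p + 1),
        ((-1) ^ i * (p.choose i : ℂ) * ((p + q - i).choose p : ℂ)) *
          monoDD (a g) (b g) (a' g) (b' g) (p - i) (q - i)).re := by
    intro a b a' b' ha hb ha' hb'
    unfold monoDD
    refine Complex.continuous_re.comp ?_
    fun_prop
  exact key _ _ _ _ (continuous_entry 0 0) ((continuous_entry 0 1).neg.mul continuous_const)
    (continuous_conj_entry 0 0) ((continuous_conj_entry 0 1).neg.mul continuous_const)

theorem sphD_mul_cyl (p q : ℕ) (ϑ : ℝ) (g : SU2) (s : ℝ) : sphD p q ϑ (g * cyl s ϑ 0) =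
    (discD (g.1 0 0) (-g.1 0 1 * Complex.exp (-(ϑ * Complex.I))) ((starRingEnd ℂ) (g.1 0 0))
        (-(starRingEnd ℂ) (g.1 0 1) * Complex.exp (ϑ * Complex.I)) p q s).re := by
  have h1 := hasDerivAt_sph p q g s ϑ
  have h2 := hasDerivAt_sph p q (g * cyl s ϑ 0) 0 ϑ
  simp only [mul_assoc g, cyl_mul_cyl] at h2
  have h3 := HasDerivAt.comp_const_add (f := fun σ => sph p q (g * cyl σ ϑ 0)) s 0
    (by rw [add_zero]; exact h1)
  exact h2.unique h3

/-- The integral of `L` applied to an eigenfunction is zero, as a sum of integrals of derivatives,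
and the eigenvalue is nonzero as soon as `p + q ≠ 0`. -/
theorem integral_sph (p q : ℕ) (h : p + q ≠ 0) : ∫ g, sph p q g ∂haar = 0 := by
  have h0 : ∀ ϑ, ∫ g, sphDD p q ϑ g ∂haar = 0 := fun ϑ =>
    integral_derivation_eq_zero (continuous_sphD p q ϑ) (continuous_sphDD p q ϑ) ϑ fun g => by
      simp only [sphD_mul_cyl]
      exact hasDerivAt_re (hasDerivAt_discD _ _ _ _ p q)
  have h1 : ∀ g, sphDD p q 0 g + sphDD p q (π / 2) g = -(4 * p * q + 2 * p + 2 * q) * sph p q g := by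
    intro g
    rw [← subLaplacian_sph, subLaplacian, vfX_vfX, vfY_vfY, deriv_deriv_sph, deriv_deriv_sph]
    rfl
  have h2 : ∫ g, -(4 * p * q + 2 * p + 2 * q) * sph p q g ∂haar = 0 := by
    simp only [← h1]
    rw [integral_add (integrable_of_continuous (continuous_sphDD p q 0))
      (integrable_of_continuous (continuous_sphDD p q (π / 2))), h0, h0, add_zero]
  rw [integral_const_mul] at h2
  have h3 : (-(4 * p * q + 2 * p + 2 * q) : ℝ) ≠ 0 := by
    have : (0 : ℝ) < p + q := by exact_mod_cast Nat.pos_of_ne_zero h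
    have : (0 : ℝ) ≤ p * q := by positivity
    nlinarith
  exact (mul_eq_zero.1 h2).resolve_left h3

/-- The character of degree `m` of `SU(2)`. -/
noncomputable def char (m : ℕ) (g : SU2) : ℝ :=
  ∑ x ∈ Finset.HasAntidiagonal.antidiagonal m, sph x.1 x.2 g

/-- Half the trace. -/
noncomputable def htr (g : SU2) : ℝ := (ent g).re

theorem char_eq (m : ℕ) (g : SU2) : (char m g : ℂ) = chi m (ent g) ((starRingEnd ℂ) (ent g)) := by
  have h : ∀ m, (starRingEnd ℂ) (chi m (ent g) ((starRingEnd ℂ) (ent g))) =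
      chi m (ent g) ((starRingEnd ℂ) (ent g)) := by
    intro m
    rw [chi_congr m (add_comm (ent g) _)]
    simp only [chi, map_sum, conj_disc, Complex.conj_conj]
    exact chi_congr m (add_comm (ent g) _)
  rw [← Complex.conj_eq_iff_re.1 (h m), char, chi, Complex.re_sum]
  rfl

theorem char_zero (g : SU2) : char 0 g = 1 := by
  have := char_eq 0 g
  rw [chi_zero] at this
  exact_mod_cast this

theorem char_one (g : SU2) : char 1 g = 2 * htr g := by
  have := char_eq 1 g
  rw [chi_one, Complex.add_conj] at this
  exact_mod_cast this

theorem char_add_two (m : ℕ) (g : SU2) :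
    char (m + 2) g = 2 * htr g * char (m + 1) g - char m g := by
  have h := char_eq (m + 2) g
  rw [chi_add_two, Complex.add_conj, ← char_eq, ← char_eq] at h
  exact_mod_cast h

theorem continuous_char (m : ℕ) : Continuous (char m) :=
  continuous_finsetSum _ fun x _ => continuous_sph x.1 x.2

theorem continuous_htr : Continuous htr := Complex.continuous_re.comp continuous_ent

theorem integral_char (m : ℕ) : ∫ g, char m g ∂haar = if m = 0 then 1 else 0 := by
  split_ifs with h
  · subst h; simp [char_zero]
  · unfold char
    rw [integral_finsetSum _ fun x _ => integrable_of_continuous (continuous_sph x.1 x.2)]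
    refine Finset.sum_eq_zero fun x hx => integral_sph _ _ ?_
    rwa [Finset.HasAntidiagonal.mem_antidiagonal.1 hx]

/-- Multiplication by twice the half trace can be moved from one factor to the other. The Chebyshev
recurrence thus lowers one degree at the cost of raising the other, down to the integral of a single
character. -/
theorem integral_char_mul_char (m k : ℕ) :
    ∫ g, char m g * char k g ∂haar = if m = k then 1 else 0 := by
  have hint : ∀ m k, Integrable (fun g => char m g * char k g) haar := fun m k =>
    integrable_of_continuous ((continuous_char m).mul (continuous_char k))
  have key : ∀ m k, ∫ g, char (m + 2) g * char (k + 1) g ∂haar =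
      ∫ g, char (m + 1) g * char (k + 2) g ∂haar + ∫ g, char (m + 1) g * char k g ∂haar -
        ∫ g, char m g * char (k + 1) g ∂haar := by
    intro m k
    rw [← integral_add (hint _ _) (hint _ _),
      ← integral_sub (by exact (hint _ _).add (hint _ _)) (hint _ _)]
    refine integral_congr_ae (Eventually.of_forall fun g => ?_)
    simp only [char_add_two]
    ring
  have key1 : ∀ k, ∫ g, char 1 g * char (k + 1) g ∂haar =
      ∫ g, char (k + 2) g ∂haar + ∫ g, char k g ∂haar := by
    intro k
    rw [← integral_add (integrable_of_continuous (continuous_char _))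
      (integrable_of_continuous (continuous_char _))]
    refine integral_congr_ae (Eventually.of_forall fun g => ?_)
    simp only [char_add_two, char_one]; ring
  have h0 : ∀ m, ∫ g, char m g * char 0 g ∂haar = if m = 0 then 1 else 0 := by
    intro m; simp only [char_zero, mul_one, integral_char]
  induction m using Nat.twoStepInduction generalizing k with
  | zero =>
    simp only [mul_comm (char 0 _), h0, eq_comm]
  | one =>
    rcases k with _ | k
    · exact h0 1
    · rw [key1, integral_char, integral_char]
      rcases k with _ | k <;> simp
  | more m h1 h2 =>
    rcases k with _ | k
    · exact h0 _
    · rw [key, h2, h2, h1]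
      split_ifs <;> first | omega | norm_num

/-! ### Characters, powers of a peak function, and moments of the heat kernel -/

theorem norm_ent_le (g : SU2) : ‖ent g‖ ≤ 1 :=
  entry_norm_bound_of_unitary (Matrix.mem_specialUnitaryGroup_iff.1 g.2).1 0 0

theorem abs_htr_le (g : SU2) : |htr g| ≤ 1 := (Complex.abs_re_le_norm _).trans (norm_ent_le g)

/-- This makes the identity the only maximum point of `(1 + htr g) / 2`, whose powers therefore
concentrate there. -/
theorem eq_one_of_htr (g : SU2) (h : htr g = 1) : g = 1 := by
  have h1 := norm_ent_le g
  have h2 : Complex.normSq (ent g) ≤ 1 := by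
    rw [Complex.normSq_eq_norm_sq]; nlinarith [norm_nonneg (ent g)]
  rw [Complex.normSq_apply] at h2
  have him : (ent g).im = 0 := by
    have : (ent g).re = 1 := h
    rw [this] at h2
    nlinarith
  have ha : g.1 0 0 = 1 := Complex.ext h him
  have hb : g.1 0 1 = 0 := by
    have := row_eq g
    rw [ha] at this
    simp only [map_one, mul_one, add_eq_left] at this
    rw [Complex.mul_conj] at this
    exact Complex.normSq_eq_zero.1 (by exact_mod_cast this)
  have hc : g.1 1 0 = 0 ∧ g.1 1 1 = 1 := by
    have hdet : g.1.det = 1 := (Matrix.mem_specialUnitaryGroup_iff.1 g.2).2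
    have hu := (Matrix.mem_unitaryGroup_iff.1 (Matrix.mem_specialUnitaryGroup_iff.1 g.2).1)
    have h10 := congrFun (congrFun hu 1) 0
    rw [Matrix.det_fin_two, ha, hb] at hdet
    simp [Matrix.mul_apply, Fin.sum_univ_two, Matrix.star_apply, ha, hb] at h10
    exact ⟨h10, by simpa using hdet⟩
  apply Subtype.ext
  ext i j
  fin_cases i <;> fin_cases j <;> simp [ha, hb, hc.1, hc.2]

theorem abs_char_le (m : ℕ) (g : SU2) : |char m g| ≤ m + 1 := by
  have h := abs_le.1 (abs_htr_le g)
  have h1 : ent g + (starRingEnd ℂ) (ent g) = 2 * Complex.cos (arccos (htr g)) := by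
    rw [Complex.add_conj, ← Complex.ofReal_cos, Real.cos_arccos h.1 h.2]
    push_cast; rfl
  rw [← Real.norm_eq_abs, ← Complex.norm_real, char_eq, chi_exp m _ h1]
  refine (norm_sum_le _ _).trans ?_
  have : ∀ x ∈ Finset.HasAntidiagonal.antidiagonal m,
      ‖Complex.exp (((x.1 : ℂ) - x.2) * ((arccos (htr g) : ℝ) * Complex.I))‖ = 1 := by
    intro x _
    rw [show ((x.1 : ℂ) - x.2) * ((arccos (htr g) : ℝ) * Complex.I) =
      ((((x.1 : ℝ) - x.2) * arccos (htr g) : ℝ) : ℂ) * Complex.I by push_cast; ring,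
      Complex.norm_exp_ofReal_mul_I]
  rw [Finset.sum_congr rfl this]
  simp

theorem exists_pow_eq_sum_char (n : ℕ) :
    ∃ c : ℕ → ℝ, ∀ g, ((1 + htr g) / 2) ^ n = ∑ m ∈ Finset.range (n + 1), c m * char m g := by
  induction n with
  | zero => exact ⟨fun _ => 1, fun g => by simp [char_zero]⟩
  | succ n ih =>
    obtain ⟨c, hc⟩ := ih
    have hx : ∀ m g, 2 * htr g * char m g =
        char (m + 1) g + (if m = 0 then 0 else char (m - 1) g) := by
      intro m g
      rcases m with _ | m
      · simp [char_zero, char_one]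
      · simp [char_add_two]
    -- These coefficients transcribe `(1 + x) / 2 * U m = U m / 2 + U (m + 1) / 4 + U (m - 1) / 4`,
    -- with `x` the half trace and `U (-1) = 0`.
    refine ⟨fun m => (if m < n + 1 then c m / 2 else 0) + (if m = 0 then 0 else c (m - 1) / 4) +
      (if m + 1 < n + 1 then c (m + 1) / 4 else 0), fun g => ?_⟩
    rw [pow_succ, hc]
    have e1 : ∑ m ∈ Finset.range (n + 1 + 1), (if m < n + 1 then c m / 2 else 0) * char m g =
        ∑ m ∈ Finset.range (n + 1), c m / 2 * char m g := by
      rw [Finset.sum_range_succ]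
      simp only [lt_irrefl, if_false, zero_mul, add_zero]
      exact Finset.sum_congr rfl fun m hm => by rw [if_pos (Finset.mem_range.1 hm)]
    have e2 : ∑ m ∈ Finset.range (n + 1 + 1), (if m = 0 then 0 else c (m - 1) / 4) * char m g =
        ∑ m ∈ Finset.range (n + 1), c m / 4 * char (m + 1) g := by
      rw [Finset.sum_range_succ']
      simp
    have e3 : ∑ m ∈ Finset.range (n + 1 + 1), (if m + 1 < n + 1 then c (m + 1) / 4 else 0) *
        char m g = ∑ m ∈ Finset.range (n + 1), c m / 4 * (if m = 0 then 0 else char (m - 1) g) := by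
      rw [Finset.sum_range_succ' _ n, Finset.sum_range_succ, Finset.sum_range_succ]
      simp
      exact Finset.sum_congr rfl fun m hm => by rw [if_pos (Finset.mem_range.1 hm)]
    simp only [add_mul]
    rw [Finset.sum_add_distrib, Finset.sum_add_distrib, e1, e2, e3, ← Finset.sum_add_distrib,
      ← Finset.sum_add_distrib, Finset.sum_mul]
    refine Finset.sum_congr rfl fun m _ => ?_
    linear_combination (c m / 4) * hx m g

theorem eq_exp_mul_of_hasDerivAt {F : ℝ → ℝ} {lam c : ℝ}
    (h : ∀ t, 0 < t → HasDerivAt F (-lam * F t) t) (h0 : Tendsto F (𝓝[>] 0) (𝓝 c))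
    {t : ℝ} (ht : 0 < t) : F t = exp (-lam * t) * c := by
  have hG : ∀ s ∈ Ioi (0 : ℝ), HasDerivAt (fun s => exp (lam * s) * F s) 0 s := by
    intro s hs
    have h1 : HasDerivAt (fun s => exp (lam * s)) (exp (lam * s) * lam) s := by
      simpa using ((hasDerivAt_id s).const_mul lam).exp
    refine (h1.fun_mul (h s hs)).congr_deriv ?_
    ring
  have hconst : ∀ s ∈ Ioi (0 : ℝ), exp (lam * s) * F s = exp (lam * t) * F t := by
    intro s hs
    exact isOpen_Ioi.is_const_of_deriv_eq_zero isPreconnected_Ioi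
      (fun x hx => (hG x hx).differentiableAt.differentiableWithinAt)
      (fun x hx => (hG x hx).deriv) hs ht
  have h2 : Tendsto (fun s => exp (lam * s) * F s) (𝓝[>] 0) (𝓝 (exp (lam * 0) * c)) := by
    refine Tendsto.mul ?_ h0
    exact ((by fun_prop : Continuous fun s : ℝ => exp (lam * s)).tendsto 0).mono_left
      nhdsWithin_le_nhds
  have h3 : Tendsto (fun s => exp (lam * s) * F s) (𝓝[>] 0) (𝓝 (exp (lam * t) * F t)) :=
    tendsto_const_nhds.congr' (eventually_nhdsWithin_of_forall fun s hs => (hconst s hs).symm)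
  have h4 := tendsto_nhds_unique h2 h3
  rw [mul_zero, exp_zero, one_mul] at h4
  rw [h4, ← mul_assoc, ← exp_add]
  simp

/-- The eigenvalue of `-L` at `sph p q`. -/
noncomputable def eig (x : ℕ × ℕ) : ℝ := 4 * x.1 * x.2 + 2 * x.1 + 2 * x.2

/-- Left-invariant operators commute with left translation, so a translated eigenfunction is an
eigenfunction. The heat equation tested on it is a scalar linear differential equation, with initial
value given by the limit at `0`. -/
theorem IsHeatKernel.integral_sph_mul {p : ℝ → SU2 → ℝ} (hp : IsHeatKernel p) (x : ℕ × ℕ)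
    (h : SU2) {t : ℝ} (ht : 0 < t) :
    ∫ g, sph x.1 x.2 (h * g) * p t g ∂haar = exp (-eig x * t) * sph x.1 x.2 h := by
  have hs := isSmooth_sph_mul_left x.1 x.2 h
  refine eq_exp_mul_of_hasDerivAt (F := fun t => ∫ g, sph x.1 x.2 (h * g) * p t g ∂haar)
    (fun s hs' => ?_) ?_ ht
  · have := hp.heat_eq _ hs s hs'
    simp only [subLaplacian_mul_left, subLaplacian_sph] at this
    rw [← integral_const_mul]
    simpa only [eig, mul_assoc] using this
  · have := hp.initial _ hs
    rwa [mul_one] at this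

theorem norm_chi_le (m : ℕ) {A B : ℂ} {x : ℝ} (hx : |x| ≤ 1) (h : A + B = 2 * x) :
    ‖chi m A B‖ ≤ m + 1 := by
  have h' := abs_le.1 hx
  have h1 : A + B = 2 * Complex.cos (arccos x) := by
    rw [h, ← Complex.ofReal_cos, Real.cos_arccos h'.1 h'.2]
  rw [chi_exp m _ h1]
  refine (norm_sum_le _ _).trans ?_
  have : ∀ y ∈ Finset.HasAntidiagonal.antidiagonal m,
      ‖Complex.exp (((y.1 : ℂ) - y.2) * ((arccos x : ℝ) * Complex.I))‖ = 1 := by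
    intro y _
    rw [show ((y.1 : ℂ) - y.2) * ((arccos x : ℝ) * Complex.I) =
      ((((y.1 : ℝ) - y.2) * arccos x : ℝ) : ℂ) * Complex.I by push_cast; ring,
      Complex.norm_exp_ofReal_mul_I]
  rw [Finset.sum_congr rfl this]
  simp

theorem disc_mul_exp (p q : ℕ) (A B w : ℂ) :
    disc p q (A * Complex.exp (w * Complex.I)) (B * Complex.exp (-(w * Complex.I))) =
      Complex.exp (((p : ℂ) - q) * (w * Complex.I)) * disc p q A B := by
  rw [disc_mul_mul p q A B (by rw [← Complex.exp_add]; simp), ← Complex.exp_nat_mul,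
    ← Complex.exp_nat_mul, ← Complex.exp_add]
  ring_nf

/-- Rotating `A` by `e^{is}` multiplies `disc p q` by `e^{i(p-q)s}`, so `disc p q` is a Fourier
coefficient in `s` of the character sum of degree `p + q`. It inherits the uniform bound of that
sum, which consists of `p + q + 1` unimodular terms. -/
theorem norm_disc_le (p q : ℕ) {A : ℂ} (hA : ‖A‖ ≤ 1) :
    ‖disc p q A ((starRingEnd ℂ) A)‖ ≤ ((p + q : ℕ) : ℝ) + 1 := by
  set B := (starRingEnd ℂ) A with hB
  set m := p + q with hm
  have hint : ∀ n : ℤ, ∫ s in (0 : ℝ)..(2 * π), Complex.exp ((n : ℂ) * (s * Complex.I)) =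
      if n = 0 then 2 * π else 0 := by
    intro n
    split_ifs with h
    · simp [h]
    · have hn : (n : ℂ) * Complex.I ≠ 0 := mul_ne_zero (by exact_mod_cast h) Complex.I_ne_zero
      have := integral_exp_mul_complex (a := 0) (b := 2 * π) hn
      rw [show ((n : ℂ) * Complex.I) * ((2 * π : ℝ) : ℂ) = n * (2 * π * Complex.I) by
        push_cast; ring, Complex.exp_int_mul_two_pi_mul_I] at this
      simp only [Complex.ofReal_zero, mul_zero, Complex.exp_zero, sub_self, zero_div] at this
      rw [Complex.ofReal_zero, ← this]
      congr 1; funext s; ring_nf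
  have hchi : ∀ s : ℝ, chi m (A * Complex.exp (s * Complex.I)) (B * Complex.exp (-(s * Complex.I)))
      * Complex.exp (-(((p : ℂ) - q) * (s * Complex.I))) =
      ∑ x ∈ Finset.HasAntidiagonal.antidiagonal m,
        disc x.1 x.2 A B * Complex.exp (((x.1 - x.2 - (p - q) : ℤ) : ℂ) * (s * Complex.I)) := by
    intro s
    rw [chi, Finset.sum_mul]
    refine Finset.sum_congr rfl fun x _ => ?_
    rw [disc_mul_exp, mul_comm (Complex.exp _) (disc _ _ _ _), mul_assoc, ← Complex.exp_add]
    push_cast; ring_nf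
  have hI : ∫ s in (0 : ℝ)..(2 * π), chi m (A * Complex.exp (s * Complex.I))
      (B * Complex.exp (-(s * Complex.I))) * Complex.exp (-(((p : ℂ) - q) * (s * Complex.I))) =
      2 * π * disc p q A B := by
    simp only [hchi]
    rw [intervalIntegral.integral_finsetSum]
    · rw [Finset.sum_eq_single (p, q)]
      · rw [intervalIntegral.integral_const_mul, hint]; simp; ring
      · intro x hx hne
        rw [intervalIntegral.integral_const_mul, hint, if_neg, Complex.ofReal_zero, mul_zero]
        intro h0
        apply hne
        have := Finset.HasAntidiagonal.mem_antidiagonal.1 hx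
        ext <;> simp <;> omega
      · intro h
        exact absurd (Finset.HasAntidiagonal.mem_antidiagonal.2 hm.symm) h
    · intro x _
      exact (by fun_prop : Continuous _).intervalIntegrable _ _
  have hbound : ‖∫ s in (0 : ℝ)..(2 * π), chi m (A * Complex.exp (s * Complex.I))
      (B * Complex.exp (-(s * Complex.I))) * Complex.exp (-(((p : ℂ) - q) * (s * Complex.I)))‖ ≤
      (m + 1) * |2 * π - 0| := by
    refine intervalIntegral.norm_integral_le_of_norm_le_const fun s _ => ?_
    have hs : B * Complex.exp (-(s * Complex.I)) =
        (starRingEnd ℂ) (A * Complex.exp (s * Complex.I)) := by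
      rw [map_mul, ← Complex.exp_conj]; simp [hB]
    rw [norm_mul, show -(((p : ℂ) - q) * (s * Complex.I)) = ((-((p - q) * s) : ℝ) : ℂ) * Complex.I by
      push_cast; ring, Complex.norm_exp_ofReal_mul_I, mul_one]
    refine norm_chi_le m (x := (A * Complex.exp (s * Complex.I)).re) ?_ ?_
    · refine (Complex.abs_re_le_norm _).trans ?_
      rw [norm_mul, Complex.norm_exp_ofReal_mul_I, mul_one]; exact hA
    · rw [hs, Complex.add_conj]; push_cast; rfl
  rw [hI, norm_mul, sub_zero] at hbound
  have h2 : ‖(2 * π : ℂ)‖ = |2 * π| := by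
    rw [← Real.norm_eq_abs, ← Complex.norm_real]; push_cast; rfl
  rw [h2, mul_comm] at hbound
  exact le_of_mul_le_mul_right hbound (by positivity)

theorem abs_sph_le (p q : ℕ) (g : SU2) : |sph p q g| ≤ ((p + q : ℕ) : ℝ) + 1 :=
  (Complex.abs_re_le_norm _).trans (norm_disc_le p q (norm_ent_le g))

/-! ### Spectral expansion of the heat kernel -/

theorem two_mul_le_eig {m : ℕ} {x : ℕ × ℕ} (hx : x ∈ Finset.HasAntidiagonal.antidiagonal m) :
    2 * (m : ℝ) ≤ eig x := by
  have : x.1 + x.2 = m := Finset.HasAntidiagonal.mem_antidiagonal.1 hx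
  have h1 : (x.1 : ℝ) + x.2 = m := by exact_mod_cast this
  have h2 : (0 : ℝ) ≤ x.1 * x.2 := by positivity
  rw [eig]; nlinarith

theorem summable_cube_mul_exp {t : ℝ} (ht : 0 < t) :
    Summable fun m : ℕ => ((m : ℝ) + 1) ^ 3 * exp (-(2 * m * t)) := by
  have h := (summable_nat_add_iff 1).2
    (Real.summable_pow_mul_exp_neg_nat_mul 3 (r := 2 * t) (by positivity))
  refine (h.mul_right (exp (2 * t))).congr fun m => ?_
  rw [mul_assoc, ← exp_add]
  push_cast; ring_nf

/-- The homogeneous component of degree `m` of the heat kernel, up to the factor `m + 1`. -/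
noncomputable def comp (t : ℝ) (h : SU2) (m : ℕ) : ℝ :=
  ∑ x ∈ Finset.HasAntidiagonal.antidiagonal m, exp (-eig x * t) * sph x.1 x.2 h

theorem abs_comp_le {t : ℝ} (ht : 0 < t) (h : SU2) (m : ℕ) :
    |comp t h m| ≤ ((m : ℝ) + 1) ^ 2 * exp (-(2 * m * t)) := by
  refine (Finset.abs_sum_le_sum_abs _ _).trans ?_
  have : ∀ x ∈ Finset.HasAntidiagonal.antidiagonal m, |exp (-eig x * t) * sph x.1 x.2 h| ≤
      exp (-(2 * m * t)) * (m + 1) := by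
    intro x hx
    rw [abs_mul, abs_of_pos (exp_pos _)]
    have h1 := two_mul_le_eig hx
    have h2 := abs_sph_le x.1 x.2 h
    rw [Finset.HasAntidiagonal.mem_antidiagonal.1 hx] at h2
    refine mul_le_mul (exp_le_exp.2 ?_) h2 (abs_nonneg _) (exp_pos _).le
    nlinarith
  refine (Finset.sum_le_sum this).trans (le_of_eq ?_)
  simp only [Finset.sum_const, Finset.Nat.card_antidiagonal, nsmul_eq_mul]
  push_cast; ring

theorem htr_one : htr 1 = 1 := by simp [htr, ent]

theorem char_at_one (m : ℕ) : char m 1 = m + 1 := by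
  induction m using Nat.twoStepInduction with
  | zero => simp [char_zero]
  | one => rw [char_one, htr_one]; norm_num
  | more m h1 h2 => rw [char_add_two, h1, h2, htr_one]; push_cast; ring

instance : TopologicalSpace.MetrizableSpace SU2 :=
  have : TopologicalSpace.MetrizableSpace (Matrix (Fin 2) (Fin 2) ℂ) :=
    inferInstanceAs (TopologicalSpace.MetrizableSpace (Fin 2 → Fin 2 → ℂ))
  IsEmbedding.subtypeVal.metrizableSpace

theorem tendsto_peak {f : SU2 → ℝ} (hf : Continuous f) :
    Tendsto (fun n : ℕ => (∫ g, ((1 + htr g) / 2) ^ n ∂haar)⁻¹ *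
      ∫ g, ((1 + htr g) / 2) ^ n * f g ∂haar) atTop (𝓝 (f 1)) := by
  have hc : Continuous fun g : SU2 => (1 + htr g) / 2 := by
    have := continuous_htr
    fun_prop
  have := tendsto_setIntegral_pow_smul_of_unique_maximum_of_isCompact_of_continuousOn
    (μ := haar) (s := univ) (x₀ := (1 : SU2)) (c := fun g => (1 + htr g) / 2) (g := f) isCompact_univ
    hc.continuousOn ?_ ?_ ?_ ?_ hf.continuousOn
  · simpa using this
  · intro y _ hy
    rw [htr_one]
    have h1 := (abs_le.1 (abs_htr_le y)).2
    have h2 : htr y ≠ 1 := fun h => hy (eq_one_of_htr y h)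
    have := lt_of_le_of_ne h1 h2
    linarith
  · intro y _
    have h1 := (abs_le.1 (abs_htr_le y)).1
    linarith
  · rw [htr_one]; norm_num
  · simp

theorem IsHeatKernel.integral_char_mul {p : ℝ → SU2 → ℝ} (hp : IsHeatKernel p) (m : ℕ)
    (h : SU2) {t : ℝ} (ht : 0 < t) :
    ∫ g, char m (h * g) * p t g ∂haar = comp t h m := by
  unfold char comp
  simp only [Finset.sum_mul]
  rw [integral_finsetSum]
  · exact Finset.sum_congr rfl fun x _ => hp.integral_sph_mul x h ht
  · intro x _
    refine integrable_of_continuous ?_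
    have := continuous_sph x.1 x.2
    have := hp.continuous t ht
    fun_prop

/-- The average of `p t (h * ·)` against the normalised power `f ^ n` tends to `p t h` by
continuity. It is also a finite combination of the known moments `comp t h⁻¹ m`, with weights `d n
m` that are bounded by `m + 1` and tend to `m + 1`. Dominated convergence for series identifies the
two limits. -/
theorem IsHeatKernel.hasSum {p : ℝ → SU2 → ℝ} (hp : IsHeatKernel p) (h : SU2) {t : ℝ}
    (ht : 0 < t) : HasSum (fun m : ℕ => ((m : ℝ) + 1) * comp t h⁻¹ m) (p t h) := by
  set f : SU2 → ℝ := fun g => (1 + htr g) / 2 with hf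
  have hfc : Continuous f := by
    have := continuous_htr
    fun_prop
  have hf0 : ∀ g, 0 ≤ f g := fun g => by
    have h1 := (abs_le.1 (abs_htr_le g)).1
    simp only [hf]; linarith
  set I : ℕ → ℝ := fun n => ∫ g, f g ^ n ∂haar with hI
  set d : ℕ → ℕ → ℝ := fun n m => (I n)⁻¹ * ∫ g, f g ^ n * char m g ∂haar with hd
  have hIn : ∀ n, 0 ≤ I n := fun n => integral_nonneg fun g => pow_nonneg (hf0 g) n
  have hdlim : ∀ m, Tendsto (fun n => d n m) atTop (𝓝 ((m : ℝ) + 1)) := fun m => by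
    rw [← char_at_one m]; exact tendsto_peak (continuous_char m)
  have hdle : ∀ n m, |d n m| ≤ (m : ℝ) + 1 := by
    intro n m
    rw [hd, abs_mul, abs_inv, abs_of_nonneg (hIn n)]
    have h1 : |∫ g, f g ^ n * char m g ∂haar| ≤ I n * (m + 1) := by
      rw [hI, ← integral_mul_const]
      refine (abs_integral_le_integral_abs).trans (integral_mono_of_nonneg
        (Eventually.of_forall fun g => abs_nonneg _) (integrable_of_continuous (by fun_prop))
        (Eventually.of_forall fun g => ?_))
      simp only [abs_mul, abs_of_nonneg (pow_nonneg (hf0 g) n)]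
      exact mul_le_mul_of_nonneg_left (abs_char_le m g) (pow_nonneg (hf0 g) n)
    -- If `I n = 0` its inverse is `0` by convention and the bound is trivial, so positivity of `I
    -- n` need not be proved.
    rcases (hIn n).eq_or_lt with h0 | h0
    · rw [← h0]; simp; positivity
    · calc (I n)⁻¹ * _ ≤ (I n)⁻¹ * (I n * (m + 1)) :=
          mul_le_mul_of_nonneg_left h1 (inv_nonneg.2 h0.le)
        _ = _ := by field_simp
  have hval : ∀ n, (I n)⁻¹ * ∫ g, f g ^ n * p t (h * g) ∂haar =
      ∑' m, d n m * comp t h⁻¹ m := by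
    intro n
    obtain ⟨c, hc⟩ := exists_pow_eq_sum_char n
    have hdm : ∀ m, ∫ g, f g ^ n * char m g ∂haar = if m < n + 1 then c m else 0 := by
      intro m
      simp only [hf, hc, Finset.sum_mul, mul_assoc]
      rw [integral_finsetSum]
      · simp only [integral_const_mul, integral_char_mul_char]
        simp
      · intro k _
        exact integrable_of_continuous
          (continuous_const.mul ((continuous_char k).mul (continuous_char m)))
    rw [tsum_eq_sum (s := Finset.range (n + 1))]
    -- Invariance moves the translation from the heat kernel to the peak, where the characters can
    -- absorb it.
    · have e1 : ∫ g, f g ^ n * p t (h * g) ∂haar = ∫ g, f (h⁻¹ * g) ^ n * p t g ∂haar := by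
        rw [← integral_mul_left_eq_self (fun g => f (h⁻¹ * g) ^ n * p t g) h]
        simp
      rw [e1]
      simp only [hf, hc, Finset.sum_mul, mul_assoc]
      rw [integral_finsetSum]
      · rw [Finset.mul_sum]
        refine Finset.sum_congr rfl fun m hm => ?_
        rw [integral_const_mul, hp.integral_char_mul m _ ht]
        simp only [hd, hdm, if_pos (Finset.mem_range.1 hm)]
        ring
      · intro k _
        have := hp.continuous t ht
        have := continuous_char k
        exact integrable_of_continuous (by fun_prop)
    · intro m hm
      simp only [hd, hdm, if_neg (fun h => hm (Finset.mem_range.2 h))]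
      simp
  have hb : ∀ m : ℕ, ((m : ℝ) + 1) * |comp t h⁻¹ m| ≤ ((m : ℝ) + 1) ^ 3 * exp (-(2 * m * t)) := by
    intro m
    have := abs_comp_le ht h⁻¹ m
    calc ((m : ℝ) + 1) * |comp t h⁻¹ m| ≤ (m + 1) * (((m : ℝ) + 1) ^ 2 * exp (-(2 * m * t))) :=
          mul_le_mul_of_nonneg_left this (by positivity)
      _ = _ := by ring
  have hsum := summable_cube_mul_exp ht
  have hlim : Tendsto (fun n => ∑' m, d n m * comp t h⁻¹ m) atTop
      (𝓝 (∑' m : ℕ, ((m : ℝ) + 1) * comp t h⁻¹ m)) := by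
    refine tendsto_tsum_of_dominated_convergence hsum (fun m => (hdlim m).mul_const _)
      (Eventually.of_forall fun n m => ?_)
    rw [norm_mul, Real.norm_eq_abs, Real.norm_eq_abs]
    exact (mul_le_mul_of_nonneg_right (hdle n m) (abs_nonneg _)).trans (hb m)
  have hlim2 : Tendsto (fun n => ∑' m, d n m * comp t h⁻¹ m) atTop (𝓝 (p t h)) := by
    have hpt := hp.continuous t ht
    have := tendsto_peak (f := fun g => p t (h * g)) (by fun_prop)
    rw [mul_one] at this
    exact this.congr hval
  have hS : Summable fun m : ℕ => ((m : ℝ) + 1) * comp t h⁻¹ m := by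
    refine Summable.of_norm_bounded hsum fun m => ?_
    rw [norm_mul, Real.norm_eq_abs, Real.norm_eq_abs, abs_of_pos (by positivity : (0 : ℝ) < m + 1)]
    exact hb m
  rw [tendsto_nhds_unique hlim2 hlim]
  exact hS.hasSum

theorem sph_cyl_inv (p q : ℕ) (r ϑ z : ℝ) : sph p q (cyl r ϑ z)⁻¹ =
    (Complex.exp (((p : ℂ) - q) * (z * Complex.I)) * disc p q (cos r) (cos r)).re := by
  have he : ent (cyl r ϑ z)⁻¹ = (cos r : ℂ) * Complex.exp (-(z * Complex.I)) := by
    have : (((cyl r ϑ z)⁻¹ : SU2) : Matrix (Fin 2) (Fin 2) ℂ) = star (cyl r ϑ z).1 := rfl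
    rw [ent, this, Matrix.star_apply, Complex.star_def]
    simp [cyl, ← Complex.exp_conj, ← Complex.cos_conj]
  have he' : (starRingEnd ℂ) (ent (cyl r ϑ z)⁻¹) = (cos r : ℂ) * Complex.exp (z * Complex.I) := by
    rw [he, map_mul, ← Complex.exp_conj, Complex.conj_ofReal]; simp
  rw [sph, ← disc_mul_exp, ← Complex.conj_re, conj_disc, Complex.conj_conj, he', he]

/-- The heat kernel as a double series. -/
theorem IsHeatKernel.hasSum_cyl {p : ℝ → SU2 → ℝ} (hp : IsHeatKernel p) (r ϑ z : ℝ) {t : ℝ}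
    (ht : 0 < t) : HasSum (fun m : ℕ => (((m : ℂ) + 1) *
      ∑ x ∈ Finset.HasAntidiagonal.antidiagonal m, Complex.exp (-eig x * t) *
        (Complex.exp (((x.1 : ℂ) - x.2) * (z * Complex.I)) * disc x.1 x.2 (cos r) (cos r))).re)
      (p t (cyl r ϑ z)) := by
  refine (hp.hasSum (cyl r ϑ z) ht).congr_fun ?_
  intro m
  have : ((m : ℂ) + 1) = ((m + 1 : ℝ) : ℂ) := by push_cast; rfl
  rw [this, Complex.re_ofReal_mul, comp, Complex.re_sum]
  congr 1
  refine Finset.sum_congr rfl fun x _ => ?_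
  have : Complex.exp (-eig x * t) = (exp (-eig x * t) : ℝ) := by push_cast; rfl
  rw [this, Complex.re_ofReal_mul, sph_cyl_inv]

/-! ### Gaussian integral representation over a vertical line -/

/-- The vertical line of real part `θ`. -/
noncomputable def line (θ y : ℝ) : ℂ := θ + y * Complex.I

/-- The Gaussian weight on the vertical line of real part `θ`. -/
noncomputable def gw (t θ z y : ℝ) : ℂ := Complex.exp ((line θ y - z) ^ 2 / (4 * t))

/-- The heat kernel of `SU(2)` for the Laplace-Beltrami operator, as a function of half the trace. -/
noncomputable def qser (t : ℝ) (u : ℂ) : ℂ :=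
  ∑' m : ℕ, ((m : ℂ) + 1) * Complex.exp (-((m : ℂ) * (m + 2)) * t) * chi m u u

theorem continuous_line (θ : ℝ) : Continuous (line θ) := by unfold line; fun_prop

theorem continuous_gw (t θ z : ℝ) : Continuous (gw t θ z) := by
  unfold gw
  have := continuous_line θ
  fun_prop

theorem gw_mul_exp {t : ℝ} (ht : 0 < t) (θ z y : ℝ) (j : ℂ) :
    gw t θ z y * Complex.exp (j * (line θ y * Complex.I)) =
    Complex.exp ((-(1 / (4 * t)) : ℂ) * y ^ 2 + (Complex.I * (θ - z) / (2 * t) - j) * y +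
      ((θ - z) ^ 2 / (4 * t) + j * θ * Complex.I)) := by
  have ht' : (t : ℂ) ≠ 0 := by exact_mod_cast ht.ne'
  rw [gw, ← Complex.exp_add, line]
  congr 1
  field_simp
  linear_combination (2 * y ^ 2 + 8 * j * t * y) * Complex.I_sq

theorem integrable_gw_mul_exp {t : ℝ} (ht : 0 < t) (θ z : ℝ) (j : ℂ) :
    Integrable fun y => gw t θ z y * Complex.exp (j * (line θ y * Complex.I)) := by
  simp only [gw_mul_exp ht]
  refine integrable_cexp_quadratic' ?_ _ _
  have : (-(1 / (4 * t)) : ℂ) = ((-(1 / (4 * t)) : ℝ) : ℂ) := by push_cast; rfl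
  rw [this, Complex.ofReal_re]
  have : 0 < 1 / (4 * t) := by positivity
  linarith

/-- The right side does not depend on `θ`; this freedom later allows the line to pass through the
saddle point. -/
theorem integral_gw_mul_exp {t : ℝ} (ht : 0 < t) (θ z : ℝ) (j : ℂ) :
    ∫ y, gw t θ z y * Complex.exp (j * (line θ y * Complex.I)) =
      (√(4 * π * t) : ℝ) * Complex.exp (t * j ^ 2 + j * (z * Complex.I)) := by
  have ht' : (t : ℂ) ≠ 0 := by exact_mod_cast ht.ne'
  simp only [gw_mul_exp ht]
  have h1 : (-(1 / (4 * t)) : ℂ) = ((-(1 / (4 * t)) : ℝ) : ℂ) := by push_cast; rfl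
  rw [integral_cexp_quadratic]
  · congr 1
    · have : (π / -(-(1 / (4 * t))) : ℂ) = ((4 * π * t : ℝ) : ℂ) := by
        push_cast; field_simp
      rw [this, Real.sqrt_eq_rpow, Complex.ofReal_cpow (by positivity)]
      push_cast; rfl
    · congr 1
      field_simp
      linear_combination (4 * (θ - z) ^ 2 : ℂ) * Complex.I_sq
  · rw [h1, Complex.ofReal_re]
    have : 0 < 1 / (4 * t) := by positivity
    linarith

theorem norm_gw_mul_exp {t : ℝ} (ht : 0 < t) (θ z y j : ℝ) :
    ‖gw t θ z y * Complex.exp (j * (line θ y * Complex.I))‖ =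
      exp ((θ - z) ^ 2 / (4 * t)) * (gw t 0 0 y * Complex.exp (j * (line 0 y * Complex.I))).re := by
  have e : gw t 0 0 y * Complex.exp (j * (line 0 y * Complex.I)) =
      ((exp (-(1 / (4 * t)) * y ^ 2 - j * y) : ℝ) : ℂ) := by
    rw [gw_mul_exp ht]; push_cast; congr 1; ring
  rw [e, Complex.ofReal_re, ← exp_add, gw_mul_exp ht, Complex.norm_exp]
  congr 1
  have : ((-(1 / (4 * t)) : ℂ) * y ^ 2 + (Complex.I * (θ - z) / (2 * t) - j) * y +
      ((θ - z) ^ 2 / (4 * t) + j * θ * Complex.I)) =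
      ((-(1 / (4 * t)) * y ^ 2 - j * y + (θ - z) ^ 2 / (4 * t) : ℝ) : ℂ) +
        (((θ - z) / (2 * t) * y + j * θ : ℝ) : ℂ) * Complex.I := by
    push_cast; ring
  rw [this, Complex.add_re, Complex.ofReal_re, Complex.re_ofReal_mul, Complex.I_re]
  ring

theorem integral_norm_gw_mul_exp {t : ℝ} (ht : 0 < t) (θ z j : ℝ) :
    ∫ y, ‖gw t θ z y * Complex.exp (j * (line θ y * Complex.I))‖ =
      exp ((θ - z) ^ 2 / (4 * t)) * (√(4 * π * t) * exp (t * j ^ 2)) := by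
  simp only [norm_gw_mul_exp ht]
  rw [integral_const_mul]
  congr 1
  have h := congrArg Complex.re (integral_gw_mul_exp ht 0 0 j)
  have e : (t * (j : ℂ) ^ 2 + j * (((0 : ℝ) : ℂ) * Complex.I)) = ((t * j ^ 2 : ℝ) : ℂ) := by
    push_cast; ring
  rw [e, ← Complex.ofReal_exp, ← Complex.ofReal_mul, Complex.ofReal_re] at h
  rw [← h]
  exact integral_re (𝕜 := ℂ) (integrable_gw_mul_exp ht 0 0 j)

/-- The replacement of the equal arguments `c cos w` by `c e^{iw}` and `c e^{-iw}` exhibits the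
Fourier modes `p - q` that the Gaussian integral sees. -/
theorem chi_cos_line (m : ℕ) (c : ℂ) (w : ℂ) :
    chi m (c * Complex.cos w) (c * Complex.cos w) =
      ∑ x ∈ Finset.HasAntidiagonal.antidiagonal m,
        Complex.exp (((x.1 : ℂ) - x.2) * (w * Complex.I)) * disc x.1 x.2 c c := by
  rw [chi_congr m (A' := c * Complex.exp (w * Complex.I)) (B' := c * Complex.exp (-(w * Complex.I))),
    chi]
  · exact Finset.sum_congr rfl fun x _ => disc_mul_exp _ _ _ _ _
  · rw [Complex.cos]; ring_nf

/-- Integral representation of the heat kernel of `SU(2)`. -/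
theorem IsHeatKernel.eq_integral {p : ℝ → SU2 → ℝ} (hp : IsHeatKernel p) (r ϑ z θ : ℝ) {t : ℝ}
    (ht : 0 < t) : p t (cyl r ϑ z) =
      (((√(4 * π * t) : ℝ) : ℂ)⁻¹ *
        ∫ y, gw t θ z y * qser t (cos r * Complex.cos (line θ y))).re := by
  have hK : 0 < √(4 * π * t) := Real.sqrt_pos.2 (by positivity)
  set F : ℕ → ℝ → ℂ := fun m y => gw t θ z y * (((m : ℂ) + 1) *
    Complex.exp (-((m : ℂ) * (m + 2)) * t) *
      chi m (cos r * Complex.cos (line θ y)) (cos r * Complex.cos (line θ y))) with hF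
  have hF' : ∀ m, F m = fun y => ∑ x ∈ Finset.HasAntidiagonal.antidiagonal m,
      (((m : ℂ) + 1) * Complex.exp (-((m : ℂ) * (m + 2)) * t) * disc x.1 x.2 (cos r) (cos r)) *
        (gw t θ z y * Complex.exp (((x.1 - x.2 : ℝ) : ℂ) * (line θ y * Complex.I))) := by
    intro m
    funext y
    simp only [hF, chi_cos_line, Finset.mul_sum]
    refine Finset.sum_congr rfl fun x _ => ?_
    push_cast; ring
  have hint : ∀ m, Integrable (F m) := by
    intro m
    rw [hF' m]
    exact integrable_finsetSum _ fun x _ => (integrable_gw_mul_exp ht θ z _).const_mul _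
  have hcos : ‖((cos r : ℝ) : ℂ)‖ ≤ 1 := by
    rw [Complex.norm_real]; exact abs_cos_le_one r
  -- The eigenvalue splits as `m (m + 2) - (p - q) ^ 2`. The first part stays in `qser`; the second
  -- is produced by the Gaussian integral.
  have heig : ∀ m : ℕ, ∀ x ∈ Finset.HasAntidiagonal.antidiagonal m,
      -((m : ℝ) * (m + 2)) * t + t * ((x.1 : ℝ) - x.2) ^ 2 = -eig x * t := by
    intro m x hx
    have h1 : (x.1 : ℝ) + x.2 = m := by
      exact_mod_cast Finset.HasAntidiagonal.mem_antidiagonal.1 hx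
    rw [eig, ← h1]; ring
  have hnorm : ∀ m : ℕ, ∫ y, ‖F m y‖ ≤ exp ((θ - z) ^ 2 / (4 * t)) * √(4 * π * t) *
      (((m : ℝ) + 1) ^ 3 * exp (-(2 * m * t))) := by
    intro m
    have hb : ∀ x ∈ Finset.HasAntidiagonal.antidiagonal m,
        ∫ y, ‖(((m : ℂ) + 1) * Complex.exp (-((m : ℂ) * (m + 2)) * t) *
          disc x.1 x.2 (cos r) (cos r)) *
        (gw t θ z y * Complex.exp (((x.1 - x.2 : ℝ) : ℂ) * (line θ y * Complex.I)))‖ ≤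
        exp ((θ - z) ^ 2 / (4 * t)) * √(4 * π * t) *
          (((m : ℝ) + 1) ^ 2 * exp (-(2 * m * t))) := by
      intro x hx
      simp only [norm_mul (((m : ℂ) + 1) * Complex.exp (-((m : ℂ) * (m + 2)) * t) *
          disc x.1 x.2 (cos r) (cos r))]
      rw [integral_const_mul, integral_norm_gw_mul_exp ht]
      have hd := norm_disc_le x.1 x.2 hcos
      rw [Complex.conj_ofReal, Finset.HasAntidiagonal.mem_antidiagonal.1 hx] at hd
      have h1 : ‖((m : ℂ) + 1)‖ = m + 1 := by
        have : ((m : ℂ) + 1) = ((m + 1 : ℝ) : ℂ) := by push_cast; rfl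
        rw [this, Complex.norm_real, Real.norm_eq_abs, abs_of_nonneg (by positivity)]
      have h2 : ‖Complex.exp (-((m : ℂ) * (m + 2)) * t)‖ = exp (-((m : ℝ) * (m + 2)) * t) := by
        have : (-((m : ℂ) * (m + 2)) * t) = ((-((m : ℝ) * (m + 2)) * t : ℝ) : ℂ) := by
          push_cast; rfl
        rw [this, Complex.norm_exp, Complex.ofReal_re]
      rw [norm_mul, norm_mul, h1, h2]
      have h3 := heig m x hx
      have h4 : exp (-((m : ℝ) * (m + 2)) * t) * exp (t * ((x.1 : ℝ) - x.2) ^ 2) ≤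
          exp (-(2 * m * t)) := by
        rw [← exp_add, h3]
        refine exp_le_exp.2 ?_
        have := two_mul_le_eig hx
        nlinarith
      calc _ = exp ((θ - z) ^ 2 / (4 * t)) * √(4 * π * t) * (((m : ℝ) + 1) *
            ‖disc x.1 x.2 (cos r) (cos r)‖ *
            (exp (-((m : ℝ) * (m + 2)) * t) * exp (t * ((x.1 : ℝ) - x.2) ^ 2))) := by ring
        _ ≤ exp ((θ - z) ^ 2 / (4 * t)) * √(4 * π * t) * (((m : ℝ) + 1) *
            ((m : ℝ) + 1) * exp (-(2 * m * t))) := by gcongr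
        _ = _ := by ring
    have hsub : ∀ x ∈ Finset.HasAntidiagonal.antidiagonal m, Integrable fun y =>
        ‖(((m : ℂ) + 1) * Complex.exp (-((m : ℂ) * (m + 2)) * t) *
          disc x.1 x.2 (cos r) (cos r)) *
        (gw t θ z y * Complex.exp (((x.1 - x.2 : ℝ) : ℂ) * (line θ y * Complex.I)))‖ :=
      fun x _ => ((integrable_gw_mul_exp ht θ z _).const_mul _).norm
    calc ∫ y, ‖F m y‖ ≤ ∫ y, ∑ x ∈ Finset.HasAntidiagonal.antidiagonal m,
          ‖(((m : ℂ) + 1) * Complex.exp (-((m : ℂ) * (m + 2)) * t) *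
          disc x.1 x.2 (cos r) (cos r)) *
        (gw t θ z y * Complex.exp (((x.1 - x.2 : ℝ) : ℂ) * (line θ y * Complex.I)))‖ := by
          refine integral_mono (hint m).norm (integrable_finsetSum _ hsub) fun y => ?_
          simp only [hF' m]
          exact norm_sum_le _ _
      _ ≤ _ := by
          rw [integral_finsetSum _ hsub]
          refine (Finset.sum_le_sum hb).trans (le_of_eq ?_)
          simp only [Finset.sum_const, Finset.Nat.card_antidiagonal, nsmul_eq_mul]
          push_cast; ring
  have hsum : Summable fun m => ∫ y, ‖F m y‖ :=
    Summable.of_nonneg_of_le (fun m => integral_nonneg fun y => norm_nonneg _) hnorm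
      ((summable_cube_mul_exp ht).mul_left _)
  have h := (hasSum_integral_of_summable_integral_norm hint hsum).mul_left
    (((√(4 * π * t) : ℝ) : ℂ)⁻¹)
  have hre := Complex.hasSum_re h
  have hterm : ∀ m : ℕ, (((√(4 * π * t) : ℝ) : ℂ)⁻¹ * ∫ y, F m y) = ((m : ℂ) + 1) *
      ∑ x ∈ Finset.HasAntidiagonal.antidiagonal m, Complex.exp (-eig x * t) *
        (Complex.exp (((x.1 : ℂ) - x.2) * (z * Complex.I)) * disc x.1 x.2 (cos r) (cos r)) := by
    intro m
    rw [hF' m, integral_finsetSum _ fun x _ => (integrable_gw_mul_exp ht θ z _).const_mul _,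
      Finset.mul_sum, Finset.mul_sum]
    refine Finset.sum_congr rfl fun x hx => ?_
    rw [integral_const_mul, integral_gw_mul_exp ht, Complex.exp_add]
    have h3 : Complex.exp (-((m : ℂ) * (m + 2)) * t) *
        Complex.exp (t * ((x.1 - x.2 : ℝ) : ℂ) ^ 2) = Complex.exp (-eig x * t) := by
      rw [← Complex.exp_add]
      congr 1
      exact_mod_cast heig m x hx
    have hK' : ((√(4 * π * t) : ℝ) : ℂ) ≠ 0 := by exact_mod_cast hK.ne'
    rw [← h3]
    push_cast
    field_simp
  have hq : ∀ y, ∑' m, F m y = gw t θ z y * qser t (cos r * Complex.cos (line θ y)) := by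
    intro y
    simp only [hF, tsum_mul_left, qser]
  simp only [hterm, hq] at hre
  exact (hp.hasSum_cyl r ϑ z ht).unique hre

/-! ### Poisson summation -/

/-- The derivative of the Gaussian, up to a factor. -/
noncomputable def hker (t : ℝ) (s : ℂ) : ℂ := s * Complex.exp (-s ^ 2 / (4 * t))

/-- The terms of indices `m + 1` and `-(m + 1)` pair to a multiple of `sin ((m + 1) δ)`, which is
`sin δ` times a character. The factor `exp (-t)` comes from `(m + 1) ^ 2 = m (m + 2) + 1`. -/
theorem hasSum_int_mul_exp (δ : ℂ) {t : ℝ} (ht : 0 < t) :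
    HasSum (fun n : ℤ => jacobiTheta₂'_term n (δ / (2 * π)) (t / π * Complex.I))
      (-4 * π * Complex.exp (-t) * (Complex.sin δ * qser t (Complex.cos δ))) := by
  have hτ : 0 < ((t / π : ℂ) * Complex.I).im := by
    rw [show (t / π : ℂ) = ((t / π : ℝ) : ℂ) by push_cast; rfl, Complex.im_ofReal_mul, Complex.I_im]
    positivity
  have h0 := hasSum_jacobiTheta₂'_term (δ / (2 * π)) hτ
  have h1 := h0.nat_add_neg
  have hπ : (π : ℂ) ≠ 0 := by exact_mod_cast pi_ne_zero
  have hterm : ∀ n : ℤ, jacobiTheta₂'_term n (δ / (2 * π)) (t / π * Complex.I) =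
      2 * π * Complex.I * n * (Complex.exp (n * δ * Complex.I) * Complex.exp (-(n : ℂ) ^ 2 * t)) := by
    intro n
    rw [jacobiTheta₂'_term, jacobiTheta₂_term, ← Complex.exp_add]
    congr 2
    field_simp
    linear_combination (n : ℂ) ^ 2 * t * Complex.I_sq
  have h2 := (hasSum_nat_add_iff' 1).2 h1
  have hf0 : jacobiTheta₂'_term 0 (δ / (2 * π)) (t / π * Complex.I) = 0 := by
    rw [jacobiTheta₂'_term]; simp
  simp only [Finset.sum_range_one, Nat.cast_zero, neg_zero, hf0, add_zero, sub_zero] at h2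
  have h3 : ∀ m : ℕ, jacobiTheta₂'_term ((m + 1 : ℕ) : ℤ) (δ / (2 * π)) (t / π * Complex.I) +
      jacobiTheta₂'_term (-((m + 1 : ℕ) : ℤ)) (δ / (2 * π)) (t / π * Complex.I) =
      -4 * π * Complex.exp (-t) * (Complex.sin δ * (((m : ℂ) + 1) *
        Complex.exp (-((m : ℂ) * (m + 2)) * t) * chi m (Complex.cos δ) (Complex.cos δ))) := by
    intro m
    have hs := sin_mul_chi m δ (A := Complex.cos δ) (B := Complex.cos δ) (by ring)
    rw [hterm, hterm, show Complex.sin δ * (((m : ℂ) + 1) * Complex.exp (-((m : ℂ) * (m + 2)) * t) *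
      chi m (Complex.cos δ) (Complex.cos δ)) = ((m : ℂ) + 1) *
        Complex.exp (-((m : ℂ) * (m + 2)) * t) * (Complex.sin δ *
        chi m (Complex.cos δ) (Complex.cos δ)) by ring, hs]
    have he : Complex.exp (-((m : ℂ) + 1) ^ 2 * t) =
        Complex.exp (-t) * Complex.exp (-((m : ℂ) * (m + 2)) * t) := by
      rw [← Complex.exp_add]; ring_nf
    have hsin : Complex.exp (((m : ℂ) + 1) * δ * Complex.I) -
        Complex.exp (-(((m : ℂ) + 1) * δ) * Complex.I) =
        2 * Complex.I * Complex.sin (((m : ℂ) + 1) * δ) := by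
      rw [Complex.sin]
      linear_combination (Complex.exp (((m : ℂ) + 1) * δ * Complex.I) -
        Complex.exp (-(((m : ℂ) + 1) * δ) * Complex.I)) * Complex.I_sq
    push_cast
    rw [neg_sq, he, neg_mul ((m : ℂ) + 1) δ]
    linear_combination (2 * π * Complex.I * ((m : ℂ) + 1) * (Complex.exp (-t) *
      Complex.exp (-((m : ℂ) * (m + 2)) * t))) * hsin + 4 * π * ((m : ℂ) + 1) * (Complex.exp (-t) *
      Complex.exp (-((m : ℂ) * (m + 2)) * t)) * Complex.sin (((m : ℂ) + 1) * δ) * Complex.I_sq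
  simp only [h3] at h2
  rw [qser, ← tsum_mul_left, ← tsum_mul_left, h2.tsum_eq]
  exact h0

/-- Poisson summation for the heat kernel of the Laplace-Beltrami operator. -/
theorem hasSum_hker (δ : ℂ) {t : ℝ} (ht : 0 < t) :
    HasSum (fun k : ℤ => hker t (δ + 2 * k * π))
      (Complex.sin δ * qser t (Complex.cos δ) * ((4 * t * √(t / π) * exp (-t) : ℝ) : ℂ)) := by
  have hπ : (π : ℂ) ≠ 0 := by exact_mod_cast pi_ne_zero
  have ht' : (t : ℂ) ≠ 0 := by exact_mod_cast ht.ne'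
  have hI := Complex.I_ne_zero
  set τ : ℂ := t / π * Complex.I with hτdef
  have hτ : 0 < τ.im := by
    rw [hτdef, show (t / π : ℂ) = ((t / π : ℝ) : ℂ) by push_cast; rfl, Complex.im_ofReal_mul,
      Complex.I_im]
    positivity
  have hτ' : -1 / τ = (π / t : ℝ) * Complex.I := by
    rw [hτdef]; push_cast; field_simp; linear_combination -Complex.I_sq
  have hτi : 0 < (-1 / τ).im := by
    rw [hτ', Complex.im_ofReal_mul, Complex.I_im]
    positivity
  have h0 := (hasSum_int_mul_exp δ ht).unique (hasSum_jacobiTheta₂'_term (δ / (2 * π)) hτ)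
  rw [jacobiTheta₂'_functional_equation, ← hτdef] at h0
  -- The functional equation subtracts a multiple of the undifferentiated theta function. Termwise
  -- the factor becomes `2πi n - iδ = -i (δ - 2πn)`, the linear factor of `hker`.
  have h1 := (hasSum_jacobiTheta₂'_term (δ / (2 * π) / τ) hτi).sub
    ((hasSum_jacobiTheta₂_term (δ / (2 * π) / τ) hτi).mul_left (2 * π * Complex.I * (δ / (2 * π))))
  have hE : ∀ n : ℤ, Complex.exp (-π * Complex.I * (δ / (2 * π)) ^ 2 / τ) *
      jacobiTheta₂_term n (δ / (2 * π) / τ) (-1 / τ) =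
      Complex.exp (-(δ - 2 * n * π) ^ 2 / (4 * t)) := by
    intro n
    rw [jacobiTheta₂_term, ← Complex.exp_add, hτ', hτdef]
    congr 1
    push_cast
    field_simp
    linear_combination (16 * π ^ 2 * (n : ℂ) ^ 2 : ℂ) * Complex.I_sq
  have h2 := h1.mul_left (Complex.exp (-π * Complex.I * (δ / (2 * π)) ^ 2 / τ))
  have h3 : ∀ n : ℤ, Complex.exp (-π * Complex.I * (δ / (2 * π)) ^ 2 / τ) *
      (jacobiTheta₂'_term n (δ / (2 * π) / τ) (-1 / τ) - 2 * π * Complex.I * (δ / (2 * π)) *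
        jacobiTheta₂_term n (δ / (2 * π) / τ) (-1 / τ)) =
      -Complex.I * hker t (δ + 2 * (-n : ℤ) * π) := by
    intro n
    rw [jacobiTheta₂'_term, hker]
    push_cast
    rw [show δ + 2 * -(n : ℂ) * π = δ - 2 * n * π by ring, ← hE n]
    field_simp
    ring
  simp only [h3] at h2
  -- The `n`-th theta term is the image at `δ - 2nπ`, hence the change of sign of the index.
  have h4 := (Equiv.neg ℤ).hasSum_iff.2 (h2.mul_left Complex.I)
  simp only [Function.comp_def, Equiv.neg_apply, neg_neg] at h4
  have hsq : (-Complex.I * τ) ^ (1 / 2 : ℂ) = ((√(t / π) : ℝ) : ℂ) := by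
    have : -Complex.I * τ = ((t / π : ℝ) : ℂ) := by
      rw [hτdef]; push_cast; linear_combination (-(t / π) : ℂ) * Complex.I_sq
    rw [this, Real.sqrt_eq_rpow, Complex.ofReal_cpow (by positivity)]
    push_cast; rfl
  rw [hsq] at h0
  have hs0 : ((√(t / π) : ℝ) : ℂ) ≠ 0 := by
    exact_mod_cast (Real.sqrt_pos.2 (by positivity : 0 < t / π)).ne'
  set E := Complex.exp (-π * Complex.I * (δ / (2 * π)) ^ 2 / τ) with hEdef
  set J := jacobiTheta₂' (δ / (2 * π) / τ) (-1 / τ) -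
    2 * π * Complex.I * (δ / (2 * π)) * jacobiTheta₂ (δ / (2 * π) / τ) (-1 / τ) with hJ
  have hval : Complex.I * (E * J) = Complex.sin δ * qser t (Complex.cos δ) *
      ((4 * t * √(t / π) * exp (-t) : ℝ) : ℂ) := by
    have hτ0 : τ ≠ 0 := by rw [hτdef]; exact mul_ne_zero (div_ne_zero ht' hπ) hI
    have h5 : E * J = -4 * π * Complex.exp (-t) * (Complex.sin δ * qser t (Complex.cos δ)) *
        (τ * ((√(t / π) : ℝ) : ℂ)) := by
      rw [h0]; field_simp
    rw [h5, hτdef]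
    push_cast
    field_simp
    linear_combination (-(Complex.sin δ * qser t (Complex.cos δ))) * Complex.I_sq
  rw [← hval]
  refine h4.congr_fun fun k => ?_
  linear_combination (hker t (δ + 2 * k * π)) * Complex.I_sq

/-! ### The hyperbolic secant and the values on the vertical axis -/

theorem exists_pow_mul_exp_le {a : ℝ} (ha : 0 < a) (k : ℕ) :
    ∃ C : ℝ, 0 < C ∧ ∀ x : ℝ, 0 ≤ x → (1 + x) ^ k * exp (-(a * x)) ≤ C := by
  refine ⟨exp a * (k.factorial / a ^ k), by positivity, fun x hx => ?_⟩
  have h := Real.pow_div_factorial_le_exp (a * (1 + x)) (by positivity) k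
  rw [mul_pow, div_le_iff₀ (by positivity)] at h
  have h2 : exp (-(a * x)) = exp a * (exp (a * (1 + x)))⁻¹ := by
    rw [← exp_neg, ← exp_add]; ring_nf
  rw [h2]
  have h3 : 0 < exp (a * (1 + x)) := exp_pos _
  rw [show (1 + x) ^ k * (exp a * (exp (a * (1 + x)))⁻¹) =
    exp a * ((1 + x) ^ k / exp (a * (1 + x))) by field_simp]
  refine mul_le_mul_of_nonneg_left ?_ (exp_pos a).le
  rw [div_le_div_iff₀ h3 (by positivity)]
  linarith

theorem integrable_pow_mul_exp_abs {a : ℝ} (ha : 0 < a) (k : ℕ) :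
    Integrable fun x : ℝ => (1 + |x|) ^ k * exp (-(a * |x|)) := by
  obtain ⟨C, hC, h⟩ := exists_pow_mul_exp_le ha (k + 2)
  refine (integrable_inv_one_add_sq.const_mul C).mono' (by fun_prop) (Eventually.of_forall fun x => ?_)
  have h1 := h |x| (abs_nonneg x)
  rw [Real.norm_eq_abs, abs_of_nonneg (by positivity), ← div_eq_mul_inv,
    le_div_iff₀ (by positivity)]
  refine le_trans ?_ h1
  have h2 : 1 + x ^ 2 ≤ (1 + |x|) ^ 2 := by
    rw [← sq_abs x]; nlinarith [abs_nonneg x]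
  calc (1 + |x|) ^ k * exp (-(a * |x|)) * (1 + x ^ 2)
      ≤ (1 + |x|) ^ k * exp (-(a * |x|)) * (1 + |x|) ^ 2 := by gcongr
    _ = _ := by ring

theorem inv_cosh_le (y : ℝ) : (cosh y)⁻¹ ≤ 2 * exp (-|y|) := by
  have h : exp |y| / 2 ≤ cosh y := by
    rw [← cosh_abs, cosh_eq]
    have := exp_pos (-|y|)
    linarith
  rw [exp_neg, show 2 * (exp |y|)⁻¹ = (exp |y| / 2)⁻¹ by field_simp]
  exact inv_anti₀ (by positivity) h

theorem norm_exp_mul_I (x : ℝ) : ‖Complex.exp (-(x * Complex.I))‖ = 1 := by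
  rw [← neg_mul, ← Complex.ofReal_neg, Complex.norm_exp_ofReal_mul_I]

/-- The two arguments add up to `1`, so the Beta integral is a product `Γ(s) Γ(1 - s)` and the
reflection formula applies. -/
theorem betaIntegral_sech (lam : ℝ) :
    Complex.betaIntegral (1 / 2 - lam / 2 * Complex.I) (1 / 2 + lam / 2 * Complex.I) =
      π / Complex.cosh (π * lam / 2) := by
  have h := Complex.Gamma_mul_Gamma_eq_betaIntegral (s := 1 / 2 - lam / 2 * Complex.I)
    (t := 1 / 2 + lam / 2 * Complex.I) (by simp) (by simp)
  have h2 := Complex.Gamma_mul_Gamma_one_sub (1 / 2 - lam / 2 * Complex.I)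
  rw [show 1 - (1 / 2 - lam / 2 * Complex.I) = 1 / 2 + lam / 2 * Complex.I by ring, h,
    show (1 / 2 - lam / 2 * Complex.I) + (1 / 2 + lam / 2 * Complex.I) = 1 by ring,
    Complex.Gamma_one, one_mul] at h2
  rw [h2, show (π * (1 / 2 - lam / 2 * Complex.I) : ℂ) = π / 2 - (π * lam / 2) * Complex.I by ring,
    Complex.sin_pi_div_two_sub, Complex.cos_mul_I]

/-- The Fourier transform of the hyperbolic secant. -/
theorem integral_exp_div_cosh (lam : ℝ) :
    ∫ y : ℝ, Complex.exp (-((lam * y : ℝ) * Complex.I)) / Complex.cosh y =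
      π / Complex.cosh (π * lam / 2) := by
  rw [← betaIntegral_sech, Complex.betaIntegral, intervalIntegral.integral_of_le zero_le_one,
    integral_Ioc_eq_integral_Ioo, ← range_sigmoid, ← image_univ,
    integral_image_eq_integral_abs_deriv_smul MeasurableSet.univ
      (fun x _ => (hasDerivAt_sigmoid x).hasDerivWithinAt) sigmoid_injective.injOn,
    Measure.restrict_univ]
  have key : ∀ x : ℝ, |sigmoid x * (1 - sigmoid x)| •
      (((sigmoid x : ℝ) : ℂ) ^ (1 / 2 - lam / 2 * Complex.I - 1) *
        (1 - ((sigmoid x : ℝ) : ℂ)) ^ (1 / 2 + lam / 2 * Complex.I - 1)) =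
      (1 / 2 : ℂ) * (fun y : ℝ => Complex.exp (-((lam * y : ℝ) * Complex.I)) / Complex.cosh y)
        (x * (1 / 2)) := by
    intro x
    have hs := sigmoid_pos x
    have hs1 : 0 < 1 - sigmoid x := by linarith [sigmoid_lt_one x]
    -- With this normalisation the sigmoid and its complement are `exp (±x/2 - L)`. Their complex
    -- powers become explicit exponentials, and `exp (-L)` gives the hyperbolic secant at `x / 2`.
    set L := log (2 * cosh (x / 2)) with hL
    have hch := cosh_pos (x / 2)
    have e1 : sigmoid x = exp (x / 2 - L) := by
      rw [exp_sub, hL, exp_log (by positivity), sigmoid_def, cosh_eq]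
      have : exp (-x) = exp (-(x / 2)) * exp (-(x / 2)) := by rw [← exp_add]; ring_nf
      have h3 : exp (x / 2) * exp (-(x / 2)) = 1 := by rw [← exp_add]; simp
      rw [this]
      have := exp_pos (x / 2); have := exp_pos (-(x / 2))
      field_simp
      linear_combination (-exp (-(x / 2))) * h3
    have e2 : 1 - sigmoid x = exp (-(x / 2) - L) := by
      rw [← sigmoid_neg, exp_sub, hL, exp_log (by positivity), sigmoid_def, cosh_eq, neg_neg]
      have : exp x = exp (x / 2) * exp (x / 2) := by rw [← exp_add]; ring_nf
      have h3 : exp (x / 2) * exp (-(x / 2)) = 1 := by rw [← exp_add]; simp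
      rw [this]
      have := exp_pos (x / 2); have := exp_pos (-(x / 2))
      field_simp
      linear_combination (-exp (x / 2)) * h3
    rw [abs_of_pos (mul_pos hs hs1), show (1 : ℂ) - (sigmoid x : ℝ) = ((1 - sigmoid x : ℝ) : ℂ) by
      push_cast; rfl, e2, e1, Complex.cpow_def_of_ne_zero (by exact_mod_cast (exp_pos _).ne'),
      Complex.cpow_def_of_ne_zero (by exact_mod_cast (exp_pos _).ne'), ← Complex.ofReal_log
      (exp_pos _).le, ← Complex.ofReal_log (exp_pos _).le, log_exp, log_exp, ← exp_add,
      Complex.real_smul, ← Complex.exp_add, Complex.ofReal_exp, ← Complex.exp_add]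
    have e3 : Complex.exp (-L) = 1 / (2 * Complex.cosh ((x * (1 / 2) : ℝ))) := by
      rw [← Complex.ofReal_neg, ← Complex.ofReal_exp, exp_neg, hL, exp_log (by positivity)]
      push_cast; ring_nf
    have e4 : (((x / 2 - L + (-(x / 2) - L) : ℝ) : ℂ) +
        (((x / 2 - L : ℝ) : ℂ) * (1 / 2 - lam / 2 * Complex.I - 1) +
          ((-(x / 2) - L : ℝ) : ℂ) * (1 / 2 + lam / 2 * Complex.I - 1))) =
        -((lam * (x * (1 / 2)) : ℝ) * Complex.I) + -L := by push_cast; ring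
    rw [e4, Complex.exp_add, e3]
    ring
  simp only [key]
  rw [integral_const_mul, Measure.integral_comp_mul_right
    (fun y : ℝ => Complex.exp (-((lam * y : ℝ) * Complex.I)) / Complex.cosh y)]
  norm_num
  ring

theorem cosh_ofReal_ne_zero (y : ℝ) : Complex.cosh y ≠ 0 := by
  rw [← Complex.ofReal_cosh]; exact_mod_cast (cosh_pos y).ne'

theorem continuous_exp_div_cosh (lam : ℝ) (f : ℝ → ℂ) (hf : Continuous f) : Continuous fun y : ℝ =>
    f y * (Complex.exp (-((lam * y : ℝ) * Complex.I)) / Complex.cosh y) := by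
  have h1 : Continuous fun y : ℝ => Complex.exp (-((lam * y : ℝ) * Complex.I)) := by fun_prop
  have h2 : Continuous fun y : ℝ => Complex.cosh y := by fun_prop
  exact hf.mul (h1.div h2 cosh_ofReal_ne_zero)

theorem norm_exp_div_cosh_le (lam y : ℝ) :
    ‖Complex.exp (-((lam * y : ℝ) * Complex.I)) / Complex.cosh y‖ ≤ 2 * exp (-|y|) := by
  rw [norm_div, norm_exp_mul_I, ← Complex.ofReal_cosh, Complex.norm_real, Real.norm_eq_abs,
    abs_of_pos (cosh_pos y), one_div]
  exact inv_cosh_le y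

theorem integrable_exp_div_cosh (lam : ℝ) (f : ℝ → ℂ) (hf : Continuous f) (C : ℝ)
    (hC : ∀ y, ‖f y‖ ≤ C * (1 + |y|)) : Integrable fun y : ℝ =>
    f y * (Complex.exp (-((lam * y : ℝ) * Complex.I)) / Complex.cosh y) := by
  refine ((integrable_pow_mul_exp_abs one_pos 1).const_mul (2 * C)).mono'
    (continuous_exp_div_cosh lam f hf).aestronglyMeasurable (Eventually.of_forall fun y => ?_)
  rw [norm_mul]
  refine (mul_le_mul (hC y) (norm_exp_div_cosh_le lam y) (norm_nonneg _)
    ((norm_nonneg _).trans (hC y))).trans (le_of_eq ?_)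
  ring_nf

/-- Differentiate the Fourier transform of the hyperbolic secant with respect to `lam`. -/
theorem integral_mul_exp_div_cosh (lam : ℝ) :
    ∫ y : ℝ, (y * Complex.I) * (Complex.exp (-((lam * y : ℝ) * Complex.I)) / Complex.cosh y) =
      π ^ 2 / 2 * (Complex.sinh (π * lam / 2) / Complex.cosh (π * lam / 2) ^ 2) := by
  have hb : Integrable fun y : ℝ => 2 * ((1 + |y|) ^ 1 * exp (-(1 * |y|))) :=
    (integrable_pow_mul_exp_abs one_pos 1).const_mul 2
  have hn : ∀ y : ℝ, ‖(-(y * Complex.I))‖ = |y| := by intro y; simp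
  have key := (hasDerivAt_integral_of_dominated_loc_of_deriv_le (μ := volume) (x₀ := lam)
    (F := fun l y => Complex.exp (-((l * y : ℝ) * Complex.I)) / Complex.cosh y)
    (F' := fun l y => -(y * Complex.I) * (Complex.exp (-((l * y : ℝ) * Complex.I)) / Complex.cosh y))
    (bound := fun y => 2 * ((1 + |y|) ^ 1 * exp (-(1 * |y|)))) (s := univ) univ_mem
    (Eventually.of_forall fun l => by
      simpa using (continuous_exp_div_cosh l 1 continuous_const).aestronglyMeasurable)
    (by simpa using integrable_exp_div_cosh lam 1 continuous_const 1 (by simp))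
    (continuous_exp_div_cosh lam _ (by fun_prop)).aestronglyMeasurable
    (Eventually.of_forall fun y l _ => by
      rw [norm_mul, hn]
      refine (mul_le_mul (by linarith [abs_nonneg y] : |y| ≤ 1 + |y|) (norm_exp_div_cosh_le l y)
        (norm_nonneg _) (by positivity)).trans (le_of_eq ?_)
      ring_nf) hb
    (Eventually.of_forall fun y l _ => by
      have h1 : HasDerivAt (fun l : ℝ => -((l * y : ℝ) * Complex.I)) (-(y * Complex.I)) l := by
        have := ((hasDerivAt_mul_const (x := l) y).ofReal_comp).mul_const Complex.I
        exact this.neg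
      refine (h1.cexp.div_const _).congr_deriv ?_
      ring)).2
  simp only [integral_exp_div_cosh] at key
  have h2 : HasDerivAt (fun l : ℝ => (π : ℂ) / Complex.cosh (π * l / 2))
      (-(π * (Complex.sinh (π * lam / 2) * (π / 2))) / Complex.cosh (π * lam / 2) ^ 2) lam := by
    have h3 : HasDerivAt (fun l : ℝ => (π * l / 2 : ℂ)) (π / 2) lam := by
      have := (((hasDerivAt_id lam).ofReal_comp).const_mul (π : ℂ)).div_const 2
      simpa using this
    have hne : Complex.cosh (π * lam / 2) ≠ 0 := by
      have := cosh_ofReal_ne_zero (π * lam / 2)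
      push_cast at this; exact this
    refine ((hasDerivAt_const lam (π : ℂ)).fun_div
      ((Complex.hasDerivAt_cosh _).comp lam h3) hne).congr_deriv ?_
    simp only [Function.comp_apply]
    ring
  have h4 := key.unique h2
  have h5 : ∀ y : ℝ, (y * Complex.I) * (Complex.exp (-((lam * y : ℝ) * Complex.I)) / Complex.cosh y)
      = -(-(y * Complex.I) * (Complex.exp (-((lam * y : ℝ) * Complex.I)) / Complex.cosh y)) := by
    intro y; ring
  simp only [h5]
  rw [integral_neg, h4]
  ring

theorem summable_int_gaussian (a b B : ℝ) {A : ℝ} (hA : 0 < A) :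
    Summable fun k : ℤ => (a * |(k : ℝ)| + b) * exp (-(A * (k : ℝ) ^ 2 - B * |(k : ℝ)|)) := by
  have h0 := summable_pow_mul_jacobiTheta₂_term_bound (B / (2 * π)) (T := A / π) (by positivity) 0
  have h1 := summable_pow_mul_jacobiTheta₂_term_bound (B / (2 * π)) (T := A / π) (by positivity) 1
  refine ((h1.mul_left a).add (h0.mul_left b)).congr fun k => ?_
  have : -π * (A / π * (k : ℝ) ^ 2 - 2 * (B / (2 * π)) * ((|k| : ℤ) : ℝ)) =
      -(A * (k : ℝ) ^ 2 - B * |(k : ℝ)|) := by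
    push_cast; field_simp
  rw [this]
  push_cast
  ring

theorem sin_line_pi_div_two (y : ℝ) : Complex.sin (line (π / 2) y) = Complex.cosh y := by
  rw [line, Complex.ofReal_div, Complex.ofReal_ofNat, add_comm, Complex.sin_add_pi_div_two,
    Complex.cos_mul_I]

/-- The summands of the heat kernel on the vertical axis. -/
noncomputable def axisTerm (t z : ℝ) (k : ℤ) : ℝ :=
  exp (-((k : ℝ) * (k + 1) * π ^ 2 / t)) *
    ((2 * (k : ℝ) + 1 + 2 * (k : ℝ) * exp (-(π / (2 * t) * (z + 2 * k * π)))) /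
      (1 + exp (-(π / (2 * t) * (z + 2 * k * π)))) ^ 2)

theorem axisTerm_eq {t : ℝ} (ht : 0 < t) (z : ℝ) (k : ℤ) :
    (√(4 * π * t))⁻¹ * ((4 * t * √(t / π) * exp (-t))⁻¹ *
      exp (-((z + 2 * k * π) * (π + 2 * k * π - z)) / (4 * t)) *
      ((π / 2 + 2 * k * π) * (π / cosh (π * ((z + 2 * k * π) / (2 * t)) / 2)) +
        π ^ 2 / 2 * (sinh (π * ((z + 2 * k * π) / (2 * t)) / 2) /
          cosh (π * ((z + 2 * k * π) / (2 * t)) / 2) ^ 2))) =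
    π ^ 2 * exp t / (4 * t ^ 2) * exp (-(2 * π * z - z ^ 2) / (4 * t)) * axisTerm t z k := by
  set a := π * ((z + 2 * k * π) / (2 * t)) / 2 with ha
  have hs : √(4 * π * t) * √(t / π) = 2 * t := by
    rw [← Real.sqrt_mul (by positivity), show 4 * π * t * (t / π) = (2 * t) ^ 2 by field_simp; ring,
      Real.sqrt_sq (by positivity)]
  have h1 : 0 < √(4 * π * t) := Real.sqrt_pos.2 (by positivity)
  have h2 : 0 < √(t / π) := Real.sqrt_pos.2 (by positivity)
  have hX : exp (-((z + 2 * k * π) * (π + 2 * k * π - z)) / (4 * t)) =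
      exp (-(2 * π * z - z ^ 2) / (4 * t)) * exp (-((k : ℝ) * (k + 1) * π ^ 2 / t)) * exp a := by
    rw [← exp_add, ← exp_add, ha]
    congr 1
    field_simp
    ring
  have hE : exp (-(π / (2 * t) * (z + 2 * k * π))) = exp (-a) ^ 2 := by
    rw [← exp_nat_mul, ha]; congr 1; push_cast; field_simp
  have hK : (√(4 * π * t))⁻¹ * (4 * t * √(t / π) * exp (-t))⁻¹ = exp t / (8 * t ^ 2) := by
    rw [← mul_inv, show √(4 * π * t) * (4 * t * √(t / π) * exp (-t)) =
      4 * t * exp (-t) * (√(4 * π * t) * √(t / π)) by ring, hs, exp_neg]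
    field_simp; norm_num
  rw [axisTerm, hE, hX, ← mul_assoc, ← mul_assoc, hK, cosh_eq, sinh_eq]
  have hv : exp a = (exp (-a))⁻¹ := by rw [exp_neg, inv_inv]
  rw [hv]
  have hv0 := exp_pos (-a)
  generalize exp (-a) = v at *
  have : 1 + v ^ 2 ≠ 0 := by positivity
  field_simp
  ring

/-- On the line of real part `π/2` with `r = 0`, the variable `δ` of the image sum can be the line
variable itself. The series of images is integrated term by term; the sum of the norms is controlled
by a Gaussian in `k`. -/
theorem IsHeatKernel.hasSum_axis {p : ℝ → SU2 → ℝ} (hp : IsHeatKernel p) (ϑ z : ℝ) {t : ℝ}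
    (ht : 0 < t) :
    HasSum (fun k : ℤ => π ^ 2 * exp t / (4 * t ^ 2) * exp (-(2 * π * z - z ^ 2) / (4 * t)) *
      axisTerm t z k) (p t (cyl 0 ϑ z)) := by
  have ht' : (t : ℂ) ≠ 0 := by exact_mod_cast ht.ne'
  set K : ℝ := 4 * t * √(t / π) * exp (-t) with hK
  have hK0 : 0 < K := by
    have : 0 < √(t / π) := Real.sqrt_pos.2 (by positivity)
    positivity
  have hKc : (K : ℂ) ≠ 0 := by exact_mod_cast hK0.ne'
  set F : ℤ → ℝ → ℂ := fun k y =>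
    ((K⁻¹ * exp (-((z + 2 * k * π) * (π + 2 * k * π - z)) / (4 * t)) : ℝ) : ℂ) *
      ((((π / 2 + 2 * k * π : ℝ) : ℂ) + y * Complex.I) *
        (Complex.exp (-((((z + 2 * k * π) / (2 * t)) * y : ℝ) * Complex.I)) / Complex.cosh y))
    with hF
  have hsum : ∀ y, HasSum (fun k => F k y) (gw t (π / 2) z y *
      qser t (cos 0 * Complex.cos (line (π / 2) y))) := by
    intro y
    have h := ((hasSum_hker (line (π / 2) y) ht).mul_left
      (gw t (π / 2) z y * (Complex.cosh y)⁻¹ * (K : ℂ)⁻¹))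
    have hc := cosh_ofReal_ne_zero y
    rw [sin_line_pi_div_two] at h
    have e : gw t (π / 2) z y * (Complex.cosh y)⁻¹ * (K : ℂ)⁻¹ * (Complex.cosh y *
        qser t (Complex.cos (line (π / 2) y)) * (K : ℂ)) = gw t (π / 2) z y *
      qser t (cos 0 * Complex.cos (line (π / 2) y)) := by
      rw [Real.cos_zero, Complex.ofReal_one, one_mul]; field_simp
    rw [e] at h
    refine h.congr_fun fun k => ?_
    -- The squares of the line variable cancel, so only a character of frequency `(z + 2kπ) / (2t)`
    -- in `y` remains.
    have e2 : Complex.exp ((line (π / 2) y - z) ^ 2 / (4 * t)) *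
        Complex.exp (-(line (π / 2) y + 2 * k * π) ^ 2 / (4 * t)) =
        Complex.exp ((-((z + 2 * k * π) * (π + 2 * k * π - z)) / (4 * t) : ℝ)) *
          Complex.exp (-((((z + 2 * k * π) / (2 * t)) * y : ℝ) * Complex.I)) := by
      rw [← Complex.exp_add, ← Complex.exp_add, line]
      congr 1
      push_cast
      field_simp
      ring
    rw [hF, hker, gw]
    push_cast at e2 ⊢
    rw [show (line (π / 2) y : ℂ) = π / 2 + y * Complex.I by rw [line]; push_cast; rfl] at e2 ⊢
    linear_combination (-((Complex.cosh y)⁻¹ * (K : ℂ)⁻¹ * (π / 2 + y * Complex.I + 2 * k * π))) * e2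
  have hfb : ∀ (k : ℤ) (y : ℝ), ‖(((π / 2 + 2 * k * π : ℝ) : ℂ) + y * Complex.I)‖ ≤
      (2 * π * |(k : ℝ)| + (π / 2 + 1)) * (1 + |y|) := by
    intro k y
    refine (norm_add_le _ _).trans ?_
    rw [Complex.norm_real, norm_mul, Complex.norm_real, Complex.norm_I, mul_one]
    have h1 : ‖π / 2 + 2 * (k : ℝ) * π‖ ≤ π / 2 + 2 * π * |(k : ℝ)| := by
      refine (norm_add_le _ _).trans ?_
      rw [Real.norm_eq_abs, Real.norm_eq_abs, abs_of_pos (by positivity), abs_mul, abs_mul,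
        abs_of_pos pi_pos, abs_two]
      linarith
    rw [Real.norm_eq_abs y]
    have h3 := abs_nonneg y
    have h4 : 0 ≤ 2 * π * |(k : ℝ)| + π / 2 := by positivity
    nlinarith
  have hint : ∀ k, Integrable (F k) := fun k =>
    (integrable_exp_div_cosh _ _ (by fun_prop) _ (hfb k)).const_mul _
  set D := ∫ y : ℝ, (1 + |y|) ^ 1 * exp (-(1 * |y|)) with hD
  have hnorm : ∀ k : ℤ, ∫ y, ‖F k y‖ ≤ (K⁻¹ * exp (z * (z - π) / (4 * t)) * (2 * D)) *
      ((2 * π * |(k : ℝ)| + (π / 2 + 1)) *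
        exp (-(π ^ 2 / t * (k : ℝ) ^ 2 - π ^ 2 / (2 * t) * |(k : ℝ)|))) := by
    intro k
    have hle : ∀ y, ‖F k y‖ ≤
        ((K⁻¹ * exp (-((z + 2 * k * π) * (π + 2 * k * π - z)) / (4 * t))) *
          (2 * π * |(k : ℝ)| + (π / 2 + 1)) * 2) * ((1 + |y|) ^ 1 * exp (-(1 * |y|))) := by
      intro y
      rw [hF, norm_mul, norm_mul, Complex.norm_real, Real.norm_eq_abs, abs_of_pos (by positivity)]
      refine (mul_le_mul_of_nonneg_left (mul_le_mul (hfb k y) (norm_exp_div_cosh_le _ y)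
        (norm_nonneg _) (by positivity)) (by positivity)).trans (le_of_eq ?_)
      ring_nf
    refine (integral_mono (hint k).norm ((integrable_pow_mul_exp_abs one_pos 1).const_mul _)
      hle).trans ?_
    rw [integral_const_mul, ← hD]
    have hD0 : 0 ≤ D := integral_nonneg fun y => by positivity
    have h1 : exp (-((z + 2 * k * π) * (π + 2 * k * π - z)) / (4 * t)) ≤
        exp (z * (z - π) / (4 * t)) *
          exp (-(π ^ 2 / t * (k : ℝ) ^ 2 - π ^ 2 / (2 * t) * |(k : ℝ)|)) := by
      rw [← exp_add]
      refine exp_le_exp.2 ?_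
      have hk := neg_le_abs (k : ℝ)
      have e : z * (z - π) / (4 * t) + -(π ^ 2 / t * (k : ℝ) ^ 2 - π ^ 2 / (2 * t) * |(k : ℝ)|) -
          -((z + 2 * k * π) * (π + 2 * k * π - z)) / (4 * t) =
          π ^ 2 / (2 * t) * (|(k : ℝ)| + k) := by
        field_simp; ring
      have : 0 ≤ π ^ 2 / (2 * t) * (|(k : ℝ)| + k) := by
        have : 0 ≤ |(k : ℝ)| + k := by linarith
        positivity
      linarith
    calc _ ≤ K⁻¹ * (exp (z * (z - π) / (4 * t)) *
          exp (-(π ^ 2 / t * (k : ℝ) ^ 2 - π ^ 2 / (2 * t) * |(k : ℝ)|))) *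
          (2 * π * |(k : ℝ)| + (π / 2 + 1)) * 2 * D := by gcongr
      _ = _ := by ring
  have hS : Summable fun k => ∫ y, ‖F k y‖ :=
    Summable.of_nonneg_of_le (fun k => integral_nonneg fun y => norm_nonneg _) hnorm
      ((summable_int_gaussian _ _ _ (by positivity)).mul_left _)
  have h := (hasSum_integral_of_summable_integral_norm hint hS).mul_left
    (((√(4 * π * t) : ℝ) : ℂ)⁻¹)
  simp only [fun y => (hsum y).tsum_eq] at h
  have hre := Complex.hasSum_re h
  rw [← hp.eq_integral 0 ϑ z (π / 2) ht] at hre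
  refine hre.congr_fun fun k => ?_
  rw [← axisTerm_eq ht, ← hK, hF, integral_const_mul]
  have e1 : ∀ y : ℝ, (((π / 2 + 2 * k * π : ℝ) : ℂ) + y * Complex.I) *
        (Complex.exp (-((((z + 2 * k * π) / (2 * t)) * y : ℝ) * Complex.I)) / Complex.cosh y) =
      ((π / 2 + 2 * k * π : ℝ) : ℂ) *
        (Complex.exp (-((((z + 2 * k * π) / (2 * t)) * y : ℝ) * Complex.I)) / Complex.cosh y) +
      (y * Complex.I) *
        (Complex.exp (-((((z + 2 * k * π) / (2 * t)) * y : ℝ) * Complex.I)) / Complex.cosh y) :=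
    fun y => add_mul _ _ _
  have hi1 : Integrable fun y : ℝ =>
      (Complex.exp (-((((z + 2 * k * π) / (2 * t)) * y : ℝ) * Complex.I)) / Complex.cosh y) := by
    simpa using integrable_exp_div_cosh ((z + 2 * k * π) / (2 * t)) 1 continuous_const 1 (by simp)
  have hi2 : Integrable fun y : ℝ => (y * Complex.I) *
      (Complex.exp (-((((z + 2 * k * π) / (2 * t)) * y : ℝ) * Complex.I)) / Complex.cosh y) :=
    integrable_exp_div_cosh _ _ (by fun_prop) 1 (by simp)
  simp only [e1]
  rw [integral_add (hi1.const_mul _) hi2, integral_const_mul, integral_exp_div_cosh,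
    integral_mul_exp_div_cosh]
  rw [← Complex.ofReal_re ((√(4 * π * t))⁻¹ * _)]
  congr 1
  push_cast
  rfl

theorem abs_axisTerm_le (t z : ℝ) (k : ℤ) :
    |axisTerm t z k| ≤ (2 * |(k : ℝ)| + 1) * exp (-((k : ℝ) * (k + 1) * π ^ 2 / t)) := by
  rw [axisTerm, abs_mul, abs_of_pos (exp_pos _), mul_comm]
  refine mul_le_mul_of_nonneg_right ?_ (exp_pos _).le
  have hE := exp_pos (-(π / (2 * t) * (z + 2 * k * π)))
  generalize exp (-(π / (2 * t) * (z + 2 * k * π))) = E at *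
  rw [abs_div, abs_of_pos (by positivity : 0 < (1 + E) ^ 2), div_le_iff₀ (by positivity)]
  have h1 : |2 * (k : ℝ) + 1 + 2 * k * E| ≤ (2 * |(k : ℝ)| + 1) * (1 + E) := by
    have ha := abs_nonneg (k : ℝ)
    refine (abs_add_le _ _).trans ?_
    have h2 : |2 * (k : ℝ) + 1| ≤ 2 * |(k : ℝ)| + 1 := by
      refine (abs_add_le _ _).trans ?_
      rw [abs_mul, abs_two, abs_one]
    have h3 : |2 * (k : ℝ) * E| = 2 * |(k : ℝ)| * E := by
      rw [abs_mul, abs_mul, abs_two, abs_of_pos hE]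
    rw [h3]; nlinarith
  refine h1.trans (mul_le_mul_of_nonneg_left ?_ (by positivity))
  nlinarith

/-- Three cases. For `k = 0` the error is that of `(1 + E)⁻²` with `E` exponentially small. For `k =
-1` the Gaussian factor is `1`, and smallness comes from the size of the denominator. For the other
`k` the Gaussian factor itself is small. The bound is summable in `k` uniformly for `t ≤ 1`. -/
theorem abs_axisTerm_sub_le {t z : ℝ} (ht : 0 < t) (ht1 : t ≤ 1) (hz : z ∈ Ioc 0 π) (k : ℤ) :
    |axisTerm t z k - if k = 0 then 1 else 0| ≤ exp (-(π * z / 2) / t) *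
      ((2 * |(k : ℝ)| + 2) * exp (-(π ^ 2 / 2 * (k : ℝ) ^ 2 - π ^ 2 / 2 * |(k : ℝ)|))) := by
  have hk2 : ∀ k : ℤ, (k : ℝ) * (k + 1) ≥ (k : ℝ) ^ 2 - |(k : ℝ)| := fun k => by
    have := neg_abs_le (k : ℝ); nlinarith
  by_cases h0 : k = 0
  · subst h0
    have hE : exp (-(π / (2 * t) * (z + 2 * (0 : ℤ) * π))) = exp (-(π * z / 2) / t) := by
      congr 1; push_cast; field_simp; ring
    rw [axisTerm, hE]
    have hE0 := exp_pos (-(π * z / 2) / t)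
    generalize exp (-(π * z / 2) / t) = E at *
    simp only [Int.cast_zero, if_true, abs_zero]
    rw [show exp (-(0 * (0 + 1) * π ^ 2 / t)) * ((2 * 0 + 1 + 2 * 0 * E) / (1 + E) ^ 2) - 1 =
      -(E * (2 + E) / (1 + E) ^ 2) by simp; field_simp; ring, abs_neg, abs_of_pos (by positivity),
      div_le_iff₀ (by positivity)]
    simp
    nlinarith [pow_pos hE0 2, pow_pos hE0 3]
  by_cases h1 : k = -1
  · subst h1
    simp only [h0, if_false, sub_zero]
    -- Here the exponential is large, of order `exp (π (2π - z) / (2t))`, and `z ≤ π` makes its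
    -- inverse at most `exp (-πz / (2t))`.
    have hE : (exp (-(π / (2 * t) * (z + 2 * (-1 : ℤ) * π))))⁻¹ ≤ exp (-(π * z / 2) / t) := by
      rw [← exp_neg]
      refine exp_le_exp.2 ?_
      push_cast
      rw [neg_neg, div_mul_eq_mul_div, div_le_div_iff₀ (by positivity) ht]
      have := hz.2
      have := pi_pos
      have h : 0 ≤ π * (π - z) * t := by
        have : 0 ≤ π - z := by linarith
        positivity
      nlinarith
    refine le_trans ?_ (mul_le_mul_of_nonneg_right hE (by positivity))
    rw [axisTerm]
    have hE0 := exp_pos (-(π / (2 * t) * (z + 2 * (-1 : ℤ) * π)))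
    generalize exp (-(π / (2 * t) * (z + 2 * (-1 : ℤ) * π))) = E at *
    have e1 : exp (-(((-1 : ℤ) : ℝ) * ((-1 : ℤ) + 1) * π ^ 2 / t)) = 1 := by simp
    have e2 : exp (-(π ^ 2 / 2 * ((-1 : ℤ) : ℝ) ^ 2 - π ^ 2 / 2 * |((-1 : ℤ) : ℝ)|)) = 1 := by simp
    rw [e1, e2]
    push_cast
    rw [show (1 : ℝ) * ((2 * -1 + 1 + 2 * -1 * E) / (1 + E) ^ 2) = -((1 + 2 * E) / (1 + E) ^ 2) by
      ring, abs_neg, abs_of_pos (by positivity), abs_neg, abs_one, div_le_iff₀ (by positivity)]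
    rw [show E⁻¹ * ((2 * 1 + 2) * 1) * (1 + E) ^ 2 = 4 * (1 + E) ^ 2 / E by field_simp; norm_num,
      le_div_iff₀ hE0]
    nlinarith
  · simp only [h0, if_false, sub_zero]
    refine (abs_axisTerm_le t z k).trans ?_
    have hk : (2 : ℝ) ≤ (k : ℝ) * (k + 1) := by
      have : 2 ≤ k * (k + 1) := by
        rcases lt_or_ge 0 k with h | h
        · nlinarith
        · have : k ≤ -2 := by omega
          nlinarith
      exact_mod_cast this
    have hexp : exp (-((k : ℝ) * (k + 1) * π ^ 2 / t)) ≤ exp (-(π * z / 2) / t) *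
        exp (-(π ^ 2 / 2 * (k : ℝ) ^ 2 - π ^ 2 / 2 * |(k : ℝ)|)) := by
      rw [← exp_add]
      refine exp_le_exp.2 ?_
      have hzz : π * z / 2 ≤ π ^ 2 / 2 := by nlinarith [hz.2, pi_pos]
      have a1 : π ^ 2 / 2 * ((k : ℝ) ^ 2 - |(k : ℝ)|) ≤ π ^ 2 / 2 * ((k : ℝ) * (k + 1)) :=
        mul_le_mul_of_nonneg_left (hk2 k) (by positivity)
      have a2 : π ^ 2 / 2 * ((k : ℝ) * (k + 1)) ≤ π ^ 2 / 2 * ((k : ℝ) * (k + 1)) / t := by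
        rw [le_div_iff₀ ht]
        exact mul_le_of_le_one_right (by positivity) ht1
      have a3 : π * z / 2 / t ≤ π ^ 2 / 2 * ((k : ℝ) * (k + 1)) / t := by
        refine (div_le_div_iff_of_pos_right ht).2 ?_
        nlinarith [pow_pos pi_pos 2]
      -- One half of the exponent pays for the decay in `t`, the other half for summability in `k`.
      have a4 : (k : ℝ) * (k + 1) * π ^ 2 / t = π ^ 2 / 2 * ((k : ℝ) * (k + 1)) / t +
        π ^ 2 / 2 * ((k : ℝ) * (k + 1)) / t := by ring
      rw [a4, neg_div]
      linarith
    calc _ ≤ (2 * |(k : ℝ)| + 2) * (exp (-(π * z / 2) / t) *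
        exp (-(π ^ 2 / 2 * (k : ℝ) ^ 2 - π ^ 2 / 2 * |(k : ℝ)|))) := by gcongr; norm_num
      _ = _ := by ring

theorem IsHeatKernel.axis_isBigO {p : ℝ → SU2 → ℝ} (hp : IsHeatKernel p) (ϑ : ℝ) {z : ℝ}
    (hz : z ∈ Ioc 0 π) :
    (fun t : ℝ => p t (cyl 0 ϑ z) /
        (π ^ 2 * exp t / (4 * t ^ 2) * exp (-(2 * π * z - z ^ 2) / (4 * t))) - 1)
      =O[𝓝[>] 0] fun t : ℝ => exp (-(π * z / 2) / t) := by
  have hS := summable_int_gaussian 2 2 (π ^ 2 / 2) (A := π ^ 2 / 2) (by positivity)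
  refine IsBigO.of_bound (∑' k : ℤ, (2 * |(k : ℝ)| + 2) *
    exp (-(π ^ 2 / 2 * (k : ℝ) ^ 2 - π ^ 2 / 2 * |(k : ℝ)|))) ?_
  filter_upwards [Ioc_mem_nhdsGT (zero_lt_one' ℝ)] with t ht
  have hpre : 0 < π ^ 2 * exp t / (4 * t ^ 2) * exp (-(2 * π * z - z ^ 2) / (4 * t)) := by
    have := ht.1
    positivity
  have h1 := (hp.hasSum_axis ϑ z ht.1).div_const
    (π ^ 2 * exp t / (4 * t ^ 2) * exp (-(2 * π * z - z ^ 2) / (4 * t)))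
  simp only [mul_div_cancel_left₀ _ hpre.ne'] at h1
  have h2 := h1.sub (hasSum_ite_eq (0 : ℤ) (1 : ℝ))
  have h3 := h2.norm_le_of_bounded (hS.hasSum.mul_left (exp (-(π * z / 2) / t)))
    (fun k => abs_axisTerm_sub_le ht.1 ht.2 hz k)
  refine h3.trans (le_of_eq ?_)
  rw [Real.norm_eq_abs, abs_of_pos (exp_pos _), mul_comm]

/-! ### The complex arccosine and coercivity of the phase -/

theorem exists_cos_eq (u : ℂ) : ∃ δ : ℂ, Complex.cos δ = u ∧ 0 ≤ δ.re ∧ δ.re ≤ π := by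
  obtain ⟨δ, hδ⟩ := Complex.cos_surjective u
  set n := round (δ.re / (2 * π)) with hn
  have h1 := abs_sub_round (δ.re / (2 * π))
  have h2 : |δ.re - n * (2 * π)| ≤ π := by
    have : δ.re - n * (2 * π) = (δ.re / (2 * π) - n) * (2 * π) := by field_simp
    rw [this, abs_mul, abs_of_pos (by positivity : 0 < 2 * π)]
    nlinarith [pi_pos]
  have h3 : Complex.cos (δ - n * (2 * π)) = u := by rw [Complex.cos_sub_int_mul_two_pi, hδ]
  have h4 : (δ - n * (2 * π)).re = δ.re - n * (2 * π) := by
    rw [Complex.sub_re, show ((n : ℂ) * (2 * π)) = ((n * (2 * π) : ℝ) : ℂ) by push_cast; rfl,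
      Complex.ofReal_re]
  rcases le_total 0 (δ.re - n * (2 * π)) with h | h
  · exact ⟨δ - n * (2 * π), h3, by rw [h4]; exact h, by rw [h4]; exact (le_abs_self _).trans h2⟩
  · refine ⟨-(δ - n * (2 * π)), by rw [Complex.cos_neg, h3], ?_, ?_⟩
    · rw [Complex.neg_re, h4]; linarith
    · rw [Complex.neg_re, h4]; exact (neg_le_abs _).trans h2

theorem cos_re_im (δ : ℂ) : (Complex.cos δ).re = cos δ.re * cosh δ.im ∧
    (Complex.cos δ).im = -(sin δ.re * sinh δ.im) := by
  have h := Complex.cos_add_mul_I δ.re δ.im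
  rw [Complex.re_add_im] at h
  rw [h]
  constructor
  · rw [← Complex.ofReal_cos, ← Complex.ofReal_cosh, ← Complex.ofReal_sin, ← Complex.ofReal_sinh,
      ← Complex.ofReal_mul, ← Complex.ofReal_mul, Complex.sub_re, Complex.ofReal_re,
      Complex.re_ofReal_mul, Complex.I_re]
    ring
  · rw [← Complex.ofReal_cos, ← Complex.ofReal_cosh, ← Complex.ofReal_sin, ← Complex.ofReal_sinh,
      ← Complex.ofReal_mul, ← Complex.ofReal_mul, Complex.sub_im, Complex.ofReal_im,
      Complex.im_ofReal_mul, Complex.I_im]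
    ring

theorem norm_cos_add_one (δ : ℂ) : ‖Complex.cos δ + 1‖ = cosh δ.im + cos δ.re := by
  have h := cos_re_im δ
  have h1 : 0 ≤ cosh δ.im + cos δ.re := by
    have := one_le_cosh δ.im; have := neg_one_le_cos δ.re; linarith
  rw [← Real.sqrt_sq h1, Complex.norm_def, Complex.normSq_apply, Complex.add_re, Complex.add_im,
    h.1, h.2, Complex.one_re, Complex.one_im]
  congr 1
  have h2 := Real.cosh_sq δ.im
  have h3 := Real.sin_sq_add_cos_sq δ.re
  linear_combination (sinh δ.im ^ 2) * h3 + (cos δ.re ^ 2 - 1) * h2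

theorem norm_cos_sub_one (δ : ℂ) : ‖Complex.cos δ - 1‖ = cosh δ.im - cos δ.re := by
  have h := norm_cos_add_one (δ + π)
  rw [Complex.cos_add_pi, Complex.add_im, Complex.add_re, Complex.ofReal_im, Complex.ofReal_re,
    add_zero, Real.cos_add_pi] at h
  rw [← norm_neg, neg_sub, sub_eq_neg_add, h]
  ring

theorem line_re (θ y : ℝ) : (line θ y).re = θ := by simp [line]

theorem line_im (θ y : ℝ) : (line θ y).im = y := by simp [line]

/-- The identities for `‖cos δ ± 1‖` say that `cosh (im δ)` is half the sum of the distances from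
`cos δ` to the foci `±1`. The triangle inequality for `c cos w ± 1` and averaging of the two bounds
give the claim. -/
theorem cosh_im_le {c : ℝ} (hc0 : 0 < c) (hc1 : c < 1) {δ w : ℂ}
    (h : Complex.cos δ = c * Complex.cos w) : cosh δ.im - 1 ≤ c * (cosh w.im - 1) := by
  have h1 := norm_cos_add_one δ
  have h2 := norm_cos_sub_one δ
  have h3 := norm_cos_add_one w
  have h4 := norm_cos_sub_one w
  have hn1 : ‖(1 - c : ℂ)‖ = 1 - c := by
    rw [← Complex.ofReal_one, ← Complex.ofReal_sub, Complex.norm_real, Real.norm_eq_abs,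
      abs_of_pos (by linarith)]
  have hn2 : ‖(c : ℂ)‖ = c := by rw [Complex.norm_real, Real.norm_eq_abs, abs_of_pos hc0]
  have h5 : ‖Complex.cos δ + 1‖ ≤ c * ‖Complex.cos w + 1‖ + (1 - c) := by
    rw [h, show (c * Complex.cos w + 1 : ℂ) = c * (Complex.cos w + 1) + (1 - c) by ring]
    refine (norm_add_le _ _).trans ?_
    rw [norm_mul, hn1, hn2]
  have h6 : ‖Complex.cos δ - 1‖ ≤ c * ‖Complex.cos w - 1‖ + (1 - c) := by
    rw [h, show (c * Complex.cos w - 1 : ℂ) = c * (Complex.cos w - 1) - (1 - c) by ring]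
    refine (norm_sub_le _ _).trans ?_
    rw [norm_mul, hn1, hn2]
  rw [h1, h3] at h5
  rw [h2, h4] at h6
  linarith

theorem hasDerivAt_log_cosh (y : ℝ) : HasDerivAt (fun y => log (cosh y)) (tanh y) y := by
  rw [tanh_eq_sinh_div_cosh]
  exact (hasDerivAt_cosh y).log (cosh_pos y).ne'

/-- The gain of the Gaussian weight on a vertical line. -/
noncomputable def gain (y : ℝ) : ℝ := y ^ 2 - 2 * log (cosh y)

theorem hasDerivAt_gain (y : ℝ) : HasDerivAt gain (2 * (y - tanh y)) y := by
  unfold gain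
  refine ((hasDerivAt_pow 2 y).fun_sub ((hasDerivAt_log_cosh y).const_mul 2)).congr_deriv ?_
  simp; ring

theorem hasDerivAt_sub_tanh (y : ℝ) : HasDerivAt (fun y => y - tanh y) (tanh y ^ 2) y := by
  have h : HasDerivAt tanh (1 - tanh y ^ 2) y := by
    have h1 := (hasDerivAt_sinh y).fun_div (hasDerivAt_cosh y) (cosh_pos y).ne'
    have h2 : tanh = fun y => sinh y / cosh y := funext tanh_eq_sinh_div_cosh
    rw [h2]
    refine h1.congr_deriv ?_
    have := (cosh_pos y).ne'
    simp only
    field_simp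
  refine ((hasDerivAt_id y).fun_sub h).congr_deriv ?_
  ring

theorem strictMonoOn_sub_tanh : StrictMonoOn (fun y : ℝ => y - tanh y) (Ici 0) := by
  refine strictMonoOn_of_deriv_pos (convex_Ici 0)
    (fun y _ => (hasDerivAt_sub_tanh y).continuousAt.continuousWithinAt) fun y hy => ?_
  rw [interior_Ici] at hy
  rw [(hasDerivAt_sub_tanh y).deriv, tanh_eq_sinh_div_cosh]
  have h1 : 0 < sinh y := sinh_pos_iff.2 hy
  have h2 := cosh_pos y
  positivity

theorem sub_tanh_pos {y : ℝ} (hy : 0 < y) : 0 < y - tanh y := by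
  have h := strictMonoOn_sub_tanh (mem_Ici.2 le_rfl) (le_of_lt hy : y ∈ Ici (0 : ℝ)) hy
  simpa using h

theorem gain_mono {x y : ℝ} (hx : 0 ≤ x) (hxy : x ≤ y) : gain x ≤ gain y := by
  have h : MonotoneOn gain (Ici 0) := by
    refine monotoneOn_of_deriv_nonneg (convex_Ici 0)
      (fun y _ => (hasDerivAt_gain y).continuousAt.continuousWithinAt)
      (fun y _ => (hasDerivAt_gain y).differentiableAt.differentiableWithinAt) fun y hy => ?_
    rw [interior_Ici] at hy
    rw [(hasDerivAt_gain y).deriv]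
    have := sub_tanh_pos hy
    linarith
  exact h hx (hx.trans hxy) hxy

theorem exists_mul_le_sub_tanh {a : ℝ} (ha : 0 < a) :
    ∃ ε : ℝ, 0 < ε ∧ ∀ y, a ≤ y → ε * y ≤ y - tanh y := by
  set m := a - tanh a with hm
  have hm0 : 0 < m := sub_tanh_pos ha
  refine ⟨m / (1 + m), by positivity, fun y hy => ?_⟩
  have h1 : m ≤ y - tanh y :=
    strictMonoOn_sub_tanh.monotoneOn ha.le (ha.le.trans hy) hy
  have h2 : y - 1 ≤ y - tanh y := by have := tanh_lt_one y; linarith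
  rw [div_mul_eq_mul_div, div_le_iff₀ (by positivity)]
  nlinarith

/-- A contraction of `cosh - 1` by a factor `c < 1` shifts the argument by a fixed amount. -/
theorem exists_abs_le_sub {c η : ℝ} (hc0 : 0 < c) (hc1 : c < 1) (hη : 0 < η) :
    ∃ ρ : ℝ, 0 < ρ ∧ ∀ b y : ℝ, η ≤ |y| → cosh b - 1 ≤ c * (cosh y - 1) → |b| ≤ |y| - ρ := by
  have hs1 : √c < 1 := by
    rw [Real.sqrt_lt' one_pos]; linarith
  have hth : 0 < tanh (η / 2) := by
    rw [tanh_eq_sinh_div_cosh]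
    exact div_pos (sinh_pos_iff.2 (by positivity)) (cosh_pos _)
  -- Since `cosh v - 1 = 2 sinh (v/2) ^ 2`, the hypothesis says `sinh (b/2) ≤ √c sinh (y/2)` in
  -- absolute values. This `x` is chosen so that the addition formula for `sinh (Y/2 - x)` still
  -- leaves at least `√c sinh (Y/2)`, using `tanh (η/2) ≤ tanh (Y/2)`.
  set x := arsinh ((1 - √c) * tanh (η / 2)) with hx
  have hsx : sinh x = (1 - √c) * tanh (η / 2) := sinh_arsinh _
  have hx0 : 0 < x := by
    rw [← sinh_pos_iff, hsx]
    exact mul_pos (by linarith) hth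
  refine ⟨2 * x, by positivity, fun b y hy hb => ?_⟩
  rw [← cosh_abs b, ← cosh_abs y] at hb
  have hy0 : 0 ≤ |y| := abs_nonneg y
  have hb0 : 0 ≤ |b| := abs_nonneg b
  set B := |b|
  set Y := |y|
  have e (v : ℝ) : cosh v - 1 = 2 * sinh (v / 2) ^ 2 := by
    have := cosh_two_mul (v / 2)
    rw [show 2 * (v / 2) = v by ring, cosh_sq] at this
    linarith
  rw [e, e] at hb
  have hsB : 0 ≤ sinh (B / 2) := sinh_nonneg_iff.2 (by positivity)
  have hsY : 0 ≤ sinh (Y / 2) := sinh_nonneg_iff.2 (by positivity)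
  have h1 : sinh (B / 2) ≤ √c * sinh (Y / 2) := by
    refine le_of_sq_le_sq ?_ (by positivity)
    rw [mul_pow, Real.sq_sqrt hc0.le]
    linarith
  have h2 : √c * sinh (Y / 2) ≤ sinh (Y / 2 - x) := by
    rw [sinh_sub]
    have h3 : tanh (η / 2) * cosh (Y / 2) ≤ sinh (Y / 2) := by
      have := sinh_nonneg_iff.2 (show 0 ≤ Y / 2 - η / 2 by linarith)
      rw [sinh_sub] at this
      rw [tanh_eq_sinh_div_cosh, div_mul_eq_mul_div, div_le_iff₀ (cosh_pos _)]
      linarith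
    have h4 : sinh (Y / 2) ≤ sinh (Y / 2) * cosh x :=
      le_mul_of_one_le_right hsY (one_le_cosh x)
    rw [hsx]
    nlinarith
  have := sinh_le_sinh.1 (h1.trans h2)
  linarith

theorem exists_gain_le {c η : ℝ} (hc0 : 0 < c) (hc1 : c < 1) (hη : 0 < η) :
    ∃ ε : ℝ, 0 < ε ∧ ∀ b y : ℝ, η ≤ |y| → cosh b - 1 ≤ c * (cosh y - 1) →
      ε * |y| ≤ gain |y| - gain |b| := by
  obtain ⟨ρ, hρ, hb⟩ := exists_abs_le_sub hc0 hc1 hη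
  obtain ⟨ε, hε, hy⟩ := exists_mul_le_sub_tanh (show 0 < η / 2 by positivity)
  -- Capping the shift by `η / 2` keeps the mean value point above `η / 2` and above `|y| / 2`.
  set σ := min ρ (η / 2)
  have hσ : 0 < σ := lt_min hρ (by positivity)
  refine ⟨σ * ε, by positivity, fun b y h1 h2 => ?_⟩
  have h3 := hb b y h1 h2
  have h4 : |b| ≤ |y| - σ := h3.trans (by linarith [min_le_left ρ (η / 2)])
  have h5 : σ ≤ η / 2 := min_le_right _ _
  have h6 := gain_mono (abs_nonneg b) h4
  obtain ⟨ξ, hξ, h7⟩ := exists_hasDerivAt_eq_slope gain (fun y => 2 * (y - tanh y))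
    (show |y| - σ < |y| by linarith)
    (fun v _ => (hasDerivAt_gain v).continuousAt.continuousWithinAt) fun v _ => hasDerivAt_gain v
  have h8 := hy ξ (by linarith [hξ.1])
  rw [eq_div_iff (by linarith)] at h7
  have h9 : |y| ≤ 2 * ξ := by linarith [hξ.1]
  have h10 : ε * |y| ≤ 2 * (ξ - tanh ξ) := by nlinarith
  have h11 : σ * (ε * |y|) ≤ σ * (2 * (ξ - tanh ξ)) := by gcongr
  nlinarith

theorem cosh_im_le_cosh {c : ℝ} (hc0 : 0 < c) (hc1 : c < 1) {δ w : ℂ}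
    (h : Complex.cos δ = c * Complex.cos w) : cosh δ.im ≤ cosh w.im := by
  have h1 := cosh_im_le hc0 hc1 h
  have h2 := one_le_cosh w.im
  nlinarith

theorem cos_re_mul_cosh {c : ℝ} {δ w : ℂ} (h : Complex.cos δ = c * Complex.cos w) :
    cos δ.re * cosh δ.im = c * cos w.re * cosh w.im := by
  have h1 := (cos_re_im δ).1
  rw [h, Complex.re_ofReal_mul, (cos_re_im w).1] at h1
  linarith

/-- This is `x < tan x` in integrated form. It trades the loss in the real part of `δ` against the
logarithms of `cosh` contained in `gain`. -/
theorem antitoneOn_log_cos : AntitoneOn (fun x : ℝ => log (cos x) + x ^ 2 / 2) (Ico 0 (π / 2)) := by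
  have hd (x : ℝ) (hx : x ∈ Ico 0 (π / 2)) :
      HasDerivAt (fun x : ℝ => log (cos x) + x ^ 2 / 2) (-sin x / cos x + x) x := by
    have hc : cos x ≠ 0 := (cos_pos_of_mem_Ioo ⟨by linarith [hx.1, pi_pos], hx.2⟩).ne'
    refine (((hasDerivAt_cos x).log hc).fun_add
      ((hasDerivAt_pow 2 x).div_const 2)).congr_deriv ?_
    simp
  refine antitoneOn_of_deriv_nonpos (convex_Ico _ _)
    (fun x hx => (hd x hx).continuousAt.continuousWithinAt)
    (fun x hx => (hd x (interior_subset hx)).differentiableAt.differentiableWithinAt) fun x hx => ?_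
  rw [(hd x (interior_subset hx)).deriv]
  rw [interior_Ico] at hx
  have := lt_tan hx.1 hx.2
  rw [tan_eq_sin_div_cos] at this
  rw [neg_div]
  linarith

/-- Coercivity of the phase away from the critical point. -/
theorem exists_phase_ge {c θ η : ℝ} (hc0 : 0 < c) (hc1 : c < 1) (hη : 0 < η) :
    ∃ ε : ℝ, 0 < ε ∧ ∀ (δ : ℂ) (y : ℝ), 0 ≤ δ.re → δ.re ≤ π → η ≤ |y| →
      Complex.cos δ = c * Complex.cos (line θ y) →
      ε * |y| ≤ y ^ 2 - δ.im ^ 2 + δ.re ^ 2 - arccos (c * cos θ) ^ 2 := by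
  obtain ⟨ε, hε, hg⟩ := exists_gain_le hc0 hc1 hη
  refine ⟨ε, hε, fun δ y h0 hπ hy h => ?_⟩
  have h1 := hg δ.im y hy (by have := cosh_im_le hc0 hc1 h; rwa [line_im] at this)
  have h2 := cosh_im_le_cosh hc0 hc1 h
  have h3 := cos_re_mul_cosh h
  rw [line_im] at h2 h3
  rw [line_re] at h3
  refine h1.trans ?_
  unfold gain
  simp only [sq_abs, cosh_abs]
  have h4 : log (cosh δ.im) ≤ log (cosh y) := log_le_log (cosh_pos _) h2
  set α₀ := arccos (c * cos θ) with hα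
  have hα0 : 0 ≤ α₀ := arccos_nonneg _
  have hcos : cos α₀ = c * cos θ := by
    have h5 := abs_cos_le_one θ
    have h6 : |c * cos θ| ≤ 1 := by
      rw [abs_mul, abs_of_pos hc0]
      nlinarith [abs_nonneg (cos θ)]
    exact cos_arccos (neg_le_of_abs_le h6) (le_of_abs_le h6)
  have hb := cosh_pos δ.im
  -- It remains to bound `re δ ^ 2 - α₀ ^ 2` below by `2 log cosh (im δ) - 2 log cosh y`, knowing
  -- that `cos (re δ) cosh (im δ) = cos α₀ cosh y`. If `cos θ ≤ 0` the real part can only increase;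
  -- otherwise it decreases, at a rate controlled by `antitoneOn_log_cos`.
  rcases le_or_gt (cos θ) 0 with hθ | hθ
  · have h5 : cos δ.re ≤ cos α₀ := by
      rw [hcos]
      have : c * cos θ * cosh y ≤ c * cos θ * cosh δ.im :=
        mul_le_mul_of_nonpos_left h2 (mul_nonpos_of_nonneg_of_nonpos hc0.le hθ)
      rw [← h3] at this
      exact le_of_mul_le_mul_right this hb
    have h6 : α₀ ≤ δ.re := by
      by_contra! hlt
      exact absurd (cos_lt_cos_of_nonneg_of_le_pi h0 (arccos_le_pi _) hlt) (not_lt.2 h5)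
    nlinarith
  · have hp : 0 < cos α₀ := by rw [hcos]; positivity
    have hpd : 0 < cos δ.re := by
      have : 0 < cos δ.re * cosh δ.im := by rw [h3]; have := cosh_pos y; positivity
      exact pos_of_mul_pos_left this hb.le
    have h5 : cos α₀ ≤ cos δ.re := by
      rw [hcos]
      have : c * cos θ * cosh δ.im ≤ c * cos θ * cosh y := by gcongr
      rw [← h3] at this
      exact le_of_mul_le_mul_right this hb
    have h6 : δ.re ≤ α₀ := by
      by_contra! hlt
      exact absurd (cos_lt_cos_of_nonneg_of_le_pi hα0 hπ hlt) (not_lt.2 h5)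
    have h7 : α₀ < π / 2 := by
      by_contra! hle
      have := cos_nonpos_of_pi_div_two_le_of_le hle ((arccos_le_pi _).trans (by linarith [pi_pos]))
      linarith
    have h8 := antitoneOn_log_cos ⟨h0, h6.trans_lt h7⟩ ⟨hα0, h7⟩ h6
    have h9 : log (cos δ.re) + log (cosh δ.im) = log (cos α₀) + log (cosh y) := by
      rw [← log_mul hpd.ne' hb.ne', ← log_mul hp.ne' (cosh_pos y).ne', h3, hcos]
    simp only at h8
    linarith

/-! ### Estimates of the image sum -/

theorem hker_neg (t : ℝ) (s : ℂ) : hker t (-s) = -hker t s := by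
  unfold hker
  rw [neg_sq, neg_mul]

theorem norm_exp_neg_sq_div (s : ℂ) (t : ℝ) :
    ‖Complex.exp (-s ^ 2 / (4 * t))‖ = exp (-(s.re ^ 2 - s.im ^ 2) / (4 * t)) := by
  rw [Complex.norm_exp, show (-s ^ 2 / (4 * t) : ℂ) = -s ^ 2 / ((4 * t : ℝ) : ℂ) by push_cast; rfl,
    Complex.div_ofReal_re, Complex.neg_re, sq, Complex.mul_re, ← sq, ← sq]

theorem hasDerivAt_hker {t : ℝ} (ht : 0 < t) (s : ℂ) :
    HasDerivAt (hker t) ((1 - s ^ 2 / (2 * t)) * Complex.exp (-s ^ 2 / (4 * t))) s := by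
  have ht' : (t : ℂ) ≠ 0 := by exact_mod_cast ht.ne'
  have h := (hasDerivAt_id s).fun_mul
    (((hasDerivAt_pow 2 s).fun_neg.div_const (4 * t : ℂ)).cexp)
  refine h.congr_deriv ?_
  simp only [id]
  field_simp
  push_cast
  ring

/-- Mean value inequality along the segment from `a - s` to `a + s`. The factor `‖s‖` is essential:
with `s = δ` or `s = δ - π` it compensates the zero of `sin δ` by which the image sum is divided. -/
theorem norm_hker_sub_le {t a : ℝ} {s : ℂ} (ht : 0 < t) (ha : |s.re| ≤ a) :
    ‖hker t (a + s) - hker t (a - s)‖ ≤ 2 * ‖s‖ * ((1 + (a + ‖s‖) ^ 2 / (2 * t)) *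
      exp (-((a - |s.re|) ^ 2 - s.im ^ 2) / (4 * t))) := by
  have ha0 : 0 ≤ a := (abs_nonneg _).trans ha
  have hd (v : ℝ) : HasDerivAt (fun v : ℝ => hker t (a + v * s))
      ((1 - (a + v * s) ^ 2 / (2 * t)) * Complex.exp (-(a + v * s) ^ 2 / (4 * t)) * s) v := by
    have h1 : HasDerivAt (fun v : ℝ => (a + v * s : ℂ)) s v := by
      have := (Complex.ofRealCLM.hasDerivAt (x := v)).mul_const s
      simpa using this.const_add (a : ℂ)
    exact (hasDerivAt_hker ht _).comp v h1
  have hb : ∀ v ∈ Ico (-1 : ℝ) 1,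
      ‖(1 - (a + v * s) ^ 2 / (2 * t)) * Complex.exp (-(a + v * s) ^ 2 / (4 * t)) * s‖ ≤
      ‖s‖ * ((1 + (a + ‖s‖) ^ 2 / (2 * t)) *
      exp (-((a - |s.re|) ^ 2 - s.im ^ 2) / (4 * t))) := by
    intro v hv
    have hv1 : |v| ≤ 1 := abs_le.2 ⟨hv.1, hv.2.le⟩
    rw [norm_mul, norm_mul, mul_comm, norm_exp_neg_sq_div]
    have h1 : ‖(a + v * s : ℂ)‖ ≤ a + ‖s‖ := by
      refine (norm_add_le _ _).trans ?_
      rw [norm_mul, Complex.norm_real, Complex.norm_real, Real.norm_eq_abs, Real.norm_eq_abs,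
        abs_of_nonneg ha0]
      nlinarith [norm_nonneg s]
    have h2 : ‖1 - (a + v * s : ℂ) ^ 2 / (2 * t)‖ ≤ 1 + (a + ‖s‖) ^ 2 / (2 * t) := by
      refine (norm_sub_le _ _).trans ?_
      rw [norm_one, norm_div, norm_pow, norm_mul, Complex.norm_real, Complex.norm_ofNat,
        Real.norm_eq_abs, abs_of_pos ht]
      gcongr
    have h3 : (a + v * s : ℂ).re = a + v * s.re := by simp
    have h4 : (a + v * s : ℂ).im = v * s.im := by simp
    have h5 : a - |s.re| ≤ a + v * s.re := by
      have : -(v * s.re) ≤ |s.re| := by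
        refine (neg_le_abs _).trans ?_
        rw [abs_mul]
        nlinarith [abs_nonneg s.re]
      linarith
    have h6 : (v * s.im) ^ 2 ≤ s.im ^ 2 := by
      rw [mul_pow]
      have : v ^ 2 ≤ 1 := (sq_le_one_iff_abs_le_one v).2 hv1
      nlinarith [sq_nonneg s.im]
    have h7 : (a - |s.re|) ^ 2 ≤ (a + v * s.re) ^ 2 := by
      have : 0 ≤ a - |s.re| := by linarith
      gcongr
    rw [h3, h4]
    gcongr
  have h := norm_image_sub_le_of_norm_deriv_le_segment'
    (fun v _ => (hd v).hasDerivWithinAt) hb 1 ⟨by norm_num, le_rfl⟩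
  push_cast at h
  rw [one_mul, neg_one_mul, ← sub_eq_add_neg] at h
  refine h.trans (le_of_eq ?_)
  ring

/-- `‖sin s‖ ^ 2` is `sin (re s) ^ 2 + sinh (im s) ^ 2`; Jordan's inequality handles the first
square and `|x| ≤ |sinh x|` the second. -/
theorem norm_le_norm_sin {s : ℂ} (h : |s.re| ≤ π / 2) : ‖s‖ ≤ π / 2 * ‖Complex.sin s‖ := by
  have h1 := norm_cos_sub_one (2 * s)
  have h2 : Complex.cos (2 * s) - 1 = -2 * Complex.sin s ^ 2 := by
    rw [Complex.cos_two_mul, Complex.cos_sq']; ring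
  have h3 : (2 * s).im = 2 * s.im := by simp
  have h4 : (2 * s).re = 2 * s.re := by simp
  rw [h2, norm_mul, norm_pow, norm_neg, Complex.norm_ofNat, h3, h4, cosh_two_mul, cos_two_mul,
    cosh_sq, cos_sq'] at h1
  have h5 : 2 / π * |s.re| ≤ |sin s.re| := mul_abs_le_abs_sin h
  have h6 : |s.im| ≤ |sinh s.im| := by
    rw [abs_sinh]
    exact self_le_sinh_iff.2 (abs_nonneg _)
  have h7 := sq_abs (sin s.re)
  have h8 := sq_abs (sinh s.im)
  refine le_of_sq_le_sq ?_ (by positivity)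
  rw [mul_pow, show ‖Complex.sin s‖ ^ 2 = sinh s.im ^ 2 + sin s.re ^ 2 by linarith,
    ← Complex.normSq_eq_norm_sq, Complex.normSq_apply, ← h7, ← h8]
  have h9 : |s.re| ≤ π / 2 * |sin s.re| := by
    have := mul_le_mul_of_nonneg_left h5 (by positivity : 0 ≤ π / 2)
    rwa [← mul_assoc, show π / 2 * (2 / π) = 1 by field_simp, one_mul] at this
  have h10 : |s.im| ≤ π / 2 * |sinh s.im| := by
    nlinarith [pi_gt_three, abs_nonneg (sinh s.im)]
  have h11 := mul_self_le_mul_self (abs_nonneg _) h9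
  have h12 := mul_self_le_mul_self (abs_nonneg _) h10
  rw [abs_mul_abs_self] at h11 h12
  nlinarith

/-- The weight controlling the `n`-th pair of images. -/
noncomputable def imageWeight (n : ℕ) : ℝ := 2 * (1 + (2 * π) ^ 2 * (n + 1) ^ 2) * exp (-n)

theorem summable_imageWeight : Summable imageWeight := by
  have h (k : ℕ) : Summable fun n : ℕ => (n : ℝ) ^ k * exp (-n) := by
    simpa using Real.summable_pow_mul_exp_neg_nat_mul k one_pos
  have h3 := ((h 0).mul_left (2 * (1 + (2 * π) ^ 2))).add
    (((h 1).mul_left (4 * (2 * π) ^ 2)).add ((h 2).mul_left (2 * (2 * π) ^ 2)))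
  refine h3.congr fun n => ?_
  unfold imageWeight
  ring

theorem norm_image_le {t α β a : ℝ} {s : ℂ} {n : ℕ} (ht : 0 < t) (ht1 : t ≤ 1) (hs : s.im = β)
    (hsa : |s.re| ≤ a) (hs2 : |s.re| ≤ π / 2) (ha : a ≤ (2 * n + 1) * π)
    (hα : α ^ 2 + 4 * n ≤ (a - |s.re|) ^ 2) :
    ‖hker t (a + s) - hker t (a - s)‖ ≤
      ‖s‖ * ((1 + |β|) ^ 2 / t * exp (-(α ^ 2 - β ^ 2) / (4 * t))) * imageWeight n := by
  have ha0 : 0 ≤ a := (abs_nonneg _).trans hsa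
  refine (norm_hker_sub_le ht hsa).trans ?_
  have h1 : a + ‖s‖ ≤ 2 * π * (n + 1) * (1 + |β|) := by
    have h2 := Complex.norm_le_abs_re_add_abs_im s
    rw [hs] at h2
    have h3 : |β| ≤ 2 * π * (n + 1) * |β| := by
      refine le_mul_of_one_le_left (abs_nonneg _) ?_
      have : (0 : ℝ) ≤ n := n.cast_nonneg
      nlinarith [pi_gt_three]
    nlinarith [pi_pos]
  have h2 : 1 + (a + ‖s‖) ^ 2 / (2 * t) ≤
      (1 + |β|) ^ 2 / t * (1 + (2 * π) ^ 2 * (n + 1) ^ 2) := by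
    have h3 : (a + ‖s‖) ^ 2 ≤ (2 * π * (n + 1) * (1 + |β|)) ^ 2 := by gcongr
    have h4 : 1 ≤ (1 + |β|) ^ 2 := one_le_pow₀ (by linarith [abs_nonneg β])
    have h5 : 1 ≤ (1 + |β|) ^ 2 / t := by rw [le_div_iff₀ ht]; linarith
    have h6 : (a + ‖s‖) ^ 2 / (2 * t) ≤ (2 * π * (n + 1) * (1 + |β|)) ^ 2 / t := by
      gcongr
      linarith
    refine (add_le_add h5 h6).trans (le_of_eq ?_)
    ring
  have h3 : exp (-((a - |s.re|) ^ 2 - s.im ^ 2) / (4 * t)) ≤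
      exp (-(α ^ 2 - β ^ 2) / (4 * t)) * exp (-n) := by
    rw [← exp_add, hs]
    gcongr
    have : (-n : ℝ) ≥ -n / t := by
      rw [ge_iff_le, div_le_iff₀ ht]
      nlinarith [(n.cast_nonneg : (0 : ℝ) ≤ n)]
    have h5 : -(α ^ 2 - β ^ 2) / (4 * t) + -n / t = (-(α ^ 2 - β ^ 2) - 4 * n) / (4 * t) := by
      field_simp
      ring
    refine le_trans ?_ (by linarith : -(α ^ 2 - β ^ 2) / (4 * t) + -n / t ≤ _)
    rw [h5]
    gcongr
    linarith
  calc _ ≤ 2 * ‖s‖ * (((1 + |β|) ^ 2 / t * (1 + (2 * π) ^ 2 * (n + 1) ^ 2)) *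
        (exp (-(α ^ 2 - β ^ 2) / (4 * t)) * exp (-n))) := by gcongr
    _ = _ := by unfold imageWeight; ring

/-- Uniform bound for the image sum, in the strip `0 ≤ re δ ≤ π`. -/
theorem exists_norm_image_sum_le : ∃ C : ℝ, 0 < C ∧ ∀ (t : ℝ) (δ S : ℂ), 0 < t → t ≤ 1 →
    0 ≤ δ.re → δ.re ≤ π → HasSum (fun k : ℤ => hker t (δ + 2 * k * π)) S →
    ‖S‖ ≤ ‖Complex.sin δ‖ * (C / t * (1 + |δ.im|) ^ 2 *
      exp (-(δ.re ^ 2 - δ.im ^ 2) / (4 * t))) := by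
  obtain ⟨W, hW⟩ := summable_imageWeight
  have hW0 : 0 ≤ W := hW.nonneg fun n => by unfold imageWeight; positivity
  refine ⟨π / 2 * (W + 1), by positivity, fun t δ S ht ht1 h0 hπ hS => ?_⟩
  set E := exp (-(δ.re ^ 2 - δ.im ^ 2) / (4 * t)) with hE
  have h4 : 1 ≤ (1 + |δ.im|) ^ 2 := one_le_pow₀ (by linarith [abs_nonneg δ.im])
  rcases le_or_gt δ.re (π / 2) with h | h
  -- Near `re δ = 0` the images `k = n` and `k = -n` are symmetric about `2nπ`. The image `k = 0` is
  -- counted twice and is subtracted once afterwards.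
  · have h1 := hS.nat_add_neg
    have hre : |δ.re| ≤ π / 2 := by rwa [abs_of_nonneg h0]
    have hb : ∀ n : ℕ, ‖hker t (δ + 2 * (n : ℤ) * π) + hker t (δ + 2 * (-(n : ℤ) : ℤ) * π)‖ ≤
        ‖δ‖ * ((1 + |δ.im|) ^ 2 / t * E) * imageWeight n := by
      intro n
      have e : hker t (δ + 2 * (n : ℤ) * π) + hker t (δ + 2 * (-(n : ℤ) : ℤ) * π) =
          hker t ((2 * n * π : ℝ) + δ) - hker t ((2 * n * π : ℝ) - δ) := by
        rw [← neg_sub δ, hker_neg]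
        push_cast
        ring_nf
      rw [e]
      rcases Nat.eq_zero_or_pos n with hn | hn
      · subst hn
        simp only [Nat.cast_zero, mul_zero, zero_mul, Complex.ofReal_zero, zero_add, zero_sub,
          hker_neg, sub_neg_eq_add, ← two_mul]
        rw [norm_mul, Complex.norm_ofNat, hker, norm_mul, norm_exp_neg_sq_div, ← hE]
        have : 1 ≤ (1 + |δ.im|) ^ 2 / t := by
          rw [le_div_iff₀ ht]; linarith
        have hw : 2 ≤ imageWeight 0 := by
          unfold imageWeight
          simp
          nlinarith [sq_nonneg (2 * π)]
        calc 2 * (‖δ‖ * E) = ‖δ‖ * (1 * E) * 2 := by ring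
          _ ≤ _ := by gcongr
      · have hn1 : (1 : ℝ) ≤ n := by exact_mod_cast hn
        refine norm_image_le ht ht1 rfl ?_ hre (by nlinarith [pi_pos]) ?_
        · refine hre.trans ?_
          nlinarith [pi_pos]
        · rw [abs_of_nonneg h0]
          have : (2 * n * π - δ.re) ^ 2 - δ.re ^ 2 = 4 * n * (π * (n * π - δ.re)) := by ring
          have h5 : 1 ≤ π * (n * π - δ.re) := by
            have : π / 2 ≤ n * π - δ.re := by nlinarith [pi_pos]
            nlinarith [pi_gt_three]
          nlinarith
    have h2 := h1.norm_le_of_bounded (hW.mul_left _) hb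
    have h3 : ‖hker t (δ + 2 * (0 : ℤ) * π)‖ ≤ ‖δ‖ * ((1 + |δ.im|) ^ 2 / t * E) := by
      rw [Int.cast_zero, mul_zero, zero_mul, add_zero, hker, norm_mul, norm_exp_neg_sq_div, ← hE]
      have : 1 ≤ (1 + |δ.im|) ^ 2 / t := by
        rw [le_div_iff₀ ht]; linarith
      calc ‖δ‖ * E = ‖δ‖ * (1 * E) := by ring
        _ ≤ _ := by gcongr
    have h6 := norm_sub_le (S + hker t (δ + 2 * (0 : ℤ) * π)) (hker t (δ + 2 * (0 : ℤ) * π))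
    rw [add_sub_cancel_right] at h6
    have h7 := norm_le_norm_sin hre
    calc ‖S‖ ≤ ‖δ‖ * ((1 + |δ.im|) ^ 2 / t * E) * W + ‖δ‖ * ((1 + |δ.im|) ^ 2 / t * E) :=
          h6.trans (add_le_add h2 h3)
      _ = ‖δ‖ * ((1 + |δ.im|) ^ 2 / t * E * (W + 1)) := by ring
      _ ≤ (π / 2 * ‖Complex.sin δ‖) * ((1 + |δ.im|) ^ 2 / t * E * (W + 1)) := by gcongr
      _ = _ := by ring
  · have h1 := hS.nat_add_neg_add_one
    have hre' : (δ - π).re = δ.re - π := by simp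
    have him : (δ - π).im = δ.im := by simp
    have hre : |(δ - π).re| = π - δ.re := by
      rw [hre', abs_of_nonpos (by linarith)]; ring
    have hb : ∀ n : ℕ, ‖hker t (δ + 2 * (n : ℤ) * π) +
        hker t (δ + 2 * (-((n : ℤ) + 1) : ℤ) * π)‖ ≤
        ‖δ - π‖ * ((1 + |δ.im|) ^ 2 / t * E) * imageWeight n := by
      intro n
      have e : hker t (δ + 2 * (n : ℤ) * π) + hker t (δ + 2 * (-((n : ℤ) + 1) : ℤ) * π) =
          hker t (((2 * n + 1) * π : ℝ) + (δ - π)) - hker t (((2 * n + 1) * π : ℝ) - (δ - π)) := by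
        rw [← neg_sub (δ - π), hker_neg]
        push_cast
        ring_nf
      rw [e]
      have hn0 : (0 : ℝ) ≤ n := n.cast_nonneg
      refine norm_image_le ht ht1 him ?_ (by linarith) le_rfl ?_
      · rw [hre]; nlinarith [pi_pos]
      · rw [hre]
        have : ((2 * n + 1) * π - (π - δ.re)) ^ 2 = δ.re ^ 2 + 4 * n * (π * (n * π + δ.re)) := by
          ring
        rw [this]
        have h5 : 1 ≤ π * (n * π + δ.re) := by
          have : π / 2 ≤ n * π + δ.re := by nlinarith [pi_pos]
          nlinarith [pi_gt_three]
        nlinarith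
    have h2 := h1.norm_le_of_bounded (hW.mul_left _) hb
    have h7 := norm_le_norm_sin (s := δ - π) (by rw [hre]; linarith)
    rw [Complex.sin_sub_pi, norm_neg] at h7
    calc ‖S‖ ≤ ‖δ - π‖ * ((1 + |δ.im|) ^ 2 / t * E) * W := h2
      _ = ‖δ - π‖ * ((1 + |δ.im|) ^ 2 / t * E * W) := by ring
      _ ≤ (π / 2 * ‖Complex.sin δ‖) * ((1 + |δ.im|) ^ 2 / t * E * (W + 1)) := by
        gcongr; linarith
      _ = _ := by ring

/-- Away from `re δ = π` the image sum is its leading term up to an exponentially small error. -/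
theorem exists_norm_image_sum_sub_le {α₁ R : ℝ} (hα : α₁ < π) : ∃ C a : ℝ, 0 < C ∧ 0 < a ∧
    ∀ (t : ℝ) (δ S : ℂ), 0 < t → t ≤ 1 → |δ.re| ≤ α₁ → ‖δ‖ ≤ R →
    HasSum (fun k : ℤ => hker t (δ + 2 * k * π)) S →
    ‖Complex.exp (δ ^ 2 / (4 * t)) * S - δ‖ ≤ C * exp (-(a / t)) := by
  -- The exponent of the `k`-th image exceeds that of the zeroth by at least `2 A k ^ 2 / t`. One
  -- half gives `exp (-A / t)` for `k ≠ 0`, the other half is summable for `t ≤ 1`.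
  set A := π * (π - α₁) / 2 with hA
  have hA0 : 0 < A := by have : 0 < π - α₁ := by linarith
                         positivity
  obtain ⟨W, hW⟩ := summable_int_gaussian (2 * π) R 0 hA0
  refine ⟨|W| + 1, A, by positivity, hA0, fun t δ S ht ht1 hδ hR hS => ?_⟩
  have ht' : (t : ℂ) ≠ 0 := by exact_mod_cast ht.ne'
  have h1 := (hS.mul_left (Complex.exp (δ ^ 2 / (4 * t)))).sub (hasSum_ite_eq (0 : ℤ) δ)
  have hR0 : 0 ≤ R := (norm_nonneg _).trans hR
  have hb : ∀ k : ℤ, ‖Complex.exp (δ ^ 2 / (4 * t)) * hker t (δ + 2 * k * π) -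
      (if k = 0 then δ else 0)‖ ≤ exp (-(A / t)) *
      ((2 * π * |(k : ℝ)| + R) * exp (-(A * (k : ℝ) ^ 2 - 0 * |(k : ℝ)|))) := by
    intro k
    have e : Complex.exp (δ ^ 2 / (4 * t)) * hker t (δ + 2 * k * π) =
        (δ + 2 * k * π) * Complex.exp (((-(k * π / t) : ℝ) : ℂ) * (δ + k * π)) := by
      unfold hker
      rw [mul_left_comm, ← Complex.exp_add]
      congr 2
      push_cast
      field_simp
      ring
    rw [e]
    split_ifs with hk
    · subst hk
      simp only [Int.cast_zero, mul_zero, zero_mul, add_zero, zero_div, neg_zero,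
        Complex.ofReal_zero, Complex.exp_zero, mul_one, sub_self, norm_zero]
      positivity
    · rw [sub_zero, norm_mul, Complex.norm_exp, Complex.re_ofReal_mul, Complex.add_re,
        show ((k : ℂ) * π).re = k * π by
          rw [show ((k : ℂ) * π) = ((k * π : ℝ) : ℂ) by push_cast; rfl, Complex.ofReal_re],
        mul_left_comm, ← exp_add]
      have h2 : ‖δ + 2 * k * π‖ ≤ 2 * π * |(k : ℝ)| + R := by
        refine (norm_add_le _ _).trans ?_
        rw [show (2 * (k : ℂ) * π) = ((2 * k * π : ℝ) : ℂ) by push_cast; rfl, Complex.norm_real,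
          Real.norm_eq_abs, abs_mul, abs_mul, abs_two, abs_of_pos pi_pos]
        linarith
      have hk1 : 1 ≤ |(k : ℝ)| := by exact_mod_cast Int.one_le_abs hk
      have h3 : 2 * A * (k : ℝ) ^ 2 ≤ k * π * (δ.re + k * π) := by
        have h4 : -(k * δ.re) ≤ |(k : ℝ)| * α₁ := by
          refine (neg_le_abs _).trans ?_
          rw [abs_mul]
          gcongr
        have h5 := sq_abs (k : ℝ)
        have hα0 : 0 ≤ α₁ := (abs_nonneg _).trans hδ
        have h6 : |(k : ℝ)| * α₁ ≤ (k : ℝ) ^ 2 * α₁ := by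
          rw [← h5]; gcongr; nlinarith
        have : 2 * A * (k : ℝ) ^ 2 = π * ((k : ℝ) ^ 2 * π - (k : ℝ) ^ 2 * α₁) := by rw [hA]; ring
        rw [this, show k * π * (δ.re + k * π) = π * ((k : ℝ) ^ 2 * π + k * δ.re) by ring]
        gcongr
        linarith
      have h7 : -(k * π / t) * (δ.re + k * π) ≤ -(A / t) +
          -(A * (k : ℝ) ^ 2 - 0 * |(k : ℝ)|) := by
        have hk2 : 1 ≤ (k : ℝ) ^ 2 := by rw [← sq_abs]; nlinarith
        rw [show -(k * π / t) * (δ.re + k * π) = -(k * π * (δ.re + k * π)) / t by ring,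
          div_le_iff₀ ht, add_mul, neg_mul, div_mul_cancel₀ _ ht.ne']
        have h8 : A * (k : ℝ) ^ 2 * t ≤ A * (k : ℝ) ^ 2 * 1 := by gcongr
        have h9 : A * 1 ≤ A * (k : ℝ) ^ 2 := by gcongr
        linarith
      have := exp_le_exp.2 h7
      gcongr
  have h2 := h1.norm_le_of_bounded (hW.mul_left _) hb
  refine h2.trans ?_
  rw [mul_comm]
  gcongr
  linarith [le_abs_self W]

theorem summable_qser (u : ℂ) {t : ℝ} (ht : 0 < t) : Summable fun m : ℕ =>
    ((m : ℂ) + 1) * Complex.exp (-((m : ℂ) * (m + 2)) * t) * chi m u u := by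
  obtain ⟨δ, rfl⟩ := Complex.cos_surjective u
  have hs := (summable_int_gaussian 1 1 (‖δ‖ + 1) ht).comp_injective Nat.cast_injective
  refine Summable.of_norm_bounded hs fun m => ?_
  have h1 : ‖chi m (Complex.cos δ) (Complex.cos δ)‖ ≤ (m + 1) * exp (m * ‖δ‖) := by
    rw [chi_exp m δ (two_mul _).symm]
    refine (norm_sum_le _ _).trans ?_
    refine (Finset.sum_le_card_nsmul _ _ (exp (m * ‖δ‖)) fun x hx => ?_).trans ?_
    · refine (Complex.norm_exp_le_exp_norm _).trans (exp_le_exp.2 ?_)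
      rw [norm_mul, norm_mul, Complex.norm_I, mul_one]
      gcongr
      have hx' : (x.1 : ℝ) + x.2 = m := by
        exact_mod_cast Finset.HasAntidiagonal.mem_antidiagonal.1 hx
      rw [show ((x.1 : ℂ) - x.2) = ((x.1 - x.2 : ℝ) : ℂ) by push_cast; rfl, Complex.norm_real,
        Real.norm_eq_abs, abs_le]
      have := (x.1.cast_nonneg : (0 : ℝ) ≤ x.1)
      have := (x.2.cast_nonneg : (0 : ℝ) ≤ x.2)
      constructor <;> linarith
    · rw [Finset.Nat.card_antidiagonal, nsmul_eq_mul]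
      push_cast; rfl
  have h2 : ‖((m : ℂ) + 1)‖ = m + 1 := by
    rw [show ((m : ℂ) + 1) = ((m + 1 : ℝ) : ℂ) by push_cast; rfl, Complex.norm_real,
      Real.norm_eq_abs, abs_of_nonneg (by positivity)]
  have h3 : ‖Complex.exp (-((m : ℂ) * (m + 2)) * t)‖ = exp (-((m : ℝ) * (m + 2)) * t) := by
    rw [show (-((m : ℂ) * (m + 2)) * t) = ((-((m : ℝ) * (m + 2)) * t : ℝ) : ℂ) by
      push_cast; rfl, Complex.norm_exp, Complex.ofReal_re]
  have h4 : (m : ℝ) + 1 ≤ exp m := add_one_le_exp _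
  have hm : (0 : ℝ) ≤ m := m.cast_nonneg
  rw [norm_mul, norm_mul, h2, h3]
  simp only [Function.comp_apply, Int.cast_natCast, abs_of_nonneg hm, one_mul]
  calc (m + 1) * exp (-((m : ℝ) * (m + 2)) * t) * ‖chi m (Complex.cos δ) (Complex.cos δ)‖
      ≤ (m + 1) * exp (-((m : ℝ) * (m + 2)) * t) * (exp m * exp (m * ‖δ‖)) := by
        gcongr
        exact h1.trans (by gcongr)
    _ = (m + 1) * exp (-((m : ℝ) * (m + 2)) * t + m + m * ‖δ‖) := by
        rw [exp_add, exp_add]; ring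
    _ ≤ _ := by
        gcongr
        nlinarith [mul_nonneg hm ht.le]

/-- Only measurability of the integrand is required by dominated convergence, and it follows from
pointwise convergence of the partial sums. -/
theorem measurable_qser {t : ℝ} (ht : 0 < t) : Measurable (qser t) := by
  refine measurable_of_tendsto_metrizable (f := fun n u => ∑ m ∈ Finset.range n,
    ((m : ℂ) + 1) * Complex.exp (-((m : ℂ) * (m + 2)) * t) * chi m u u) (fun n => ?_) ?_
  · refine Continuous.measurable (continuous_finsetSum _ fun m _ => ?_)
    refine continuous_const.mul ?_
    unfold chi disc
    fun_prop
  · rw [tendsto_pi_nhds]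
    exact fun u => (summable_qser u ht).hasSum.tendsto_sum_nat

/-! ### The quadratic expansion of the phase at the saddle point -/

/-- The holomorphic branch of `arccos (c cos w)` near a real point. -/
theorem exists_branch {c θ a : ℝ} (ha : sin a ≠ 0) (h : cos a = c * cos θ) :
    ∃ D : ℂ → ℂ, D θ = a ∧ ∀ᶠ w in 𝓝 (θ : ℂ), Complex.cos (D w) = c * Complex.cos w ∧
      HasDerivAt D (c * Complex.sin w / Complex.sin (D w)) w := by
  have hs : -Complex.sin (a : ℂ) ≠ 0 := by
    rw [← Complex.ofReal_sin]; exact neg_ne_zero.2 (by exact_mod_cast ha)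
  have hf := (Complex.hasStrictDerivAt_cos (a : ℂ)).hasStrictFDerivAt_equiv hs
  set e := hf.toOpenPartialHomeomorph Complex.cos with he
  have hcoe : (e : ℂ → ℂ) = Complex.cos := rfl
  have hsrc : (a : ℂ) ∈ e.source := hf.mem_toOpenPartialHomeomorph_source
  have htgt : (c * Complex.cos θ : ℂ) ∈ e.target := by
    have := e.map_source hsrc
    rw [hcoe, ← Complex.ofReal_cos, h] at this
    push_cast at this
    exact this
  have hval : e.symm (c * Complex.cos θ : ℂ) = a := by
    have := e.left_inv hsrc
    rw [hcoe, ← Complex.ofReal_cos, h] at this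
    push_cast at this
    exact this
  have hcont : ContinuousAt (fun w : ℂ => (c : ℂ) * Complex.cos w) θ := by fun_prop
  have hDc : ContinuousAt (fun w : ℂ => e.symm ((c : ℂ) * Complex.cos w)) θ :=
    ContinuousAt.comp (f := fun w : ℂ => (c : ℂ) * Complex.cos w) (e.symm.continuousAt htgt) hcont
  have h1 : ∀ᶠ w in 𝓝 (θ : ℂ), (c * Complex.cos w : ℂ) ∈ e.target :=
    hcont.eventually_mem (e.open_target.mem_nhds htgt)
  have h2 : ∀ᶠ w in 𝓝 (θ : ℂ), -Complex.sin (e.symm (c * Complex.cos w)) ≠ 0 := by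
    have h3 : ContinuousAt (fun w : ℂ => -Complex.sin (e.symm (c * Complex.cos w))) θ :=
      (Complex.continuous_sin.continuousAt.comp hDc).neg
    refine h3.eventually_ne ?_
    rw [hval]; exact hs
  refine ⟨fun w => e.symm (c * Complex.cos w), hval, ?_⟩
  filter_upwards [h1, h2] with w hw1 hw2
  refine ⟨?_, ?_⟩
  · have := e.right_inv hw1
    rwa [hcoe] at this
  · have h3 := e.hasDerivAt_symm hw1 hw2 (by rw [hcoe]; exact Complex.hasDerivAt_cos _)
    have h4 : HasDerivAt (fun w : ℂ => (c : ℂ) * Complex.cos w) (c * -Complex.sin w) w :=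
      (Complex.hasDerivAt_cos w).const_mul _
    refine (h3.comp w h4).congr_deriv ?_
    field_simp

/-- Second order Taylor expansion at a critical point. -/
theorem isLittleO_sq_of_hasDerivAt {F F' : ℂ → ℂ} {x m : ℂ}
    (hF : ∀ᶠ w in 𝓝 x, HasDerivAt F (F' w) w) (h0 : F' x = 0) (h1 : HasDerivAt F' m x) :
    (fun w => F w - F x - m * (w - x) ^ 2 / 2) =o[𝓝 x] fun w => (w - x) ^ 2 := by
  rw [isLittleO_iff]
  intro ε hε
  have h2 := h1.isLittleO.def hε
  obtain ⟨ρ, hρ, hb⟩ := Metric.eventually_nhds_iff_ball.1 (hF.and h2)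
  refine Metric.eventually_nhds_iff_ball.2 ⟨ρ, hρ, fun w hw => ?_⟩
  have hsub : ∀ v ∈ Metric.closedBall x ‖w - x‖, v ∈ Metric.ball x ρ := fun v hv => by
    rw [Metric.mem_ball, dist_eq_norm] at *
    rw [Metric.mem_closedBall, dist_eq_norm] at hv
    linarith
  have hd : ∀ v ∈ Metric.closedBall x ‖w - x‖,
      HasDerivWithinAt (fun w => F w - F x - m * (w - x) ^ 2 / 2) (F' v - m * (v - x))
        (Metric.closedBall x ‖w - x‖) v := fun v hv => by
    have h3 := (hb v (hsub v hv)).1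
    have h4 : HasDerivAt (fun w => m * (w - x) ^ 2 / 2) (m * (v - x)) v := by
      have := ((((hasDerivAt_id v).sub_const x).fun_pow 2).const_mul m).div_const 2
      refine this.congr_deriv ?_
      simp only [id]
      push_cast
      ring
    exact ((h3.sub_const _).fun_sub h4).hasDerivWithinAt
  have hbd : ∀ v ∈ Metric.closedBall x ‖w - x‖, ‖F' v - m * (v - x)‖ ≤ ε * ‖w - x‖ := fun v hv => by
    have h3 := (hb v (hsub v hv)).2
    rw [h0, sub_zero, smul_eq_mul, mul_comm] at h3
    refine h3.trans ?_
    rw [Metric.mem_closedBall, dist_eq_norm] at hv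
    gcongr
  have h5 := (convex_closedBall x ‖w - x‖).norm_image_sub_le_of_norm_hasDerivWithin_le hd hbd
    (Metric.mem_closedBall_self (norm_nonneg _)) (show w ∈ Metric.closedBall x ‖w - x‖ by
      rw [Metric.mem_closedBall, dist_eq_norm])
  simp only [sub_self] at h5
  rw [norm_pow, sq ‖w - x‖, ← mul_assoc]
  simpa using h5

/-- The curvature of the phase at its critical point. -/
noncomputable def curv (c a : ℝ) : ℝ := (1 - cos a * a / sin a) * (1 - c ^ 2) / sin a ^ 2

/-- The hypothesis `hcrit` is the vanishing of the first derivative of `D w ^ 2 - (w - z) ^ 2` at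
`θ`; its second derivative is `-2 curv c a`. On the vertical line `(w - θ) ^ 2` is negative, so
positive curvature yields a decaying Gaussian. -/
theorem phase_isLittleO {c θ z a : ℝ} (ha : sin a ≠ 0) (h : cos a = c * cos θ)
    (hcrit : θ - z = c * sin θ * (a / sin a)) {D : ℂ → ℂ} (hD0 : D θ = a)
    (hD : ∀ᶠ w in 𝓝 (θ : ℂ), HasDerivAt D (c * Complex.sin w / Complex.sin (D w)) w) :
    (fun w => D w ^ 2 - (w - z) ^ 2 - (a ^ 2 - (θ - z) ^ 2) + curv c a * (w - θ) ^ 2)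
      =o[𝓝 (θ : ℂ)] fun w => (w - θ) ^ 2 := by
  have hs : Complex.sin (a : ℂ) ≠ 0 := by rw [← Complex.ofReal_sin]; exact_mod_cast ha
  have hF : ∀ᶠ w in 𝓝 (θ : ℂ), HasDerivAt (fun w => D w ^ 2 - (w - z) ^ 2)
      (2 * (D w * (c * Complex.sin w / Complex.sin (D w)) - (w - z))) w := by
    filter_upwards [hD] with w hw
    have h1 := (hw.fun_pow 2).fun_sub (((hasDerivAt_id w).sub_const (z : ℂ)).fun_pow 2)
    refine h1.congr_deriv ?_
    simp only [id]
    push_cast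
    ring
  have h0 : (2 * (D θ * (c * Complex.sin θ / Complex.sin (D θ)) - (θ - z)) : ℂ) = 0 := by
    rw [hD0]
    have : ((θ : ℂ) - z) = c * Complex.sin θ * (a / Complex.sin a) := by exact_mod_cast hcrit
    rw [this]
    ring
  have hd := hD.self_of_nhds
  have h1 : HasDerivAt (fun w => 2 * (D w * (c * Complex.sin w / Complex.sin (D w)) - (w - z)))
      (-(2 * curv c a)) (θ : ℂ) := by
    have h2 := ((hd.fun_mul (((Complex.hasDerivAt_sin (θ : ℂ)).const_mul (c : ℂ)).fun_div
      hd.csin (by rw [hD0]; exact hs))).fun_sub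
      ((hasDerivAt_id (θ : ℂ)).sub_const (z : ℂ))).const_mul (2 : ℂ)
    refine h2.congr_deriv ?_
    simp only [hD0, curv]
    push_cast
    have e1 : (c : ℂ) * Complex.cos θ = Complex.cos a := by exact_mod_cast h.symm
    have e2 : Complex.sin (a : ℂ) ^ 2 + Complex.cos (a : ℂ) ^ 2 = 1 := Complex.sin_sq_add_cos_sq _
    have e3 : Complex.sin (θ : ℂ) ^ 2 + Complex.cos (θ : ℂ) ^ 2 = 1 := Complex.sin_sq_add_cos_sq _
    have e4 : (c : ℂ) ^ 2 * Complex.sin θ ^ 2 = c ^ 2 - Complex.cos a ^ 2 := by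
      rw [← e1]; linear_combination (c ^ 2 : ℂ) * e3
    rw [e1]
    field_simp
    linear_combination (Complex.sin a - a * Complex.cos a) * (e4 - e2)
  have h3 := isLittleO_sq_of_hasDerivAt hF h0 h1
  refine h3.congr_left fun w => ?_
  rw [hD0]
  ring

theorem mul_cos_lt_sin {a : ℝ} (h0 : 0 < a) (hπ : a < π) : a * cos a < sin a := by
  have hs := sin_pos_of_pos_of_lt_pi h0 hπ
  rcases le_or_gt (cos a) 0 with h | h
  · nlinarith
  · have h1 : a < π / 2 := by
      by_contra! hle
      have := cos_nonpos_of_pi_div_two_le_of_le hle (by linarith)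
      linarith
    have := lt_tan h0 h1
    rwa [tan_eq_sin_div_cos, lt_div_iff₀ h] at this

theorem curv_pos {c a : ℝ} (hc0 : 0 < c) (hc1 : c < 1) (h0 : 0 < a) (hπ : a < π) :
    0 < curv c a := by
  have hs := sin_pos_of_pos_of_lt_pi h0 hπ
  have h1 := mul_cos_lt_sin h0 hπ
  have h2 : 0 < 1 - cos a * a / sin a := by
    rw [sub_pos, div_lt_one hs]; linarith
  have h3 : 0 < 1 - c ^ 2 := by nlinarith
  unfold curv
  positivity

/-! ### Laplace's method -/

theorem norm_gw (t θ z y : ℝ) : ‖gw t θ z y‖ = exp (((θ - z) ^ 2 - y ^ 2) / (4 * t)) := by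
  have h1 : (line θ y - z).re = θ - z := by rw [Complex.sub_re, line_re, Complex.ofReal_re]
  have h2 : (line θ y - z).im = y := by rw [Complex.sub_im, line_im, Complex.ofReal_im, sub_zero]
  rw [gw, Complex.norm_exp,
    show ((line θ y - z) ^ 2 / (4 * t) : ℂ) = (line θ y - z) ^ 2 / ((4 * t : ℝ) : ℂ) by
      push_cast; rfl, Complex.div_ofReal_re, sq, Complex.mul_re, h1, h2]
  ring_nf

/-- The rescaled and normalized integrand of the Laplace integral. -/
noncomputable def lapl (c θ z a t x : ℝ) : ℂ :=
  ((4 * t * √(t / π) * exp (-t) : ℝ) : ℂ) * ((exp ((a ^ 2 - (θ - z) ^ 2) / (4 * t)) : ℝ) : ℂ) *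
    (gw t θ z (√t * x) * qser t (c * Complex.cos (line θ (√t * x))))

theorem measurable_lapl (c θ z a : ℝ) {t : ℝ} (ht : 0 < t) : Measurable (lapl c θ z a t) := by
  have h1 : Continuous fun x : ℝ => line θ (√t * x) := (continuous_line θ).comp (by fun_prop)
  have h2 : Continuous fun x : ℝ => gw t θ z (√t * x) := (continuous_gw t θ z).comp (by fun_prop)
  have h3 : Continuous fun x : ℝ => (c : ℂ) * Complex.cos (line θ (√t * x)) := by fun_prop
  exact (h2.measurable.mul ((measurable_qser ht).comp h3.measurable)).const_mul _

/-- A zero of `sin δ` forces `cos δ = ±1`, hence `|c cos θ| cosh (√t x) = 1`, which at most two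
values of `x` satisfy. Off this null set the bound on the image sum can be divided by `‖sin δ‖`. -/
theorem ae_sin_ne_zero {c θ t : ℝ} (ht : 0 < t) :
    ∀ᵐ x : ℝ, ∀ δ : ℂ, Complex.cos δ = c * Complex.cos (line θ (√t * x)) → Complex.sin δ ≠ 0 := by
  have key : ∀ x : ℝ, (∃ δ : ℂ, Complex.cos δ = c * Complex.cos (line θ (√t * x)) ∧
      Complex.sin δ = 0) → |c * cos θ| * cosh (√t * x) = 1 := by
    rintro x ⟨δ, h1, h2⟩
    have h3 := Complex.sin_sq_add_cos_sq δ
    rw [h2, zero_pow two_ne_zero, zero_add, sq] at h3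
    have h4 : (c * Complex.cos (line θ (√t * x))).re = c * cos θ * cosh (√t * x) := by
      rw [Complex.re_ofReal_mul, (cos_re_im _).1, line_re, line_im, mul_assoc]
    rw [← h1] at h4
    have h5 : |c * cos θ * cosh (√t * x)| = 1 := by
      rcases mul_self_eq_one_iff.1 h3 with h | h <;> rw [← h4, h] <;> simp
    rwa [abs_mul, abs_of_pos (cosh_pos _)] at h5
  have hs : {x : ℝ | ¬∀ δ : ℂ, Complex.cos δ = c * Complex.cos (line θ (√t * x)) →
      Complex.sin δ ≠ 0}.Finite := by
    rcases Set.eq_empty_or_nonempty {x : ℝ | ¬∀ δ : ℂ,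
      Complex.cos δ = c * Complex.cos (line θ (√t * x)) → Complex.sin δ ≠ 0} with h | ⟨x₀, hx₀⟩
    · rw [h]; exact Set.finite_empty
    · refine (Set.toFinite {x₀, -x₀}).subset fun x hx => ?_
      simp only [mem_ofPred_eq, not_forall, not_not, exists_prop] at hx hx₀
      have h1 := key x hx
      have h2 := key x₀ hx₀
      have h3 : |c * cos θ| ≠ 0 := fun h => by rw [h, zero_mul] at h1; exact zero_ne_one h1
      have h4 := mul_left_cancel₀ h3 (h1.trans h2.symm)
      have h5 : |√t * x| = |√t * x₀| :=
        le_antisymm (cosh_le_cosh.1 h4.le) (cosh_le_cosh.1 h4.ge)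
      rw [abs_mul, abs_mul] at h5
      have h6 := mul_left_cancel₀ (abs_pos.2 (Real.sqrt_pos.2 ht).ne').ne' h5
      rcases abs_eq_abs.1 h6 with h | h
      · exact Or.inl h
      · exact Or.inr h
  exact hs.measure_zero _

/-- The uniform image bound is combined with the coercivity of the phase; since `t ≤ 1`, the
resulting decay in `y = √t x` over `t` dominates the decay in `x`. -/
theorem exists_norm_lapl_le_far {c θ η : ℝ} (z : ℝ) {a : ℝ} (hc0 : 0 < c) (hc1 : c < 1)
    (hη : 0 < η) (ha : arccos (c * cos θ) = a) :
    ∃ C ε : ℝ, 0 < C ∧ 0 < ε ∧ ∀ t : ℝ, 0 < t → t ≤ 1 → ∀ᵐ x : ℝ, η ≤ |√t * x| →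
      ‖lapl c θ z a t x‖ ≤ C * ((1 + |x|) ^ 2 * exp (-(ε * |x|))) := by
  obtain ⟨C, hC, hS⟩ := exists_norm_image_sum_le
  obtain ⟨ε, hε, hP⟩ := exists_phase_ge (θ := θ) hc0 hc1 hη
  refine ⟨C * (8 / (ε * η)), ε / 8, by positivity, by positivity, fun t ht ht1 => ?_⟩
  filter_upwards [ae_sin_ne_zero (c := c) (θ := θ) ht] with x hx hy
  obtain ⟨δ, h1, h2, h3⟩ := exists_cos_eq (c * Complex.cos (line θ (√t * x)))
  have hsin := hx δ h1
  have h4 := hS t δ _ ht ht1 h2 h3 (hasSum_hker δ ht)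
  have h5 := hP δ _ h2 h3 hy h1
  rw [ha] at h5
  have h6 : |δ.im| ≤ |√t * x| := by
    have := cosh_im_le_cosh hc0 hc1 h1
    rw [line_im] at this
    exact cosh_le_cosh.1 this
  have hst : √t ≤ 1 := Real.sqrt_le_one.2 ht1
  have hst0 : 0 < √t := Real.sqrt_pos.2 ht
  have hyx : |√t * x| = √t * |x| := by rw [abs_mul, abs_of_pos hst0]
  have h7 : |δ.im| ≤ |x| := h6.trans (by rw [hyx]; nlinarith [abs_nonneg x])
  rw [norm_mul, norm_mul, mul_assoc] at h4
  have h8 := le_of_mul_le_mul_left h4 (norm_pos_iff.2 hsin)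
  rw [h1] at h8
  set y := √t * x with hydef
  have h9 : ε * |x| ≤ ε * |y| / t := by
    rw [le_div_iff₀ ht, hyx, mul_assoc]
    have : |x| * t ≤ √t * |x| := by
      nlinarith [abs_nonneg x, Real.mul_self_sqrt ht.le]
    gcongr
  -- The factor `1 / t` of the image bound is absorbed by half of the exponential gain, available
  -- because `|y| ≥ η`.
  have h10 : 1 / t ≤ 8 / (ε * η) * exp (ε * η / (8 * t)) := by
    have := add_one_le_exp (ε * η / (8 * t))
    have h11 : ε * η / (8 * t) ≤ exp (ε * η / (8 * t)) := by linarith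
    calc 1 / t = 8 / (ε * η) * (ε * η / (8 * t)) := by field_simp
      _ ≤ _ := by gcongr
  rw [lapl, norm_mul, norm_mul, norm_mul, norm_gw, Complex.norm_real (exp _), Real.norm_eq_abs,
    abs_of_pos (exp_pos _), ← hydef]
  calc _ = exp ((a ^ 2 - (θ - z) ^ 2) / (4 * t)) * exp (((θ - z) ^ 2 - y ^ 2) / (4 * t)) *
        (‖qser t (c * Complex.cos (line θ y))‖ *
          ‖((4 * t * √(t / π) * exp (-t) : ℝ) : ℂ)‖) := by ring
    _ ≤ exp ((a ^ 2 - (θ - z) ^ 2) / (4 * t)) * exp (((θ - z) ^ 2 - y ^ 2) / (4 * t)) *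
        (C / t * (1 + |δ.im|) ^ 2 * exp (-(δ.re ^ 2 - δ.im ^ 2) / (4 * t))) := by gcongr
    _ = C * (1 + |δ.im|) ^ 2 * (1 / t) *
        exp (-(y ^ 2 - δ.im ^ 2 + δ.re ^ 2 - a ^ 2) / (4 * t)) := by
      have : exp (-(y ^ 2 - δ.im ^ 2 + δ.re ^ 2 - a ^ 2) / (4 * t)) =
          exp ((a ^ 2 - (θ - z) ^ 2) / (4 * t)) * exp (((θ - z) ^ 2 - y ^ 2) / (4 * t)) *
          exp (-(δ.re ^ 2 - δ.im ^ 2) / (4 * t)) := by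
        rw [← exp_add, ← exp_add]
        congr 1
        ring
      rw [this]; ring
    _ ≤ C * (1 + |x|) ^ 2 * (8 / (ε * η) * exp (ε * η / (8 * t))) *
        exp (-(ε * |y|) / (4 * t)) := by gcongr
    _ = C * (8 / (ε * η)) * ((1 + |x|) ^ 2 *
        exp (ε * η / (8 * t) + -(ε * |y|) / (4 * t))) := by rw [exp_add]; ring
    _ ≤ _ := by
      gcongr
      have h11 : ε * η / (8 * t) ≤ ε * |y| / (8 * t) := by gcongr
      have h12 : ε * η / (8 * t) + -(ε * |y|) / (4 * t) ≤ -(ε * |y| / t) / 8 := by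
        refine (add_le_add_left h11 _).trans (le_of_eq ?_)
        field_simp
        ring
      linarith

/-- This separates the phase from the image sum normalised by its leading exponential, which is the
quantity that converges to `δ`. -/
theorem lapl_eq {c θ z a t x : ℝ} {δ : ℂ} (hs : Complex.sin δ ≠ 0)
    (hδ : Complex.cos δ = c * Complex.cos (line θ (√t * x))) :
    lapl c θ z a t x = Complex.exp (-(δ ^ 2 - (line θ (√t * x) - z) ^ 2 -
      (a ^ 2 - (θ - z) ^ 2)) / (4 * t)) * (Complex.exp (δ ^ 2 / (4 * t)) *
        (Complex.sin δ * qser t (Complex.cos δ) * ((4 * t * √(t / π) * exp (-t) : ℝ) : ℂ)) /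
          Complex.sin δ) := by
  have e : Complex.exp (-(δ ^ 2 - (line θ (√t * x) - z) ^ 2 - (a ^ 2 - (θ - z) ^ 2)) / (4 * t)) *
      Complex.exp (δ ^ 2 / (4 * t)) = gw t θ z (√t * x) *
        ((exp ((a ^ 2 - (θ - z) ^ 2) / (4 * t)) : ℝ) : ℂ) := by
    rw [gw, Complex.ofReal_exp, ← Complex.exp_add, ← Complex.exp_add]
    push_cast
    congr 1
    ring
  rw [mul_div_assoc, ← mul_assoc, e, hδ, lapl]
  field_simp

/-- The Laplace method for the rescaled integrand at the critical angle. -/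
theorem tendsto_integral_lapl {c θ z a : ℝ} (hc0 : 0 < c) (hc1 : c < 1) (ha0 : 0 < a) (haπ : a < π)
    (h : cos a = c * cos θ) (hcrit : θ - z = c * sin θ * (a / sin a)) :
    Tendsto (fun t => ∫ x, lapl c θ z a t x) (𝓝[>] 0)
      (𝓝 ((a / sin a * √(4 * π / curv c a) : ℝ) : ℂ)) := by
  have hs := sin_pos_of_pos_of_lt_pi ha0 haπ
  set κ := curv c a with hκdef
  have hκ : 0 < κ := curv_pos hc0 hc1 ha0 haπ
  obtain ⟨D, hD0, hD⟩ := exists_branch hs.ne' h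
  have hDθ : ContinuousAt D θ := (hD.self_of_nhds).2.continuousAt
  set G : ℂ → ℂ := fun w => D w ^ 2 - (w - z) ^ 2 - (a ^ 2 - (θ - z) ^ 2) + κ * (w - θ) ^ 2
    with hGdef
  have hG : G =o[𝓝 (θ : ℂ)] fun w => (w - θ) ^ 2 :=
    phase_isLittleO hs.ne' h hcrit hD0 (hD.mono fun w hw => hw.2)
  have hsinD : ContinuousAt (fun w => Complex.sin (D w)) θ :=
    Complex.continuous_sin.continuousAt.comp hDθ
  have hreD : ContinuousAt (fun w => |(D w).re|) θ :=
    (Complex.continuous_re.continuousAt.comp hDθ).abs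
  -- The threshold `(a + π) / 2` lies strictly between `a` and `π`, so near `θ` the branch `D` stays
  -- in the region where the zeroth image dominates.
  obtain ⟨C₁, b, hC₁, hb, hN⟩ := exists_norm_image_sum_sub_le (α₁ := (a + π) / 2) (R := a + 1)
    (by linarith)
  have ev : ∀ᶠ w in 𝓝 (θ : ℂ), Complex.cos (D w) = c * Complex.cos w ∧
      ‖G w‖ ≤ κ / 2 * ‖(w - θ) ^ 2‖ ∧ sin a / 2 ≤ ‖Complex.sin (D w)‖ ∧
      |(D w).re| ≤ (a + π) / 2 ∧ ‖D w‖ ≤ a + 1 := by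
    have e1 : ∀ᶠ w in 𝓝 (θ : ℂ), sin a / 2 ≤ ‖Complex.sin (D w)‖ := by
      refine (hsinD.norm.eventually_const_le ?_)
      beta_reduce
      rw [hD0, ← Complex.ofReal_sin, Complex.norm_real, Real.norm_eq_abs, abs_of_pos hs]
      linarith
    have e2 : ∀ᶠ w in 𝓝 (θ : ℂ), |(D w).re| ≤ (a + π) / 2 := by
      refine hreD.eventually_le_const ?_
      beta_reduce
      rw [hD0, Complex.ofReal_re, abs_of_pos ha0]
      linarith
    have e3 : ∀ᶠ w in 𝓝 (θ : ℂ), ‖D w‖ ≤ a + 1 := by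
      refine hDθ.norm.eventually_le_const ?_
      beta_reduce
      rw [hD0, Complex.norm_real, Real.norm_eq_abs, abs_of_pos ha0]
      linarith
    filter_upwards [hD, hG.def (half_pos hκ), e1, e2, e3] with w h1 h2 h3 h4 h5
    exact ⟨h1.1, h2, h3, h4, h5⟩
  obtain ⟨η, hη, hball⟩ := Metric.eventually_nhds_iff_ball.1 ev
  have hw (y : ℝ) : ‖line θ y - θ‖ = |y| := by simp [line]
  have hw2 (y : ℝ) : (line θ y - θ) ^ 2 = -(y ^ 2 : ℝ) := by
    simp [line, mul_pow]
  have hψ (t y : ℝ) : -(D (line θ y) ^ 2 - (line θ y - z) ^ 2 - (a ^ 2 - (θ - z) ^ 2)) / (4 * t) =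
      ((-(κ * y ^ 2) / (4 * t) : ℝ) : ℂ) - G (line θ y) / (4 * t) := by
    have : D (line θ y) ^ 2 - (line θ y - z) ^ 2 - (a ^ 2 - (θ - z) ^ 2) =
        G (line θ y) + κ * (y ^ 2 : ℝ) := by
      simp only [hGdef, hw2]; ring
    rw [this]
    push_cast
    ring
  set M : ℝ → ℝ → ℂ := fun t x => Complex.exp (D (line θ (√t * x)) ^ 2 / (4 * t)) *
        (Complex.sin (D (line θ (√t * x))) * qser t (Complex.cos (D (line θ (√t * x)))) *
          ((4 * t * √(t / π) * exp (-t) : ℝ) : ℂ)) with hMdef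
  have near (t x : ℝ) (ht : 0 < t) (ht1 : t ≤ 1) (hx : |√t * x| < η) :
      lapl c θ z a t x = Complex.exp (((-(κ * x ^ 2) / 4 : ℝ) : ℂ) -
        G (line θ (√t * x)) / (4 * t)) * (M t x / Complex.sin (D (line θ (√t * x)))) ∧
      ‖M t x - D (line θ (√t * x))‖ ≤ C₁ * exp (-(b / t)) ∧
      ‖G (line θ (√t * x))‖ ≤ κ / 2 * (t * x ^ 2) ∧
      sin a / 2 ≤ ‖Complex.sin (D (line θ (√t * x)))‖ ∧ ‖D (line θ (√t * x))‖ ≤ a + 1 := by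
    obtain ⟨h1, h2, h3, h4, h5⟩ := hball (line θ (√t * x)) (by
      rw [Metric.mem_ball, dist_eq_norm, hw]; exact hx)
    have hsq : (√t * x) ^ 2 = t * x ^ 2 := by rw [mul_pow, Real.sq_sqrt ht.le]
    have hsin : Complex.sin (D (line θ (√t * x))) ≠ 0 := by
      rw [← norm_pos_iff]; linarith
    refine ⟨?_, hN t _ _ ht ht1 h4 h5 (hasSum_hker _ ht), ?_, h3, h5⟩
    · rw [lapl_eq hsin h1, hψ, hsq]
      congr 4
      field_simp
    · rw [norm_pow, hw, sq_abs, hsq] at h2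
      exact h2
  obtain ⟨C₂, ε, hC₂, hε, far⟩ := exists_norm_lapl_le_far (θ := θ) (a := a) z hc0 hc1 hη
    (by rw [← h, arccos_cos ha0.le haπ.le])
  have hgauss : ∫ x : ℝ, Complex.exp (((-(κ * x ^ 2) / 4 : ℝ) : ℂ)) * ((a / sin a : ℝ) : ℂ) =
      ((a / sin a * √(4 * π / κ) : ℝ) : ℂ) := by
    rw [integral_mul_const]
    have : ∀ x : ℝ, Complex.exp ((-(κ * x ^ 2) / 4 : ℝ) : ℂ) =
        ((exp (-(κ / 4) * x ^ 2) : ℝ) : ℂ) := fun x => by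
      rw [← Complex.ofReal_exp]; congr 2; ring
    simp only [this]
    rw [integral_complex_ofReal, integral_gaussian, ← Complex.ofReal_mul, mul_comm]
    congr 3
    field_simp
  rw [← hgauss]
  have hev : ∀ᶠ t : ℝ in 𝓝[>] 0, 0 < t ∧ t ≤ 1 := by
    filter_upwards [Ioc_mem_nhdsGT (zero_lt_one' ℝ)] with t ht using ht
  refine tendsto_integral_filter_of_dominated_convergence
    -- The first term dominates near the saddle, where half of the curvature survives the error in
    -- the phase; the second dominates far from it.
    (fun x => (a + 1 + C₁) / (sin a / 2) * exp (-(κ / 8) * x ^ 2) +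
      C₂ * ((1 + |x|) ^ 2 * exp (-(ε * |x|)))) ?_ ?_ ?_ ?_
  · filter_upwards [hev] with t ht using (measurable_lapl c θ z a ht.1).aestronglyMeasurable
  · filter_upwards [hev] with t ht
    filter_upwards [far t ht.1 ht.2] with x hfar
    rcases lt_or_ge |√t * x| η with hx | hx
    · obtain ⟨h1, h2, h3, h4, h5⟩ := near t x ht.1 ht.2 hx
      refine le_add_of_le_of_nonneg ?_ (by positivity)
      rw [h1, norm_mul, norm_div, Complex.norm_exp, mul_comm]
      have h6 : ‖M t x‖ ≤ a + 1 + C₁ := by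
        have h7 : C₁ * exp (-(b / t)) ≤ C₁ * 1 := by
          gcongr
          rw [exp_le_one_iff]
          have := ht.1
          have : 0 < b / t := by positivity
          linarith
        have h8 := norm_sub_norm_le (M t x) (D (line θ (√t * x)))
        linarith
      have h7 : (((-(κ * x ^ 2) / 4 : ℝ) : ℂ) - G (line θ (√t * x)) / (4 * t)).re ≤
          -(κ / 8) * x ^ 2 := by
        rw [Complex.sub_re, Complex.ofReal_re, show (4 * t : ℂ) = ((4 * t : ℝ) : ℂ) by push_cast; rfl,
          Complex.div_ofReal_re]
        have h8 := (neg_le_abs _).trans ((Complex.abs_re_le_norm _).trans h3)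
        have h9 : -(κ / 2 * (t * x ^ 2)) / (4 * t) ≤ (G (line θ (√t * x))).re / (4 * t) := by
          have := ht.1
          gcongr
          linarith
        have h10 : -(κ / 2 * (t * x ^ 2)) / (4 * t) = -(κ / 8 * x ^ 2) := by
          have := ht.1.ne'
          field_simp
          ring
        linarith
      gcongr
    · exact le_add_of_nonneg_of_le (by positivity) (hfar hx)
  · exact ((integrable_exp_neg_mul_sq (by positivity)).const_mul _).add
      ((integrable_pow_mul_exp_abs hε 2).const_mul _)
  · refine Eventually.of_forall fun x => ?_
    have hy : Tendsto (fun t : ℝ => √t * x) (𝓝[>] 0) (𝓝 0) := by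
      have : Tendsto (fun t : ℝ => √t * x) (𝓝 0) (𝓝 (√0 * x)) :=
        (Real.continuous_sqrt.tendsto 0).mul_const x
      rw [Real.sqrt_zero, zero_mul] at this
      exact this.mono_left nhdsWithin_le_nhds
    have hl : Tendsto (fun t : ℝ => line θ (√t * x)) (𝓝[>] 0) (𝓝 (θ : ℂ)) := by
      have := ((continuous_line θ).tendsto 0).comp hy
      rwa [show line θ 0 = θ by simp [line]] at this
    have hDl : Tendsto (fun t : ℝ => D (line θ (√t * x))) (𝓝[>] 0) (𝓝 (a : ℂ)) := by
      have := hDθ.tendsto.comp hl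
      rwa [hD0] at this
    have hsl : Tendsto (fun t : ℝ => Complex.sin (D (line θ (√t * x)))) (𝓝[>] 0)
        (𝓝 (Complex.sin a)) := (Complex.continuous_sin.tendsto _).comp hDl
    have hevx : ∀ᶠ t : ℝ in 𝓝[>] 0, (0 < t ∧ t ≤ 1) ∧ |√t * x| < η := by
      have := (hy.abs).eventually_lt_const (by rwa [abs_zero] : |(0 : ℝ)| < η)
      exact hev.and this
    have hexp : Tendsto (fun t : ℝ => C₁ * exp (-(b / t))) (𝓝[>] 0) (𝓝 0) := by
      have h1 : Tendsto (fun t : ℝ => b / t) (𝓝[>] 0) atTop := by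
        simpa [div_eq_mul_inv] using tendsto_inv_nhdsGT_zero.const_mul_atTop hb
      simpa using (tendsto_exp_neg_atTop_nhds_zero.comp h1).const_mul C₁
    have hM : Tendsto (fun t => M t x) (𝓝[>] 0) (𝓝 (a : ℂ)) := by
      have h1 : Tendsto (fun t => M t x - D (line θ (√t * x))) (𝓝[>] 0) (𝓝 0) := by
        refine squeeze_zero_norm' ?_ hexp
        filter_upwards [hevx] with t ht using (near t x ht.1.1 ht.1.2 ht.2).2.1
      simpa using h1.add hDl
    -- The error is `o (t x ^ 2)` because the squared distance to `θ` is `t x ^ 2`, so dividing by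
    -- `4 t` leaves a quantity that tends to `0`.
    have hGl : Tendsto (fun t : ℝ => G (line θ (√t * x)) / (4 * t)) (𝓝[>] 0) (𝓝 0) := by
      have h1 : (fun t : ℝ => G (line θ (√t * x)) / (4 * t)) =o[𝓝[>] 0]
          fun t : ℝ => (line θ (√t * x) - θ) ^ 2 / (4 * t : ℂ) := by
        simp only [div_eq_mul_inv]
        exact (hG.comp_tendsto hl).mul_isBigO (isBigO_refl _ _)
      refine (isLittleO_one_iff ℝ).1 (h1.trans_isBigO (IsBigO.of_bound (x ^ 2 / 4) ?_))
      filter_upwards [hev] with t ht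
      have := ht.1
      rw [norm_div, norm_pow, hw, sq_abs, mul_pow, Real.sq_sqrt this.le,
        show (4 * t : ℂ) = ((4 * t : ℝ) : ℂ) by push_cast; rfl, Complex.norm_real, norm_one,
        Real.norm_eq_abs, abs_of_pos (by positivity)]
      refine le_of_eq ?_
      field_simp
    have hlim : Tendsto (fun t : ℝ => Complex.exp (((-(κ * x ^ 2) / 4 : ℝ) : ℂ) -
        G (line θ (√t * x)) / (4 * t)) * (M t x / Complex.sin (D (line θ (√t * x))))) (𝓝[>] 0)
        (𝓝 (Complex.exp (((-(κ * x ^ 2) / 4 : ℝ) : ℂ) - 0) * (a / Complex.sin a))) := by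
      refine Tendsto.mul ((Complex.continuous_exp.tendsto _).comp (hGl.const_sub _))
        (hM.div hsl ?_)
      rw [← Complex.ofReal_sin]
      exact_mod_cast hs.ne'
    rw [sub_zero, ← Complex.ofReal_sin, ← Complex.ofReal_div] at hlim
    refine hlim.congr' ?_
    filter_upwards [hevx] with t ht using (near t x ht.1.1 ht.1.2 ht.2).1.symm

/-! ### The critical angle and the final asymptotics -/

theorem abs_mul_cos_lt_one {c : ℝ} (hc0 : 0 < c) (hc1 : c < 1) (θ : ℝ) : |c * cos θ| < 1 := by
  rw [abs_mul, abs_of_pos hc0]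
  have := abs_cos_le_one θ
  nlinarith [abs_nonneg (cos θ)]

theorem arccos_mem_Ioo {u : ℝ} (hu : |u| < 1) : arccos u ∈ Ioo 0 π := by
  have h := abs_lt.1 hu
  refine ⟨arccos_pos.2 h.2, lt_of_le_of_ne (arccos_le_pi u) fun h1 => ?_⟩
  have := arccos_eq_pi.1 h1
  linarith

theorem cos_arccos_of_abs_lt {u : ℝ} (hu : |u| < 1) : cos (arccos u) = u :=
  cos_arccos (abs_lt.1 hu).1.le (abs_lt.1 hu).2.le

theorem IsHeatKernel.eq_integral_lapl {p : ℝ → SU2 → ℝ} (hp : IsHeatKernel p) (r ϑ z θ a : ℝ)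
    {t : ℝ} (ht : 0 < t) : p t (cyl r ϑ z) =
      √π * exp (-(a ^ 2 - (θ - z) ^ 2) / (4 * t)) / (4 * t ^ (3 / 2 : ℝ)) *
        (exp t * (∫ x, lapl (cos r) θ z a t x).re / (2 * √π)) := by
  have hst : 0 < √t := Real.sqrt_pos.2 ht
  have hsπ : 0 < √π := Real.sqrt_pos.2 pi_pos
  have h1 := hp.eq_integral r ϑ z θ ht
  set I := ∫ y, gw t θ z y * qser t (cos r * Complex.cos (line θ y)) with hI
  have h2 : (∫ x, lapl (cos r) θ z a t x) = (((4 * t * √(t / π) * exp (-t)) *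
      exp ((a ^ 2 - (θ - z) ^ 2) / (4 * t)) * (√t)⁻¹ : ℝ) : ℂ) * I := by
    unfold lapl
    rw [integral_const_mul, Measure.integral_comp_mul_left
      (fun y => gw t θ z y * qser t (cos r * Complex.cos (line θ y))) √t, ← hI,
      abs_of_pos (inv_pos.2 hst), Complex.real_smul]
    push_cast
    ring
  have h3 : t ^ (3 / 2 : ℝ) = t * √t := by
    rw [show (3 / 2 : ℝ) = 1 + 1 / 2 by norm_num, rpow_add ht, rpow_one, ← Real.sqrt_eq_rpow]
  have h4 : √(4 * π * t) = 2 * √π * √t := by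
    rw [Real.sqrt_mul (by positivity), Real.sqrt_mul (by norm_num),
      show (4 : ℝ) = 2 ^ 2 by norm_num, Real.sqrt_sq (by norm_num)]
  rw [h1, h2, ← Complex.ofReal_inv, Complex.re_ofReal_mul, Complex.re_ofReal_mul, h3, h4,
    Real.sqrt_div ht.le, exp_neg t, neg_div, exp_neg]
  have := exp_pos t
  have := exp_pos ((a ^ 2 - (θ - z) ^ 2) / (4 * t))
  have e := Real.sq_sqrt ht.le
  field_simp

/-- The factor `sin a` in `√(4π / curv)` cancels the denominator of `a / sin a`, and `1 - cos r ^ 2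
= sin r ^ 2` supplies the prefactor `1 / sin r`. -/
theorem IsHeatKernel.isEquivalent {p : ℝ → SU2 → ℝ} (hp : IsHeatKernel p) {r z θ a : ℝ}
    (hr : r ∈ Ioo 0 (π / 2)) (ha : a ∈ Ioo 0 π) (h : cos a = cos r * cos θ)
    (hcrit : θ - z = cos r * sin θ * (a / sin a)) (ϑ : ℝ) :
    (fun t : ℝ => p t (cyl r ϑ z)) ~[𝓝[>] 0] fun t : ℝ =>
      1 / sin r * (a / √(1 - cos a * a / sin a)) *
        (√π * exp (-(a ^ 2 - (θ - z) ^ 2) / (4 * t)) / (4 * t ^ (3 / 2 : ℝ))) := by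
  have hsr : 0 < sin r := sin_pos_of_pos_of_lt_pi hr.1 (by linarith [hr.2, pi_pos])
  have hc0 : 0 < cos r := cos_pos_of_mem_Ioo ⟨by linarith [hr.1, pi_pos], hr.2⟩
  have hc1 : cos r < 1 := by nlinarith [sin_sq_add_cos_sq r]
  have hsa := sin_pos_of_pos_of_lt_pi ha.1 ha.2
  have hq : 0 < 1 - cos a * a / sin a := by
    have := mul_cos_lt_sin ha.1 ha.2
    rw [sub_pos, div_lt_one hsa]; linarith
  have hsq := Real.sqrt_pos.2 hq
  have hsπ : 0 < √π := Real.sqrt_pos.2 pi_pos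
  have hlim := tendsto_integral_lapl hc0 hc1 ha.1 ha.2 h hcrit
  have hlim' : Tendsto (fun t => exp t * (∫ x, lapl (cos r) θ z a t x).re / (2 * √π)) (𝓝[>] 0)
      (𝓝 (1 / sin r * (a / √(1 - cos a * a / sin a)))) := by
    have h1 := (Complex.continuous_re.tendsto _).comp hlim
    have h2 : Tendsto exp (𝓝[>] 0) (𝓝 1) := by
      rw [← exp_zero]; exact (continuous_exp.tendsto 0).mono_left nhdsWithin_le_nhds
    have h3 := (h2.mul h1).div_const (2 * √π)
    have h5 : √(4 * π / curv (cos r) a) =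
        2 * √π * sin a / (√(1 - cos a * a / sin a) * sin r) := by
      rw [← Real.sqrt_sq (by positivity :
        0 ≤ 2 * √π * sin a / (√(1 - cos a * a / sin a) * sin r)), curv, ← sin_sq, div_pow, mul_pow,
        mul_pow, mul_pow, Real.sq_sqrt pi_pos.le, Real.sq_sqrt hq.le]
      congr 1
      have := hq.ne'
      generalize 1 - cos a * a / sin a = q at this
      field_simp
      norm_num
    rw [Complex.ofReal_re, h5] at h3
    have h6 : 1 / sin r * (a / √(1 - cos a * a / sin a)) = 1 * (a / sin a *
        (2 * √π * sin a / (√(1 - cos a * a / sin a) * sin r))) / (2 * √π) := by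
      generalize √(1 - cos a * a / sin a) = q at hsq
      field_simp
    rw [h6]
    exact h3
  have hne : 1 / sin r * (a / √(1 - cos a * a / sin a)) ≠ 0 := by
    have := ha.1
    positivity
  have h4 := (IsEquivalent.refl (u := fun t : ℝ =>
    √π * exp (-(a ^ 2 - (θ - z) ^ 2) / (4 * t)) / (4 * t ^ (3 / 2 : ℝ)))
      (l := 𝓝[>] 0)).mul ((isEquivalent_const_iff_tendsto hne).2 hlim')
  refine (h4.congr_left ?_).congr_right ?_
  · filter_upwards [self_mem_nhdsWithin] with t ht
    exact (hp.eq_integral_lapl r ϑ z θ a ht).symm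
  · exact Eventually.of_forall fun t => mul_comm _ _

/-- The critical equation is half the derivative of the phase up to sign, so its own derivative is
the curvature. Positivity of `curv` makes the equation strictly monotone in `θ`. -/
theorem hasDerivAt_critical {c : ℝ} (hc0 : 0 < c) (hc1 : c < 1) (θ : ℝ) :
    HasDerivAt (fun θ => θ - c * sin θ * (arccos (c * cos θ) / sin (arccos (c * cos θ))))
      (curv c (arccos (c * cos θ))) θ := by
  have hu := abs_mul_cos_lt_one hc0 hc1 θ
  have ha := arccos_mem_Ioo hu
  have hcos := cos_arccos_of_abs_lt hu
  have hs := sin_pos_of_pos_of_lt_pi ha.1 ha.2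
  have hA : HasDerivAt (fun θ => arccos (c * cos θ)) (c * sin θ / sin (arccos (c * cos θ))) θ := by
    have h1 := (hasDerivAt_arccos (abs_lt.1 hu).1.ne' (abs_lt.1 hu).2.ne).comp θ
      ((hasDerivAt_cos θ).const_mul c)
    refine h1.congr_deriv ?_
    rw [sin_arccos]
    ring
  have h2 := (hasDerivAt_id θ).fun_sub
    (((hasDerivAt_sin θ).const_mul c).fun_mul (hA.fun_div hA.sin hs.ne'))
  refine h2.congr_deriv ?_
  set a := arccos (c * cos θ)
  unfold curv
  have e2 := sin_sq_add_cos_sq a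
  have e4 : c ^ 2 * sin θ ^ 2 = c ^ 2 - cos a ^ 2 := by
    rw [hcos]; linear_combination c ^ 2 * sin_sq_add_cos_sq θ
  rw [← hcos]
  field_simp
  linear_combination -(sin a - a * cos a) * (e4 - e2)

theorem isCriticalAngle_iff {r z θ : ℝ} : IsCriticalAngle r z θ ↔ θ ∈ Icc (-π) π ∧
    θ - z = cos r * sin θ * (arccos (cos r * cos θ) / sin (arccos (cos r * cos θ))) := by
  rw [IsCriticalAngle, sin_arccos, mul_comm (cos θ), mul_pow]

theorem existsUnique_isCriticalAngle {r z : ℝ} (hr : r ∈ Ioo 0 (π / 2)) (hz : z ∈ Icc (-π) π) :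
    ∃! θ : ℝ, IsCriticalAngle r z θ := by
  have hsr : 0 < sin r := sin_pos_of_pos_of_lt_pi hr.1 (by linarith [hr.2, pi_pos])
  have hc0 : 0 < cos r := cos_pos_of_mem_Ioo ⟨by linarith [hr.1, pi_pos], hr.2⟩
  have hc1 : cos r < 1 := by nlinarith [sin_sq_add_cos_sq r]
  simp only [isCriticalAngle_iff]
  set f : ℝ → ℝ := fun θ =>
    θ - cos r * sin θ * (arccos (cos r * cos θ) / sin (arccos (cos r * cos θ))) with hf
  have hd := hasDerivAt_critical hc0 hc1
  have hmono : StrictMono f := strictMono_of_deriv_pos fun θ => by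
    have ha := arccos_mem_Ioo (abs_mul_cos_lt_one hc0 hc1 θ)
    rw [(hd θ).deriv]
    exact curv_pos hc0 hc1 ha.1 ha.2
  have hcont : Continuous f := continuous_iff_continuousAt.2 fun θ => (hd θ).continuousAt
  -- The function fixes both endpoints `±π`, so the intermediate value theorem reaches every `z` of
  -- the interval.
  have h1 : f π = π := by simp [hf]
  have h2 : f (-π) = -π := by simp [hf]
  have hivt := intermediate_value_Icc (by linarith [pi_pos] : -π ≤ π) hcont.continuousOn
  rw [h1, h2] at hivt
  obtain ⟨θ, hθ, hfθ⟩ := hivt hz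
  refine ⟨θ, ⟨hθ, by simp only [hf] at hfθ; linarith⟩, fun θ' hθ' => hmono.injective ?_⟩
  rw [hfθ]
  simp only [hf]
  linarith [hθ'.2]

/-- The Laplace exponent is rewritten with the critical equation: with `a` the arccosine, `sin a ^ 2
- cos r ^ 2 * sin θ ^ 2 = sin r ^ 2`, so both sides equal `a ^ 2 * sin r ^ 2 / sin a ^ 2`. When `sin
θ = 0` that equation gives `θ = z`, and the conventional value of `expo` is the correct one. -/
theorem expo_eq {r z θ : ℝ} (hr : r ∈ Ioo 0 (π / 2)) (h : IsCriticalAngle r z θ) :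
    expo r z θ = arccos (cos r * cos θ) ^ 2 - (θ - z) ^ 2 := by
  have hc0 : 0 < cos r := cos_pos_of_mem_Ioo ⟨by linarith [hr.1, pi_pos], hr.2⟩
  have hsr : 0 < sin r := sin_pos_of_pos_of_lt_pi hr.1 (by linarith [hr.2, pi_pos])
  have hc1 : cos r < 1 := by nlinarith [sin_sq_add_cos_sq r]
  have hcrit := (isCriticalAngle_iff.1 h).2
  have hu := abs_mul_cos_lt_one hc0 hc1 θ
  have ha := arccos_mem_Ioo hu
  have hcos := cos_arccos_of_abs_lt hu
  have hs := sin_pos_of_pos_of_lt_pi ha.1 ha.2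
  unfold expo
  split_ifs with h0
  · rw [hcrit, h0]; ring
  · rw [hcrit, tan_eq_sin_div_cos]
    set a := arccos (cos r * cos θ)
    have e2 := sin_sq_add_cos_sq a
    have e4 : cos r ^ 2 * sin θ ^ 2 = cos r ^ 2 - cos a ^ 2 := by
      rw [hcos]; linear_combination cos r ^ 2 * sin_sq_add_cos_sq θ
    have e5 := sin_sq_add_cos_sq r
    field_simp
    linear_combination a ^ 2 * (e4 - e2 + e5)

theorem IsHeatKernel.isEquivalent_of_isCriticalAngle {p : ℝ → SU2 → ℝ} (hp : IsHeatKernel p)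
    {r z θ : ℝ} (hr : r ∈ Ioo 0 (π / 2)) (h : IsCriticalAngle r z θ) (ϑ : ℝ) :
    (fun t : ℝ => p t (cyl r ϑ z)) ~[𝓝[>] 0] fun t : ℝ =>
      1 / sin r * (arccos (cos r * cos θ) / √(1 - cos r * cos θ * arccos (cos r * cos θ) /
        √(1 - (cos r * cos θ) ^ 2))) *
        (√π * exp (-expo r z θ / (4 * t)) / (4 * t ^ (3 / 2 : ℝ))) := by
  have hc0 : 0 < cos r := cos_pos_of_mem_Ioo ⟨by linarith [hr.1, pi_pos], hr.2⟩
  have hsr : 0 < sin r := sin_pos_of_pos_of_lt_pi hr.1 (by linarith [hr.2, pi_pos])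
  have hc1 : cos r < 1 := by nlinarith [sin_sq_add_cos_sq r]
  have hu := abs_mul_cos_lt_one hc0 hc1 θ
  have hcos := cos_arccos_of_abs_lt hu
  have := hp.isEquivalent hr (arccos_mem_Ioo hu) hcos (isCriticalAngle_iff.1 h).2 ϑ
  rw [hcos, sin_arccos] at this
  rwa [expo_eq hr h]

theorem isCriticalAngle_zero (r : ℝ) : IsCriticalAngle r 0 0 := by
  refine ⟨⟨by linarith [pi_pos], pi_pos.le⟩, ?_⟩
  simp

theorem IsHeatKernel.isEquivalent_zero {p : ℝ → SU2 → ℝ} (hp : IsHeatKernel p) (ϑ : ℝ)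
    {r : ℝ} (hr : r ∈ Ioo 0 (π / 2)) :
    (fun t : ℝ => p t (cyl r ϑ 0)) ~[𝓝[>] 0] fun t : ℝ =>
      r / sin r * √(1 / (1 - r * cot r)) *
        (√π * exp (-r ^ 2 / (4 * t)) / (4 * t ^ (3 / 2 : ℝ))) := by
  have hsr : 0 < sin r := sin_pos_of_pos_of_lt_pi hr.1 (by linarith [hr.2, pi_pos])
  have h := hp.isEquivalent_of_isCriticalAngle hr (isCriticalAngle_zero r) ϑ
  have hexpo : expo r 0 0 = r ^ 2 := by
    rw [expo_eq hr (isCriticalAngle_zero r), cos_zero, mul_one,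
      arccos_cos hr.1.le (by linarith [hr.2, pi_pos])]
    ring
  rw [hexpo, cos_zero, mul_one, arccos_cos hr.1.le (by linarith [hr.2, pi_pos]),
    ← sin_sq, Real.sqrt_sq hsr.le] at h
  convert h using 3
  rw [cot_eq_cos_div_sin, Real.sqrt_div zero_le_one, Real.sqrt_one,
    show r * (cos r / sin r) = cos r * r / sin r by ring]
  ring

end SU2

theorem proposition3p9 (p : ℝ → SU2 → ℝ) (hp : SU2.IsHeatKernel p) :
    -- the points `(0, z)`: exact series formula, and its consequence as `t → 0+`
    (∀ ϑ z t : ℝ, z ∈ Icc 0 π → 0 < t →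
      HasSum (fun k : ℤ =>
        π ^ 2 * exp t / (4 * t ^ 2) * exp (-(2 * π * z - z ^ 2) / (4 * t)) *
          (exp (-((k : ℝ) * (k + 1) * π ^ 2 / t)) *
            ((2 * (k : ℝ) + 1 + 2 * (k : ℝ) * exp (-(π / (2 * t) * (z + 2 * k * π)))) /
              (1 + exp (-(π / (2 * t) * (z + 2 * k * π)))) ^ 2)))
        (p t (SU2.cyl 0 ϑ z))) ∧
    (∀ ϑ z : ℝ, z ∈ Ioc 0 π → ∃ C : ℝ, 0 < C ∧
      (fun t : ℝ => p t (SU2.cyl 0 ϑ z) /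
          (π ^ 2 * exp t / (4 * t ^ 2) * exp (-(2 * π * z - z ^ 2) / (4 * t))) - 1)
        =O[𝓝[>] 0] fun t : ℝ => exp (-C / t)) ∧
    -- the points `(r, 0)`, `r ≠ 0`
    (∀ ϑ r : ℝ, r ∈ Ioo 0 (π / 2) →
      (fun t : ℝ => p t (SU2.cyl r ϑ 0)) ~[𝓝[>] 0] fun t : ℝ =>
        r / sin r * √(1 / (1 - r * cot r)) *
          (√π * exp (-r ^ 2 / (4 * t)) / (4 * t ^ (3 / 2 : ℝ)))) ∧
    -- the points `(r, z)`, `r ≠ 0`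
    (∀ r z : ℝ, r ∈ Ioo 0 (π / 2) → z ∈ Icc (-π) π →
      (∃! θ : ℝ, SU2.IsCriticalAngle r z θ) ∧
      ∀ θ u : ℝ, SU2.IsCriticalAngle r z θ → u = cos r * cos θ → ∀ ϑ : ℝ,
        (fun t : ℝ => p t (SU2.cyl r ϑ z)) ~[𝓝[>] 0] fun t : ℝ =>
          1 / sin r * (arccos u / √(1 - u * arccos u / √(1 - u ^ 2))) *
            (√π * exp (-SU2.expo r z θ / (4 * t)) / (4 * t ^ (3 / 2 : ℝ)))) := by
  refine ⟨fun ϑ z t hz ht => ?_, fun ϑ z hz => ?_, fun ϑ r hr => hp.isEquivalent_zero ϑ hr,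
    fun r z hr hz => ⟨SU2.existsUnique_isCriticalAngle hr hz, fun θ u hθ hu ϑ => ?_⟩⟩
  · exact hp.hasSum_axis ϑ z ht
  · exact ⟨π * z / 2, by have := hz.1; positivity, hp.axis_isBigO ϑ hz⟩
  · rw [hu]
    exact hp.isEquivalent_of_isCriticalAngle hr hθ ϑ
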